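/- Let $k$ be a field and $G$ a finite group of order $n$ prime to the exponential characteristic of $k$, and assume that $k$ contains all $n$-th roots of unity. Put $\Lambda=\mathbb{Z}[1/n]$, and let $\Gamma$ be a set of representatives for the conjugacy classes of cyclic subgroups of $G$. For a cyclic subgroup $\sigma\subset G$ of order $m$ let $\hat\sigma=\mathrm{Hom}(\sigma,k^*)$, let $t$ be a generator of $\hat\sigma$, and let $R\sigma=K_0(\sigma,\mathrm{Spec}\,k)\otimes\Lambda\cong\Lambda\hat\sigma\cong\Lambda[t]/(t^m-1)\cong\prod_{d\mid m}\Lambda[t]/(\Phi_d(t))$ be its representation ring, where $\Phi_d$ is the $d$-th cyclotomic polynomial. Let $\tilde R\sigma\subset R\sigma$ be the factor $\Lambda[t]/(\Phi_m(t))$; it does not depend on the choice of $t$. Let $X=\coprod_y \mathrm{Spec}\,k(y)$ be a $0$-dimensional scheme over $k$, a disjoint union of spectra of fields, with a left action of $G$ by $k$-automorphisms that permutes its points transitively. For a subgroup $H\subset G$ acting on a scheme $Y$, $K_0(H,Y)$ denotes the Grothendieck group of $H$-equivariant coherent sheaves on $Y$, and $K_0(Y)=K_0(1,Y)$. For $\sigma\in\Gamma$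 let $X^\sigma\subset X$ be the fixed point subscheme (the largest closed subscheme on which $\sigma$ acts trivially). The normalizer $N(\sigma)$ of $\sigma$ in $G$ acts on $K_0(X^\sigma)$ by push-forward along automorphisms of $X^\sigma$, on $\tilde R\sigma$ through conjugation on $\sigma$, and diagonally on $K_0(X^\sigma)\otimes\tilde R\sigma$. Let $$\alpha_0(X):\prod_{\sigma\in\Gamma}\bigl(K_0(X^\sigma)\otimes\tilde R\sigma\bigr)^{N(\sigma)}\longrightarrow K_0(G,X)\otimes\Lambda$$ be Vistoli's map: on the factor of $\sigma$ it is the composition of the inclusion into $K_0(X^\sigma)\otimes R\sigma$, the isomorphism $K_0(X^\sigma)\otimes R\sigma\cong K_0(\sigma,X^\sigma)\otimes\Lambda$, $[\mathcal F]\otimes\chi\mapsto[\mathcal F\otimes_k\chi]$, the push-forward to $K_0(\sigma,X)\otimes\Lambda$ along the closed embedding $X^\sigma\hookrightarrow X$, and the induction map to $K_0(G,X)\otimes\Lambda$, that is the push-forward along $(X\times G)/\sigma\to X$ after the identification $K_0(\sigma,X)\cong K_0(G,(X\times G)/\sigma)$; these maps are summed over $\sigma\in\Gamma$. Then $\alpha_0(X)$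 is an isomorphism of $\Lambda$-modules. -/

import Mathlib

open CategoryTheory AlgebraicGeometry TensorProduct

universe u

noncomputable section

namespace VistoliK

/-! ### Equivariant coherent sheaves on an affine scheme

An affine scheme `Spec A` with a left action of a group `H` is given by the commutative ring `A` of
its global functions together with `ρ : H →* RingAut A`, where `ρ h` is the pullback of functions
along the automorphism `h⁻¹` of `Spec A`. -/

/-- An `H`-equivariant coherent sheaf on the (noetherian) affine scheme `Spec A`: a finitely
generated `A`-module `M` with a semilinear action of `H`, that is `h (a m) = (h a) (h m)`. -/
structure EquivSheaf {H : Type u} [Group H] {A : Type u} [CommRing A] (ρ : H →* RingAut A) where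
  carrier : Type u
  [addCommGroup : AddCommGroup carrier]
  [module : Module A carrier]
  [finite : Module.Finite A carrier]
  act : H →* AddMonoid.End carrier
  act_smul : ∀ (h : H) (a : A) (m : carrier), act h (a • m) = ρ h a • act h m

attribute [instance] EquivSheaf.addCommGroup EquivSheaf.module EquivSheaf.finite

namespace EquivSheaf

variable {H : Type u} [Group H] {A : Type u} [CommRing A] {ρ : H →* RingAut A}

/-- The `A`-linear map `f` commutes with the actions of `H`. -/
def IsEquivariant {M N : EquivSheaf ρ} (f : M.carrier →ₗ[A] N.carrier) : Prop :=
  ∀ h m, f (M.act h m) = N.act h (f m)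

/-- `0 → M → N → P → 0` is a short exact sequence of equivariant coherent sheaves. -/
structure IsShortExact {M N P : EquivSheaf ρ} (f : M.carrier →ₗ[A] N.carrier)
    (g : N.carrier →ₗ[A] P.carrier) : Prop where
  equivariant_left : IsEquivariant f
  equivariant_right : IsEquivariant g
  injective : Function.Injective f
  exact : Function.Exact f g
  surjective : Function.Surjective g

end EquivSheaf

section K0

variable {H : Type u} [Group H] {A : Type u} [CommRing A]

/-- The relations `[N] = [M] + [P]`, one for each short exact sequence `0 → M → N → P → 0`. -/
def exactRelations (ρ : H →* RingAut A) : AddSubgroup (FreeAbelianGroup (EquivSheaf ρ)) :=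
  AddSubgroup.closure {x | ∃ (M N P : EquivSheaf ρ) (f : M.carrier →ₗ[A] N.carrier)
    (g : N.carrier →ₗ[A] P.carrier), EquivSheaf.IsShortExact f g ∧
      x = FreeAbelianGroup.of N - (FreeAbelianGroup.of M + FreeAbelianGroup.of P)}

/-- `K₀(H, Spec A)`: the Grothendieck group of the abelian category of `H`-equivariant coherent
sheaves on `Spec A`. -/
abbrev EquivK0 (ρ : H →* RingAut A) : Type (u + 1) :=
  FreeAbelianGroup (EquivSheaf ρ) ⧸ exactRelations ρ

/-- The class of an equivariant coherent sheaf. -/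
def EquivK0.mk {ρ : H →* RingAut A} (M : EquivSheaf ρ) : EquivK0 ρ :=
  QuotientAddGroup.mk (FreeAbelianGroup.of M)

/-- The ordinary (non-equivariant) group `K₀(Spec A)`. -/
abbrev OrdK0 (A : Type u) [CommRing A] : Type (u + 1) := EquivK0 (1 : PUnit.{u + 1} →* RingAut A)

theorem EquivK0.mk_eq_add {ρ : H →* RingAut A} {M N P : EquivSheaf ρ}
    {f : M.carrier →ₗ[A] N.carrier} {g : N.carrier →ₗ[A] P.carrier}
    (h : EquivSheaf.IsShortExact f g) : EquivK0.mk N = EquivK0.mk M + EquivK0.mk P := by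
  have : (QuotientAddGroup.mk (FreeAbelianGroup.of N -
      (FreeAbelianGroup.of M + FreeAbelianGroup.of P)) : EquivK0 ρ) = 0 :=
    (QuotientAddGroup.eq_zero_iff _).2 (AddSubgroup.subset_closure ⟨M, N, P, f, g, h, rfl⟩)
  exact sub_eq_zero.1 this

/-- An operation on equivariant coherent sheaves is exact if it carries short exact sequences to
short exact sequences. -/
def IsExactOn {H' : Type u} [Group H'] {A' : Type u} [CommRing A'] {ρ : H →* RingAut A}
    {ρ' : H' →* RingAut A'} (F : EquivSheaf ρ → EquivSheaf ρ') : Prop :=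
  ∀ (M N P : EquivSheaf ρ) (f : M.carrier →ₗ[A] N.carrier) (g : N.carrier →ₗ[A] P.carrier),
    EquivSheaf.IsShortExact f g →
      ∃ (f' : (F M).carrier →ₗ[A'] (F N).carrier) (g' : (F N).carrier →ₗ[A'] (F P).carrier),
        EquivSheaf.IsShortExact f' g'

/-- The homomorphism `[M] ↦ [F M]` of Grothendieck groups induced by an exact operation `F`. -/
def EquivK0.map {H' : Type u} [Group H'] {A' : Type u} [CommRing A'] {ρ : H →* RingAut A}
    {ρ' : H' →* RingAut A'} (F : EquivSheaf ρ → EquivSheaf ρ') (hF : IsExactOn F) :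
    EquivK0 ρ →+ EquivK0 ρ' :=
  QuotientAddGroup.lift (exactRelations ρ)
    (FreeAbelianGroup.lift fun M => EquivK0.mk (F M)) (by
      rw [exactRelations, AddSubgroup.closure_le]
      rintro _ ⟨M, N, P, f, g, h, rfl⟩
      obtain ⟨f', g', h'⟩ := hF M N P f g h
      simp [EquivK0.mk_eq_add h'])

theorem EquivK0.map_mk {H' : Type u} [Group H'] {A' : Type u} [CommRing A'] {ρ : H →* RingAut A}
    {ρ' : H' →* RingAut A'} (F : EquivSheaf ρ → EquivSheaf ρ') (hF : IsExactOn F)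
    (M : EquivSheaf ρ) : EquivK0.map F hF (EquivK0.mk M) = EquivK0.mk (F M) := by
  simp [EquivK0.map, EquivK0.mk]

end K0

/-! ### Push-forward along finite equivariant morphisms -/

section Pushforward

variable {H : Type u} [Group H] {A B : Type u} [CommRing A] [CommRing B]
  {ρA : H →* RingAut A} {ρB : H →* RingAut B}

/-- Push-forward along the finite `H`-equivariant morphism `Spec B → Spec A` given by `φ : A → B`:
the same group, with `A` acting through `φ`. -/
def EquivSheaf.pushforward (φ : A →+* B) (hfin : φ.Finite)
    (hφ : ∀ h a, φ (ρA h a) = ρB h (φ a)) (M : EquivSheaf ρB) : EquivSheaf ρA where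
  carrier := M.carrier
  addCommGroup := M.addCommGroup
  module := Module.compHom M.carrier φ
  finite := by
    let := φ.toAlgebra
    let : Module A M.carrier := Module.compHom M.carrier φ
    have : IsScalarTower A B M.carrier := ⟨fun a b m => mul_smul (φ a) b m⟩
    have : Module.Finite A B := hfin
    exact Module.Finite.trans B M.carrier
  act := M.act
  act_smul h a m := by
    refine (M.act_smul h (φ a) m).trans ?_
    rw [← hφ]
    rfl

theorem EquivSheaf.isExactOn_pushforward (φ : A →+* B) (hfin : φ.Finite)
    (hφ : ∀ h a, φ (ρA h a) = ρB h (φ a)) :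
    IsExactOn (EquivSheaf.pushforward (ρA := ρA) (ρB := ρB) φ hfin hφ) := by
  intro M N P f g h
  refine ⟨{ toFun := f, map_add' := f.map_add, map_smul' := fun a m => f.map_smul (φ a) m },
    { toFun := g, map_add' := g.map_add, map_smul' := fun a m => g.map_smul (φ a) m },
    ⟨h.equivariant_left, h.equivariant_right, h.injective, h.exact, h.surjective⟩⟩

end Pushforward

/-! ### Induction -/

section Induction

variable {G : Type u} [Group G] {A : Type u} [CommRing A] (ρ : G →* RingAut A) (H : Subgroup G)

/-- The group underlying the induced sheaf: the functions `f : G → M` with `f (x h) = h⁻¹ f x`.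
These are the `H`-invariant sections of the pullback of `M` to `X × G`, where `X = Spec A` and
`h (y, x) = (h y, x h⁻¹)`, that is the sections on `(X × G) / H` of the sheaf given by `M`. -/
def induced (M : EquivSheaf (ρ.comp H.subtype)) : AddSubgroup (G → M.carrier) where
  carrier := {f | ∀ (x : G) (h : H), f (x * h) = M.act h⁻¹ (f x)}
  add_mem' := fun hf hf' x h => by simp [hf x h, hf' x h]
  zero_mem' := fun x h => by simp
  neg_mem' := fun hf x h => by simp [hf x h]

namespace induced

variable {ρ H} {M : EquivSheaf (ρ.comp H.subtype)}

/-- A function `a` on `X` acts through the map `(y, x) ↦ x y` from `(X × G) / H` to `X`: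
`(a f) x = (x⁻¹ a) (f x)`. -/
instance : SMul A (induced ρ H M) where
  smul a f := ⟨fun x => ρ x⁻¹ a • f.1 x, fun x h => by
    change ρ (x * h)⁻¹ a • f.1 (x * h) = M.act h⁻¹ (ρ x⁻¹ a • f.1 x)
    rw [f.2 x h, M.act_smul]
    simp [mul_inv_rev]⟩

@[simp] theorem smul_apply (a : A) (f : induced ρ H M) (x : G) :
    (a • f).1 x = ρ x⁻¹ a • f.1 x := rfl

instance : Module A (induced ρ H M) where
  one_smul f := by ext x; simp
  mul_smul a b f := by ext x; simp [mul_smul]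
  smul_zero a := by ext x; simp
  smul_add a f f' := by ext x; simp
  add_smul a b f := by ext x; simp [add_smul]
  zero_smul f := by ext x; simp

open scoped Classical in
/-- The function supported on `c H` with value `m` at `c`. -/
def single (c : G) (m : M.carrier) : induced ρ H M :=
  ⟨fun x => if h : c⁻¹ * x ∈ H then M.act (⟨c⁻¹ * x, h⟩ : H)⁻¹ m else 0, fun x h => by
    have key : c⁻¹ * (x * h) ∈ H ↔ c⁻¹ * x ∈ H := by
      rw [← mul_assoc]; exact H.mul_mem_cancel_right h.2
    by_cases hx : c⁻¹ * x ∈ H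
    · have hx' := key.2 hx
      have e : (⟨c⁻¹ * (x * h), hx'⟩ : H) = ⟨c⁻¹ * x, hx⟩ * h :=
        Subtype.ext (mul_assoc _ _ _).symm
      simp only [hx, hx', dite_true, e, mul_inv_rev, map_mul]
      rfl
    · have hx' : c⁻¹ * (x * h) ∉ H := fun h' => hx (key.1 h')
      beta_reduce
      rw [dif_neg hx', dif_neg hx, map_zero]⟩

theorem single_apply_self (c : G) (m : M.carrier) : (single (ρ := ρ) (H := H) c m).1 c = m := by
  have h : c⁻¹ * c ∈ H := by simp
  have e : (⟨c⁻¹ * c, h⟩ : H) = 1 := Subtype.ext (by simp)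
  simp only [single, h, dite_true, e, inv_one, map_one]
  rfl

theorem single_apply_of_notMem (c x : G) (m : M.carrier) (h : c⁻¹ * x ∉ H) :
    (single (ρ := ρ) (H := H) c m).1 x = 0 := by
  simp [single, h]

theorem single_add (c : G) (m m' : M.carrier) :
    single (ρ := ρ) (H := H) c (m + m') = single c m + single c m' := by
  ext x
  by_cases h : c⁻¹ * x ∈ H <;> simp [single, h]

theorem single_smul (c : G) (a : A) (m : M.carrier) :
    single (ρ := ρ) (H := H) c (a • m) = ρ c a • single c m := by
  ext x
  by_cases h : c⁻¹ * x ∈ H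
  · simp [single, h, M.act_smul]
  · simp [single, h]

/-- Two elements that agree on coset representatives are equal. -/
theorem ext_out {f f' : induced ρ H M} (h : ∀ q : G ⧸ H, f.1 q.out = f'.1 q.out) : f = f' := by
  ext x
  have e : ((QuotientGroup.mk x : G ⧸ H).out)⁻¹ * x ∈ H :=
    QuotientGroup.eq.1 (Quotient.out_eq' (QuotientGroup.mk x : G ⧸ H))
  have hx : x = (QuotientGroup.mk x : G ⧸ H).out *
      (⟨((QuotientGroup.mk x : G ⧸ H).out)⁻¹ * x, e⟩ : H) := by simp
  rw [hx, f.2, f'.2, h]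

theorem eq_sum_single [Fintype (G ⧸ H)] (f : induced ρ H M) :
    f = ∑ q : G ⧸ H, single q.out (f.1 q.out) := by
  refine ext_out fun r => ?_
  have : (∑ q : G ⧸ H, single (ρ := ρ) (H := H) q.out (f.1 q.out)).1 r.out =
      ∑ q : G ⧸ H, (single (ρ := ρ) (H := H) q.out (f.1 q.out)).1 r.out := by
    rw [AddSubgroup.val_finsetSum, Finset.sum_apply]
  rw [this, Finset.sum_eq_single r]
  · exact (single_apply_self _ _).symm
  · intro q _ hq
    refine single_apply_of_notMem _ _ _ fun h => hq ?_
    have := QuotientGroup.eq.2 h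
    simpa using this
  · simp

instance [Finite G] : Module.Finite A (induced ρ H M) := by
  classical
  have := Fintype.ofFinite (G ⧸ H)
  obtain ⟨S, hS⟩ := (Module.Finite.fg_top : (⊤ : Submodule A M.carrier).FG)
  let T : Set (induced ρ H M) := ⋃ q : G ⧸ H, (fun m => single q.out m) '' (S : Set M.carrier)
  have hT : T.Finite := Set.finite_iUnion fun q => S.finite_toSet.image _
  have mem (c : G ⧸ H) (m : M.carrier) : single c.out m ∈ Submodule.span A T := by
    have hm : m ∈ Submodule.span A (S : Set M.carrier) := hS ▸ Submodule.mem_top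
    induction hm using Submodule.span_induction with
    | mem y hy => exact Submodule.subset_span (Set.mem_iUnion.2 ⟨c, y, hy, rfl⟩)
    | zero =>
      have := single_add (ρ := ρ) (H := H) c.out (0 : M.carrier) 0
      rw [add_zero, left_eq_add] at this
      rw [this]
      exact Submodule.zero_mem _
    | add y z _ _ hy hz => rw [single_add]; exact Submodule.add_mem _ hy hz
    | smul a y _ hy => rw [single_smul]; exact Submodule.smul_mem _ _ hy
  refine ⟨⟨hT.toFinset, ?_⟩⟩
  rw [Set.Finite.coe_toFinset, eq_top_iff]
  intro f _
  rw [eq_sum_single f]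
  exact Submodule.sum_mem _ fun q _ => mem q _

/-- The action of `G`: `(g f) x = f (g⁻¹ x)`. -/
def translate : G →* AddMonoid.End (induced ρ H M) where
  toFun g :=
    { toFun := fun f => ⟨fun x => f.1 (g⁻¹ * x), fun x h => by
        change f.1 (g⁻¹ * (x * h)) = M.act h⁻¹ (f.1 (g⁻¹ * x))
        rw [← mul_assoc, f.2]⟩
      map_zero' := rfl
      map_add' := fun _ _ => rfl }
  map_one' := by
    refine AddMonoidHom.ext fun f => Subtype.ext (funext fun x => ?_)
    change f.1 (1⁻¹ * x) = f.1 x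
    simp
  map_mul' g g' := by
    refine AddMonoidHom.ext fun f => Subtype.ext (funext fun x => ?_)
    change f.1 ((g * g')⁻¹ * x) = f.1 (g'⁻¹ * (g⁻¹ * x))
    simp [mul_assoc]

/-- The map between induced modules given by an equivariant map. -/
def map {N : EquivSheaf (ρ.comp H.subtype)} (φ : M.carrier →ₗ[A] N.carrier)
    (hφ : EquivSheaf.IsEquivariant φ) : induced ρ H M →ₗ[A] induced ρ H N where
  toFun f := ⟨fun x => φ (f.1 x), fun x h => by
    change φ (f.1 (x * h)) = N.act h⁻¹ (φ (f.1 x))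
    rw [f.2 x h, hφ]⟩
  map_add' f f' := by ext x; simp
  map_smul' a f := by ext x; simp

end induced

/-- The induced sheaf `Ind_H^G M`, with `G` acting by `(g f) x = f (g⁻¹ x)`: the push-forward along
`(X × G) / H → X`, `(y, x) ↦ x y`, of the `G`-equivariant sheaf that corresponds to `M`. -/
def EquivSheaf.ind [Finite G] (M : EquivSheaf (ρ.comp H.subtype)) : EquivSheaf ρ where
  carrier := induced ρ H M
  act := induced.translate
  act_smul g a f := by
    refine Subtype.ext (funext fun x => ?_)
    change ρ (g⁻¹ * x)⁻¹ a • f.1 (g⁻¹ * x) = ρ x⁻¹ (ρ g a) • f.1 (g⁻¹ * x)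
    rw [mul_inv_rev, inv_inv, map_mul]
    rfl

theorem EquivSheaf.isExactOn_ind [Finite G] : IsExactOn (EquivSheaf.ind ρ H) := by
  classical
  intro M N P f g h
  have := Fintype.ofFinite (G ⧸ H)
  refine ⟨induced.map f h.equivariant_left, induced.map g h.equivariant_right,
    ⟨fun s u => rfl, fun s u => rfl, ?_, ?_, ?_⟩⟩
  · intro u v huv
    exact Subtype.ext (funext fun x => h.injective (congrFun (congrArg Subtype.val huv) x))
  · intro v
    constructor
    · intro hv
      have hv' (x : G) : ∃ m, f m = v.1 x :=
        (h.exact (v.1 x)).1 (congrFun (congrArg Subtype.val hv) x)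
      choose m hm using hv'
      refine ⟨⟨m, fun x s => h.injective ?_⟩, Subtype.ext (funext hm)⟩
      rw [hm, v.2, h.equivariant_left, hm]
    · rintro ⟨u, rfl⟩
      exact Subtype.ext (funext fun x => h.exact.apply_apply_eq_zero (u.1 x))
  · intro p
    choose m hm using fun q : G ⧸ H => h.surjective (p.1 q.out)
    refine ⟨∑ q : G ⧸ H, (induced.single q.out (m q) : induced ρ H N),
      induced.ext_out fun r => ?_⟩
    change g ((∑ q : G ⧸ H, (induced.single q.out (m q) : induced ρ H N)).1 r.out) = _
    rw [AddSubgroup.val_finsetSum, Finset.sum_apply, Finset.sum_eq_single r,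
      induced.single_apply_self, hm]
    · intro q _ hq
      refine induced.single_apply_of_notMem _ _ _ fun h => hq ?_
      simpa using QuotientGroup.eq.2 h
    · simp

end Induction

/-! ### Twisting by a character -/

section Twist

variable {k : Type u} [Field k] {σ : Type u} [Group σ] {B : Type u} [CommRing B]

/-- The sheaf `M ⊗ₖ χ` on `Spec B`, for a trivial action of `σ` on `Spec B`: the module `M`, on
which `s ∈ σ` acts as the scalar `χ s ∈ k`. The ring homomorphism `κ` is the `k`-algebra structure
of `B`. -/
def EquivSheaf.twist (κ : k →+* B) (χ : σ →* kˣ)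
    (M : EquivSheaf (1 : PUnit.{u + 1} →* RingAut B)) : EquivSheaf (1 : σ →* RingAut B) where
  carrier := M.carrier
  act :=
    { toFun := fun s => DistribSMul.toAddMonoidHom M.carrier (κ (χ s))
      map_one' := by
        refine AddMonoidHom.ext fun m => ?_
        change κ ((χ 1 : kˣ) : k) • m = m
        simp
      map_mul' := fun s t => by
        refine AddMonoidHom.ext fun m => ?_
        change κ ((χ (s * t) : kˣ) : k) • m = κ (χ s) • κ (χ t) • m
        simp [mul_smul] }
  act_smul s a m := by
    change κ (χ s) • a • m = a • κ (χ s) • m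
    exact smul_comm _ _ _

theorem EquivSheaf.isExactOn_twist (κ : k →+* B) (χ : σ →* kˣ) :
    IsExactOn (EquivSheaf.twist κ χ) := by
  intro M N P f g h
  exact ⟨f, g, ⟨fun s m => f.map_smul _ m, fun s m => g.map_smul _ m, h.injective, h.exact,
    h.surjective⟩⟩

end Twist

/-! ### Fixed point subschemes -/

section FixedPoints

variable {G : Type u} [Group G] {A : Type u} [CommRing A] (ρ : G →* RingAut A) (σ : Subgroup G)

/-- The ideal of the fixed point subscheme `X^σ` of `X = Spec A`, the largest closed subscheme on
which `σ` acts trivially. -/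
def fixedIdeal : Ideal A := Ideal.span {x | ∃ s ∈ σ, ∃ a, x = ρ s a - a}

/-- The ring of functions of the fixed point subscheme `X^σ`. -/
abbrev FixedRing : Type u := A ⧸ fixedIdeal ρ σ

theorem mk_act_eq (s : σ) (a : A) :
    Ideal.Quotient.mk (fixedIdeal ρ σ) (ρ.comp σ.subtype s a) =
      (1 : σ →* RingAut (FixedRing ρ σ)) s (Ideal.Quotient.mk (fixedIdeal ρ σ) a) :=
  Ideal.Quotient.eq.2 (Ideal.subset_span ⟨s, s.2, a, rfl⟩)

theorem fixedIdeal_le_comap (g : Subgroup.normalizer (σ : Set G)) :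
    fixedIdeal ρ σ ≤ (fixedIdeal ρ σ).comap (ρ (g : G) : A ≃+* A).toRingHom := by
  rw [fixedIdeal, Ideal.span_le]
  rintro _ ⟨s, hs, a, rfl⟩
  refine Ideal.subset_span ⟨g * s * g⁻¹, (g.2 s).1 hs, ρ g a, ?_⟩
  change ρ g (ρ s a - a) = _
  rw [map_sub]
  congr 1
  rw [← RingAut.mul_apply, ← RingAut.mul_apply, ← map_mul, ← map_mul]
  simp

/-- The action of `g ∈ N(σ)` on the functions of `X^σ`. -/
def fixedAct (g : Subgroup.normalizer (σ : Set G)) : FixedRing ρ σ →+* FixedRing ρ σ :=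
  Ideal.quotientMap _ (ρ (g : G) : A ≃+* A).toRingHom (fixedIdeal_le_comap ρ σ g)

theorem fixedAct_surjective (g : Subgroup.normalizer (σ : Set G)) :
    Function.Surjective (fixedAct ρ σ g) :=
  Ideal.quotientMap_surjective (ρ (g : G)).surjective

/-- The action of `g ∈ N(σ)` on `K₀(X^σ)`: push-forward along the automorphism `g` of `X^σ`, for
which the pullback of functions is the action of `g⁻¹`. -/
def normalizerActK0 (g : Subgroup.normalizer (σ : Set G)) :
    OrdK0 (FixedRing ρ σ) →+ OrdK0 (FixedRing ρ σ) :=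
  EquivK0.map
    (EquivSheaf.pushforward (fixedAct ρ σ g⁻¹)
      (RingHom.Finite.of_surjective _ (fixedAct_surjective ρ σ g⁻¹)) fun _ _ => rfl)
    (EquivSheaf.isExactOn_pushforward _ _ _)

/-- Push-forward `K₀(σ, X^σ) → K₀(σ, X)` along the closed embedding of `X^σ` into `X`. -/
def closedPushforward : EquivK0 (1 : σ →* RingAut (FixedRing ρ σ)) →+
    EquivK0 (ρ.comp σ.subtype) :=
  EquivK0.map
    (EquivSheaf.pushforward (Ideal.Quotient.mk (fixedIdeal ρ σ))
      (RingHom.Finite.of_surjective _ Ideal.Quotient.mk_surjective) (mk_act_eq ρ σ))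
    (EquivSheaf.isExactOn_pushforward _ _ _)

/-- Induction `K₀(σ, X) → K₀(G, X)`. -/
def inductionK0 [Finite G] : EquivK0 (ρ.comp σ.subtype) →+ EquivK0 ρ :=
  EquivK0.map (EquivSheaf.ind ρ σ) (EquivSheaf.isExactOn_ind ρ σ)

end FixedPoints

/-! ### Representation rings of cyclic subgroups -/

section RepRing

variable (k : Type u) [Field k] {G : Type u} [Group G]

/-- The coefficient ring `Λ = ℤ[1/n]`, where `n` is the order of `G`. -/
def Coeff (G : Type u) [Group G] : Type := Localization.Away (Nat.card G : ℤ)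

instance : CommRing (Coeff G) := inferInstanceAs (CommRing (Localization.Away (Nat.card G : ℤ)))

instance : IsLocalization.Away (Nat.card G : ℤ) (Coeff G) := by
  let a : Algebra ℤ (Coeff G) := inferInstanceAs (Algebra ℤ (Localization.Away (Nat.card G : ℤ)))
  have h : @IsLocalization.Away ℤ _ (Nat.card G : ℤ) (Coeff G) _ a :=
    inferInstanceAs (IsLocalization.Away (Nat.card G : ℤ) (Localization.Away (Nat.card G : ℤ)))
  have e : a = Ring.toIntAlgebra (Coeff G) := Subsingleton.elim _ _
  exact e ▸ h

/-- The representation ring `Rσ = Λ[σ^]` of a cyclic subgroup `σ`, where `σ^ = Hom(σ, kˣ)`. -/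
abbrev RepRing (σ : Subgroup G) : Type u := MonoidAlgebra (Coeff G) (σ →* kˣ)

/-- The value `Φ_d(t)` in `Rσ` of the `d`-th cyclotomic polynomial. -/
def cyclotomicAt (σ : Subgroup G) (d : ℕ) (t : σ →* kˣ) : RepRing k σ :=
  Polynomial.aeval (MonoidAlgebra.of (Coeff G) (σ →* kˣ) t)
    (Polynomial.cyclotomic d (Coeff G))

/-- The factor `R̃σ` of `Rσ = Λ[t]/(t^m - 1) = ∏_{d ∣ m} Λ[t]/(Φ_d(t))` belonging to `Φ_m`, embedded
in `Rσ` as the ideal of the elements whose components in the factors `Λ[t]/(Φ_d(t))` vanish for all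
`d ∣ m`, `d ≠ m`. Here `m` is the order of `σ` and `t` is a generator of `σ^` (any of them gives the
same ideal). -/
def PrimitivePart (σ : Subgroup G) : Submodule (Coeff G) (RepRing k σ) where
  carrier := {x | ∀ t : σ →* kˣ, (∀ χ, χ ∈ Subgroup.zpowers t) →
    ∀ d ∈ (Nat.card σ).properDivisors, x ∈ Ideal.span {cyclotomicAt k σ d t}}
  add_mem' hx hy t ht d hd := Ideal.add_mem _ (hx t ht d hd) (hy t ht d hd)
  zero_mem' _ _ _ _ := Ideal.zero_mem _
  smul_mem' c _ hx t ht d hd := Submodule.smul_of_tower_mem _ c (hx t ht d hd)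

/-- The action of `g ∈ N(σ)` on characters: `(g χ) s = χ (g⁻¹ s g)`. -/
def normalizerActChar (σ : Subgroup G) (g : Subgroup.normalizer (σ : Set G)) :
    (σ →* kˣ) ≃* (σ →* kˣ) :=
  (σ.normalizerMonoidHom g).monoidHomCongrLeft

/-- The action of `g ∈ N(σ)` on `Rσ`. -/
def normalizerActRep (σ : Subgroup G) (g : Subgroup.normalizer (σ : Set G)) :
    RepRing k σ ≃ₐ[Coeff G] RepRing k σ :=
  MonoidAlgebra.domCongr (Coeff G) (Coeff G) (normalizerActChar k σ g)

theorem normalizerActRep_cyclotomicAt (σ : Subgroup G) (g : Subgroup.normalizer (σ : Set G))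
    (d : ℕ) (t : σ →* kˣ) :
    normalizerActRep k σ g (cyclotomicAt k σ d t) =
      cyclotomicAt k σ d (normalizerActChar k σ g t) := by
  rw [cyclotomicAt, cyclotomicAt, ← AlgEquiv.coe_toAlgHom, ← Polynomial.aeval_algHom_apply]
  congr 1
  simp [normalizerActRep]

theorem normalizerActRep_mem (σ : Subgroup G) (g : Subgroup.normalizer (σ : Set G))
    (x : RepRing k σ) (hx : x ∈ PrimitivePart k σ) :
    normalizerActRep k σ g x ∈ PrimitivePart k σ := by
  intro t ht d hd
  have key := hx ((normalizerActChar k σ g).symm t) (fun χ => by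
    obtain ⟨z, hz⟩ := Subgroup.mem_zpowers_iff.1 (ht (normalizerActChar k σ g χ))
    exact Subgroup.mem_zpowers_iff.2 ⟨z, (normalizerActChar k σ g).injective (by simpa using hz)⟩)
    d hd
  obtain ⟨y, hy⟩ := Ideal.mem_span_singleton'.1 key
  refine Ideal.mem_span_singleton'.2 ⟨normalizerActRep k σ g y, ?_⟩
  rw [← hy, map_mul, normalizerActRep_cyclotomicAt, MulEquiv.apply_symm_apply]

/-- The action of `g ∈ N(σ)` on `R̃σ`. -/
def normalizerActPrimitive (σ : Subgroup G) (g : Subgroup.normalizer (σ : Set G)) :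
    PrimitivePart k σ →ₗ[Coeff G] PrimitivePart k σ :=
  (normalizerActRep k σ g).toLinearMap.restrict (normalizerActRep_mem k σ g)

end RepRing

/-! ### Vistoli's map -/

section Map

variable {k : Type u} [Field k] {G : Type u} [Group G] {A : Type u} [CommRing A]
  (κ : k →+* A) (ρ : G →* RingAut A)

/-- The `Λ`-module `(R̃σ ⊗ K₀(X^σ))^{N(σ)}` of invariants under the diagonal action. -/
def invariants (k : Type u) [Field k] (ρ : G →* RingAut A) (σ : Subgroup G) :
    Submodule (Coeff G) (PrimitivePart k σ ⊗[ℤ] OrdK0 (FixedRing ρ σ)) where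
  carrier := {x | ∀ g : Subgroup.normalizer (σ : Set G),
    TensorProduct.AlgebraTensorModule.map (normalizerActPrimitive k σ g)
      (normalizerActK0 ρ σ g).toIntLinearMap x = x}
  add_mem' hx hy g := by rw [map_add, hx g, hy g]
  zero_mem' g := map_zero _
  smul_mem' c x hx g := by rw [map_smul, hx g]

/-- The natural map `Rσ ⊗ K₀(X^σ) → Λ ⊗ K₀(σ, X^σ)` (an isomorphism, as `σ` acts trivially on
`X^σ`): it carries `χ ⊗ [M]` to the class of `M ⊗ₖ χ`. -/
def trivialActionMap (σ : Subgroup G) :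
    RepRing k σ ⊗[ℤ] OrdK0 (FixedRing ρ σ) →ₗ[Coeff G]
      Coeff G ⊗[ℤ] EquivK0 (1 : σ →* RingAut (FixedRing ρ σ)) :=
  TensorProduct.AlgebraTensorModule.lift
    (Finsupp.linearCombination (Coeff G) (fun χ : σ →* kˣ =>
      TensorProduct.mk ℤ (Coeff G) (EquivK0 (1 : σ →* RingAut (FixedRing ρ σ))) 1 ∘ₗ
        (EquivK0.map (EquivSheaf.twist ((Ideal.Quotient.mk (fixedIdeal ρ σ)).comp κ) χ)
          (EquivSheaf.isExactOn_twist _ χ)).toIntLinearMap) ∘ₗ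
      (MonoidAlgebra.coeffLinearEquiv (Coeff G)).toLinearMap)

/-- The component of Vistoli's map at `σ`: the inclusion of the invariants, the inclusion of `R̃σ`
in `Rσ`, the identification of `Rσ ⊗ K₀(X^σ)` with `Λ ⊗ K₀(σ, X^σ)`, the push-forward to
`Λ ⊗ K₀(σ, X)`, and the induction to `Λ ⊗ K₀(G, X)`. -/
def vistoliComponent [Finite G] (σ : Subgroup G) :
    invariants k ρ σ →ₗ[Coeff G] Coeff G ⊗[ℤ] EquivK0 ρ :=
  (inductionK0 ρ σ).toIntLinearMap.baseChange (Coeff G) ∘ₗ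
    (closedPushforward ρ σ).toIntLinearMap.baseChange (Coeff G) ∘ₗ
      trivialActionMap κ ρ σ ∘ₗ
        TensorProduct.AlgebraTensorModule.map (PrimitivePart k σ).subtype LinearMap.id ∘ₗ
          (invariants k ρ σ).subtype

/-- Vistoli's map `∏_{σ ∈ S} (R̃σ ⊗ K₀(X^σ))^{N(σ)} → Λ ⊗ K₀(G, X)` for `X = Spec A`. -/
def vistoliMap [Finite G] (S : Finset (Subgroup G)) :
    (∀ σ : S, invariants k ρ (σ : Subgroup G)) →ₗ[Coeff G] Coeff G ⊗[ℤ] EquivK0 ρ :=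
  ∑ σ : S, vistoliComponent κ ρ (σ : Subgroup G) ∘ₗ LinearMap.proj σ

end Map

/-- `S` is a set of representatives for the conjugacy classes of cyclic subgroups of `G`. -/
def IsCyclicRepresentatives {G : Type u} [Group G] (S : Finset (Subgroup G)) : Prop :=
  (∀ σ ∈ S, IsCyclic σ) ∧ ∀ τ : Subgroup G, IsCyclic τ →
    ∃! σ, σ ∈ S ∧ ∃ g : G, τ = σ.map (MulAut.conj g).toMonoidHom

/-! ### Schemes with an action -/

section Scheme

variable {k : Type u} [Field k] {G : Type u} [Group G] {X : Over (Spec (.of k))}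

theorem appTop_hom_mul (a b : Aut X) (f : Γ(X.left, ⊤)) :
    (a * b).hom.left.appTop f = b.hom.left.appTop (a.hom.left.appTop f) := by
  have h : (a * b).hom.left = b.hom.left ≫ a.hom.left := rfl
  rw [h, Scheme.Hom.comp_appTop]
  rfl

theorem appTop_hom_one (f : Γ(X.left, ⊤)) : (1 : Aut X).hom.left.appTop f = f := by
  have h : (1 : Aut X).hom.left = 𝟙 X.left := rfl
  rw [h, Scheme.Hom.id_appTop]
  rfl

/-- The left action of `G` on the global functions of a `G`-scheme `X` over `k`: `g` acts by
pullback along `g⁻¹`. -/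
def functionAct (ρ : G →* Aut X) : G →* RingAut Γ(X.left, ⊤) where
  toFun g :=
    { ((ρ g⁻¹).hom.left.appTop).hom with
      toFun := fun f => (ρ g⁻¹).hom.left.appTop f
      invFun := fun f => (ρ g).hom.left.appTop f
      left_inv := fun f => by
        change (ρ g).hom.left.appTop ((ρ g⁻¹).hom.left.appTop f) = f
        rw [← appTop_hom_mul, ← map_mul, inv_mul_cancel, map_one, appTop_hom_one]
      right_inv := fun f => by
        change (ρ g⁻¹).hom.left.appTop ((ρ g).hom.left.appTop f) = f
        rw [← appTop_hom_mul, ← map_mul, mul_inv_cancel, map_one, appTop_hom_one] }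
  map_one' := RingEquiv.ext fun f => by
    change (ρ 1⁻¹).hom.left.appTop f = f
    rw [inv_one, map_one, appTop_hom_one]
  map_mul' g h := RingEquiv.ext fun f => by
    change (ρ (g * h)⁻¹).hom.left.appTop f =
      (ρ g⁻¹).hom.left.appTop ((ρ h⁻¹).hom.left.appTop f)
    rw [mul_inv_rev, map_mul, appTop_hom_mul]

/-- The structure map from `k` to the global functions of a `k`-scheme `X`. -/
def constants (X : Over (Spec (.of k))) : k →+* Γ(X.left, ⊤) :=
  ((Scheme.ΓSpecIso (.of k)).inv ≫ X.hom.appTop).hom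

end Scheme

end VistoliK

namespace VistoliK

/-! ### The coefficient ring -/

section Coeff

variable {G : Type u} [Group G]

/-! The ring `A` of global functions of `X` is a finite product of fields, so all `A`-modules are
semisimple, and everything is proved for an arbitrary semisimple commutative ring with an action of
`G` that fixes `k`. The inverse of Vistoli's map is constructed, up to a unit of `Λ` on each factor,
from eigensheaves.

For a cyclic subgroup `τ` and a character `ψ`, let `M_ψ` be the part of `M` over `X^τ` on which `τ`
acts through `ψ`. Since `|τ|` is invertible in `k`, `M ↦ M_ψ` is exact. Put `β_τ [M] = ∑_ψ π(ψ) ⊗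
[M_ψ]`, where `π : Rτ → R̃τ` is multiplication by the idempotent of `R̃τ`. This is
`primitiveComponent`; its values are `N(τ)`-invariant because `g` carries `M_ψ` to `M_{gψ}`.

The key to `R̃τ` is `mem_primitivePart_iff`: its elements are those of `Rτ` with zero restriction to
every proper subgroup. Moreover `π` kills everything induced from proper subgroups
(`primitiveProj_charInd`).

Let `α_σ` be the component of Vistoli's map at `σ`. Mackey's formula writes `β_τ ∘ α_σ` as a sum
over `ω ∈ τ\G/σ` (`primitiveComponent_inductionMap`). On characters, the term at `x` restricts to `τ
∩ xσx⁻¹`, induces to `τ` and applies `π`. If `τ ≠ xσx⁻¹`, then either the intersection is proper in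
`τ` and `π` kills the induced element, or the restriction is to a proper subgroup of the conjugate
and is already zero. Hence `β_τ ∘ α_σ = 0` for nonconjugate `σ`, `τ`. For `τ = σ` only the
`[N(σ):σ]` double cosets in `N(σ)` remain, and each fixes the invariants, so `β_σ ∘ α_σ` is
multiplication by this index, a unit of `Λ`. Thus `α₀` is injective, and it is surjective once the
`β_σ` are jointly injective.

Joint injectivity (`eq_zero_of_primitiveComponent`) rests on the fact that a class in `K₀(G, X)` is
determined by the ranks of all `M_ψ` at all maximal ideals `𝔪` with `τ` cyclic and `𝔪` on `X^τ`
(`EquivK0.mk_eq_of_rankAt_eigen`). Given this, induction on `|τ|` applies: if the ranks for smaller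
subgroups vanish, then `∑_ψ rank(M_ψ) ψ` lies in the primitive part, where `π` is the identity, so
`β_τ = 0` makes all the coefficients vanish.

For the determination by ranks, take a simple equivariant subsheaf `S` of `M` and a point `𝔪` in its
support. The ranks give the dimensions of the eigenspaces of all cyclic subgroups of the inertia
group of `𝔪` on the `𝔪`-torsion of `M` and of `M'`. Over an algebraic closure these determine the
multiplicities of the simple representations, also in positive characteristic
(`IsSplitSystem.actionRank_eq_of_forall`), so `S[𝔪]` has a nonzero inertia-equivariant map to
`M'[𝔪]`. Averaging over `G`, with Dedekind's independence of characters, makes a nonzero equivariant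
map `S → M'` (`exists_equivariant_ne_zero`). It is injective as `S` is simple; passing to the
quotients by `S` lowers the length. -/

theorem isUnit_natCast_coeff {d : ℕ} (hd : d ∣ Nat.card G) : IsUnit (d : Coeff G) := by
  have h : IsUnit ((Nat.card G : ℕ) : Coeff G) := by
    simpa using IsLocalization.Away.algebraMap_isUnit (S := Coeff G) (Nat.card G : ℤ)
  exact isUnit_of_dvd_unit (Nat.cast_dvd_cast hd) h

variable [Finite G]

/-- Gives access to `ℚ[X]`, where distinct cyclotomic polynomials are coprime; over `Λ` only some of
them are comaximal a priori. -/
theorem exists_coeff_ringHom_rat_injective :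
    ∃ f : Coeff G →+* ℚ, Function.Injective f := by
  have hG : ((Nat.card G : ℤ) : ℚ) ≠ 0 := by
    exact_mod_cast Nat.card_pos.ne'
  have hu : ∀ y : Submonoid.powers (Nat.card G : ℤ), IsUnit (Int.castRingHom ℚ y) := by
    rintro ⟨_, m, rfl⟩
    simp [Nat.card_pos.ne']
  have inst : IsLocalization (Submonoid.powers (Nat.card G : ℤ)) (Coeff G) :=
    inferInstanceAs (IsLocalization.Away (Nat.card G : ℤ) (Coeff G))
  refine ⟨IsLocalization.lift (M := Submonoid.powers (Nat.card G : ℤ)) hu, ?_⟩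
  rw [IsLocalization.lift_injective_iff]
  intro x y
  constructor
  · intro h
    have := congrArg (IsLocalization.lift (M := Submonoid.powers (Nat.card G : ℤ)) hu) h
    simpa only [IsLocalization.lift_eq] using this
  · intro h
    have : x = y := by simpa using h
    rw [this]

theorem coeff_intCast_injective : Function.Injective (Int.cast : ℤ → Coeff G) := by
  obtain ⟨f, -⟩ := exists_coeff_ringHom_rat_injective (G := G)
  intro a b h
  have := congrArg f h
  simpa using this

instance : CharZero (Coeff G) :=
  ⟨fun a b h => by
    have := coeff_intCast_injective (G := G) (a₁ := a) (a₂ := b) (by simpa using h)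
    exact_mod_cast this⟩

/-- Over `ℚ` the factors `Φ_e` of `X ^ d - 1` are pairwise coprime, so their product divides `f`;
divisibility by a monic polynomial descends along an injective ring homomorphism. -/
theorem X_pow_sub_one_dvd_of_cyclotomic_dvd {d : ℕ} (hd : 0 < d) {f : Polynomial (Coeff G)}
    (h : ∀ e ∈ d.divisors, Polynomial.cyclotomic e (Coeff G) ∣ f) :
    Polynomial.X ^ d - 1 ∣ f := by
  obtain ⟨φ, hφ⟩ := exists_coeff_ringHom_rat_injective (G := G)
  have hm : (Polynomial.X ^ d - 1 : Polynomial (Coeff G)).Monic := by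
    simpa using Polynomial.monic_X_pow_sub_C (1 : Coeff G) hd.ne'
  rw [← Polynomial.map_dvd_map φ hφ hm, ← Polynomial.prod_cyclotomic_eq_X_pow_sub_one hd,
    Polynomial.map_prod]
  refine Finset.prod_dvd_of_coprime (fun a _ b _ hab => ?_) fun e he => ?_
  · simpa [Function.onFun] using Polynomial.cyclotomic.isCoprime_rat hab
  · exact Polynomial.map_dvd φ (h e he)

end Coeff

/-! ### Characters of cyclic groups -/

section Characters

variable {k : Type*} [Field k] {C : Type*} [Group C]

theorem sum_character_eq_zero [Fintype C] {ψ : C →* kˣ} (hψ : ψ ≠ 1) :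
    ∑ s : C, ((ψ s : kˣ) : k) = 0 := by
  obtain ⟨s, hs⟩ : ∃ s, ψ s ≠ 1 := by
    by_contra! h
    exact hψ (MonoidHom.ext h)
  have h : ((ψ s : kˣ) : k) * ∑ x : C, ((ψ x : kˣ) : k) = ∑ x : C, ((ψ x : kˣ) : k) := by
    rw [Finset.mul_sum]
    exact Fintype.sum_equiv (Equiv.mulLeft s) _ _ fun ψ => by simp
  have h' : (((ψ s : kˣ) : k) - 1) * ∑ x : C, ((ψ x : kˣ) : k) = 0 := by
    rw [sub_mul, h, one_mul, sub_self]
  refine (mul_eq_zero.1 h').resolve_left fun h0 => hs (Units.ext ?_)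
  simpa using sub_eq_zero.1 h0

variable [Finite C] [HasEnoughRootsOfUnity k (Nat.card C)]

theorem natCast_ne_zero_of_hasEnoughRootsOfUnity (k : Type*) [Field k] (n : ℕ) [NeZero n]
    [HasEnoughRootsOfUnity k n] : (n : k) ≠ 0 := by
  obtain ⟨ζ, hζ⟩ := HasEnoughRootsOfUnity.exists_primitiveRoot k n
  exact (hζ.neZero').out

instance finite_characters : Finite (C →* kˣ) := by
  have : HasEnoughRootsOfUnity k (Monoid.exponent C) :=
    HasEnoughRootsOfUnity.of_dvd k Group.exponent_dvd_nat_card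
  infer_instance

theorem exists_character_ne_one [IsCyclic C] {s : C} (hs : s ≠ 1) : ∃ ψ : C →* kˣ, ψ s ≠ 1 := by
  let : CommGroup C := IsCyclic.commGroup
  have : HasEnoughRootsOfUnity k (Monoid.exponent C) :=
    HasEnoughRootsOfUnity.of_dvd k Group.exponent_dvd_nat_card
  exact CommGroup.exists_apply_ne_one_of_hasEnoughRootsOfUnity C k hs

theorem exists_character_generator [IsCyclic C] :
    ∃ t : C →* kˣ, (∀ χ, χ ∈ Subgroup.zpowers t) ∧ orderOf t = Nat.card C := by
  let : CommGroup C := IsCyclic.commGroup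
  obtain ⟨e⟩ := IsCyclic.monoidHom_equiv_self C k
  obtain ⟨g, hg⟩ := IsCyclic.exists_generator (α := C)
  refine ⟨e.symm g, fun χ => ?_, ?_⟩
  · obtain ⟨z, hz⟩ := hg (e χ)
    exact ⟨z, e.injective (by simpa using hz)⟩
  · rw [MulEquiv.orderOf_eq, orderOf_eq_card_of_forall_mem_zpowers hg]

theorem orderOf_eq_card_of_generates [IsCyclic C] {t : C →* kˣ}
    (ht : ∀ χ, χ ∈ Subgroup.zpowers t) : orderOf t = Nat.card C := by
  let : CommGroup C := IsCyclic.commGroup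
  obtain ⟨e⟩ := IsCyclic.monoidHom_equiv_self C k
  rw [orderOf_eq_card_of_forall_mem_zpowers ht, Nat.card_congr e.toEquiv]

open scoped Classical in
theorem sum_characters_apply [IsCyclic C] [Fintype (C →* kˣ)] (s : C) :
    ∑ ψ : C →* kˣ, ((ψ s : kˣ) : k) = if s = 1 then (Nat.card C : k) else 0 := by
  let : CommGroup C := IsCyclic.commGroup
  split_ifs with hs
  · obtain ⟨e⟩ := IsCyclic.monoidHom_equiv_self C k
    simp [hs, ← Nat.card_eq_fintype_card, Nat.card_congr e.toEquiv]
  · obtain ⟨φ, hφ⟩ := exists_character_ne_one (k := k) hs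
    have h : ((φ s : kˣ) : k) * ∑ ψ : C →* kˣ, ((ψ s : kˣ) : k) =
        ∑ ψ : C →* kˣ, ((ψ s : kˣ) : k) := by
      rw [Finset.mul_sum]
      exact Fintype.sum_equiv (Equiv.mulLeft φ) _ _ fun ψ => by simp
    have h' : (((φ s : kˣ) : k) - 1) * ∑ ψ : C →* kˣ, ((ψ s : kˣ) : k) = 0 := by
      rw [sub_mul, h, one_mul, sub_self]
    refine (mul_eq_zero.1 h').resolve_left fun h0 => hφ (Units.ext ?_)
    simpa using sub_eq_zero.1 h0

/-- A character that is trivial on the kernel of `t ^ d` is a power of `t ^ d`. -/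
theorem mem_zpowers_pow_of_ker_le [IsCyclic C] {t : C →* kˣ} (ht : ∀ χ, χ ∈ Subgroup.zpowers t)
    {d : ℕ} (hd : d ∣ Nat.card C) {χ : C →* kˣ} (h : (t ^ d).ker ≤ χ.ker) :
    ∃ j : ℤ, χ = (t ^ d) ^ j := by
  obtain ⟨s, hs⟩ := IsCyclic.exists_generator (α := C)
  obtain ⟨j, rfl⟩ := ht χ
  obtain ⟨e, he⟩ := hd
  -- A generator `t` of the character group is faithful, so it carries a generator of `C` to an
  -- element of order `|C| = d e`.
  have ho : orderOf (t s) = d * e := by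
    rw [← he, ← orderOf_eq_card_of_generates ht]
    refine Nat.dvd_antisymm (orderOf_dvd_of_pow_eq_one ?_) (orderOf_dvd_of_pow_eq_one ?_)
    · rw [← MonoidHom.pow_apply, pow_orderOf_eq_one, MonoidHom.one_apply]
    · refine MonoidHom.ext fun x => ?_
      obtain ⟨z, rfl⟩ := hs x
      simp only [map_zpow, MonoidHom.pow_apply, MonoidHom.one_apply]
      rw [pow_orderOf_eq_one, one_zpow]
  -- The test element: `χ = t ^ j` must kill `s ^ e`, and since `t s` has order `d e`, this forces
  -- `d ∣ j`.
  have hmem : s ^ e ∈ (t ^ d).ker := by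
    rw [MonoidHom.mem_ker, MonoidHom.pow_apply, map_pow, ← pow_mul, mul_comm e d, ← ho,
      pow_orderOf_eq_one]
  have h1 := h hmem
  have h2 : (t s) ^ ((e : ℤ) * j) = 1 := by
    have : (t ^ j) (s ^ e) = 1 := h1
    rw [map_pow] at this
    rw [mul_comm, zpow_mul, zpow_natCast]
    simpa using this
  rw [← orderOf_dvd_iff_zpow_eq_one, ho] at h2
  have he0 : (e : ℤ) ≠ 0 := by
    rintro h0
    have : Nat.card C = 0 := by rw [he, Int.natCast_eq_zero.1 h0, mul_zero]
    exact Nat.card_pos.ne' this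
  push_cast at h2
  rw [mul_comm] at h2
  obtain ⟨i, hi⟩ := (mul_dvd_mul_iff_left he0).1 h2
  refine ⟨i, ?_⟩
  change t ^ j = _
  rw [hi]
  exact (zpow_mul t (d : ℤ) i).trans (congrArg (· ^ i) (zpow_natCast t d))

end Characters

/-! ### Restriction and induction for group algebras of finite abelian groups

A homomorphism `f : P → Q` of finite abelian groups stands for the restriction of characters to a
subgroup. -/

section ResInd

variable {Λ : Type*} [CommRing Λ] {P Q : Type*} [CommGroup P] [CommGroup Q]

/-- The map `Λ[P] → Λ[Q]` given by `f`. -/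
def algRes (f : P →* Q) : MonoidAlgebra Λ P →ₐ[Λ] MonoidAlgebra Λ Q :=
  MonoidAlgebra.mapDomainAlgHom Λ Λ f

@[simp] theorem algRes_single (f : P →* Q) (χ : P) (c : Λ) :
    algRes f (MonoidAlgebra.single χ c) = MonoidAlgebra.single (f χ) c := by
  simp [algRes]

variable [Fintype P]

open scoped Classical in
/-- The map `Λ[Q] → Λ[P]` that carries an element of `Q` to the sum of its preimages. -/
def algInd (f : P →* Q) : MonoidAlgebra Λ Q →ₗ[Λ] MonoidAlgebra Λ P :=
  Finsupp.linearCombination Λ (fun φ : Q =>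
    ∑ ψ : P, if f ψ = φ then (MonoidAlgebra.single ψ 1 : MonoidAlgebra Λ P) else 0) ∘ₗ
  (MonoidAlgebra.coeffLinearEquiv Λ).toLinearMap

open scoped Classical in
theorem algInd_single (f : P →* Q) (φ : Q) (c : Λ) :
    algInd f (MonoidAlgebra.single φ c) =
      c • ∑ ψ : P, if f ψ = φ then (MonoidAlgebra.single ψ 1 : MonoidAlgebra Λ P) else 0 := by
  simp [algInd]

open scoped Classical in
theorem algInd_one (f : P →* Q) :
    algInd f (1 : MonoidAlgebra Λ Q) =
      ∑ ψ : P, if f ψ = 1 then (MonoidAlgebra.single ψ 1 : MonoidAlgebra Λ P) else 0 := by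
  rw [MonoidAlgebra.one_def, algInd_single, one_smul]

/-- The projection formula. The fibre of `f` through `χ` is the translate by `χ` of the kernel, and
the sum over the kernel is `algInd f 1`. -/
theorem algInd_algRes (f : P →* Q) (x : MonoidAlgebra Λ P) :
    algInd f (algRes f x) = algInd f 1 * x := by
  classical
  suffices h : algInd f ∘ₗ (algRes f).toLinearMap =
      LinearMap.mulLeft Λ (algInd f (1 : MonoidAlgebra Λ Q)) from LinearMap.congr_fun h x
  refine MonoidAlgebra.lhom_ext' fun χ => LinearMap.ext_ring ?_
  simp only [LinearMap.comp_apply, AlgHom.toLinearMap_apply, MonoidAlgebra.lsingle_apply,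
    algRes_single, LinearMap.mulLeft_apply]
  rw [algInd_single, one_smul, algInd_one, Finset.sum_mul]
  refine Fintype.sum_equiv (Equiv.mulRight χ⁻¹) _ _ fun ψ => ?_
  have h : f (ψ * χ⁻¹) = 1 ↔ f ψ = f χ := by
    rw [map_mul, map_inv, mul_inv_eq_one]
  simp only [Equiv.coe_mulRight, h, ite_mul, zero_mul]
  refine if_congr Iff.rfl ?_ rfl
  simp [MonoidAlgebra.single_mul_single]

open scoped Classical in
theorem natCast_card_ker_eq (f : P →* Q) :
    (Nat.card f.ker : Λ) = ∑ ψ : P, if f ψ = 1 then (1 : Λ) else 0 := by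
  rw [Finset.sum_boole, Nat.card_eq_fintype_card, Fintype.card_subtype]
  simp only [MonoidHom.mem_ker]

theorem algRes_algInd_one (f : P →* Q) :
    algRes f (algInd f (1 : MonoidAlgebra Λ Q)) = (Nat.card f.ker : Λ) • 1 := by
  classical
  rw [algInd_one, map_sum, natCast_card_ker_eq, Finset.sum_smul]
  refine Finset.sum_congr rfl fun ψ _ => ?_
  split_ifs with h
  · simp [h, MonoidAlgebra.one_def]
  · simp

/-- An element of `Q` either lifts to `P`, and then the projection formula applies, or has an empty
fibre, and then its image is zero. So induced elements lie in the ideal of `algInd f 1`. -/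
theorem exists_algInd_eq_mul (f : P →* Q) (y : MonoidAlgebra Λ Q) :
    ∃ x : MonoidAlgebra Λ P, algInd f y = algInd f 1 * x := by
  classical
  obtain ⟨y⟩ := y
  induction y using Finsupp.induction_linear with
  | zero => exact ⟨0, by rw [MonoidAlgebra.ofCoeff_zero, map_zero, mul_zero]⟩
  | add a b ha hb =>
    obtain ⟨x, hx⟩ := ha
    obtain ⟨y, hy⟩ := hb
    exact ⟨x + y, by rw [MonoidAlgebra.ofCoeff_add, map_add, hx, hy, mul_add]⟩
  | single φ c =>
    rw [MonoidAlgebra.ofCoeff_single]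
    by_cases h : ∃ ψ : P, f ψ = φ
    · obtain ⟨ψ, rfl⟩ := h
      exact ⟨MonoidAlgebra.single ψ c, by rw [← algInd_algRes, algRes_single]⟩
    · push Not at h
      exact ⟨0, by simp [algInd_single, h]⟩

/-- The idempotent complementary to the regular character. -/
def coInd (Λ : Type*) [CommRing Λ] (f : P →* Q) : MonoidAlgebra Λ P :=
  1 - Ring.inverse (Nat.card f.ker : Λ) • algInd f 1

theorem algRes_coInd (f : P →* Q) (hf : IsUnit (Nat.card f.ker : Λ)) :
    algRes f (coInd Λ f) = 0 := by
  rw [coInd, map_sub, map_one, map_smul, algRes_algInd_one,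
    smul_smul, Ring.inverse_mul_cancel _ hf, one_smul, sub_self]

/-- With the next lemma this shows that multiplication by `coInd` is the projection of `Λ[P]` to the
kernel of restriction, with the induced elements sent to zero. Invertibility of the kernel's order
matters because `Ring.inverse` is zero on nonunits. -/
theorem coInd_mul_algInd (f : P →* Q) (hf : IsUnit (Nat.card f.ker : Λ))
    (y : MonoidAlgebra Λ Q) : coInd Λ f * algInd f y = 0 := by
  obtain ⟨x, hx⟩ := exists_algInd_eq_mul f y
  have := algInd_algRes f (coInd Λ f)
  rw [algRes_coInd f hf, map_zero] at this
  rw [hx, ← mul_assoc, mul_comm (coInd Λ f), ← this, zero_mul]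

theorem coInd_mul_of_algRes_eq_zero (f : P →* Q) {x : MonoidAlgebra Λ P}
    (hx : algRes f x = 0) : coInd Λ f * x = x := by
  rw [coInd, sub_mul, one_mul, smul_mul_assoc, ← algInd_algRes, hx, map_zero, smul_zero,
    sub_zero]

/-! ### Projection to the common kernel of several restrictions -/

section Family

variable {ι : Type*} [Fintype ι] {R : ι → Type*} [∀ i, CommGroup (R i)]

theorem algRes_prod_coInd_mul (f : ∀ i, P →* R i) (i : ι)
    (hf : IsUnit (Nat.card (f i).ker : Λ)) (x : MonoidAlgebra Λ P) :
    algRes (f i) ((∏ j, coInd Λ (f j)) * x) = 0 := by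
  rw [map_mul, map_prod, Finset.prod_eq_zero (Finset.mem_univ i) (algRes_coInd _ hf), zero_mul]

theorem prod_coInd_mul_eq_self (f : ∀ i, P →* R i) {x : MonoidAlgebra Λ P}
    (hx : ∀ i, algRes (f i) x = 0) : (∏ j, coInd Λ (f j)) * x = x :=
  Finset.prod_induction _ (fun p : MonoidAlgebra Λ P => p * x = x)
    (fun a b ha hb => by rw [mul_assoc, hb, ha]) (one_mul x)
    fun j _ => coInd_mul_of_algRes_eq_zero _ (hx j)

theorem prod_coInd_mul_algInd (f : ∀ i, P →* R i) (i : ι)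
    (hf : IsUnit (Nat.card (f i).ker : Λ)) (y : MonoidAlgebra Λ (R i)) :
    (∏ j, coInd Λ (f j)) * algInd (f i) y = 0 := by
  classical
  rw [← Finset.prod_erase_mul _ _ (Finset.mem_univ i), mul_assoc, coInd_mul_algInd _ hf, mul_zero]

end Family

end ResInd

/-! ### Cyclotomic ideals in the group algebra of a cyclic group -/

section Cyclotomic

variable {G : Type u} [Group G] {P : Type*} [CommGroup P] [Finite P]

theorem exists_aeval_of_generator {t : P} (ht : ∀ χ, χ ∈ Subgroup.zpowers t)
    (x : MonoidAlgebra (Coeff G) P) :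
    ∃ f : Polynomial (Coeff G),
      x = Polynomial.aeval (MonoidAlgebra.of (Coeff G) P t) f := by
  obtain ⟨x⟩ := x
  induction x using Finsupp.induction_linear with
  | zero => exact ⟨0, by simp⟩
  | add a b ha hb =>
    obtain ⟨f, hf⟩ := ha
    obtain ⟨g, hg⟩ := hb
    exact ⟨f + g, by rw [MonoidAlgebra.ofCoeff_add, hf, hg, map_add]⟩
  | single χ c =>
    have := mem_powers_iff_mem_zpowers.2 (ht χ)
    obtain ⟨i, rfl⟩ := this
    refine ⟨Polynomial.C c * Polynomial.X ^ i, ?_⟩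
    rw [map_mul, Polynomial.aeval_C, map_pow, Polynomial.aeval_X, ← map_pow,
      ← Algebra.smul_def, MonoidAlgebra.smul_of, MonoidAlgebra.ofCoeff_single]

variable [Finite G]

/-- The remainder modulo `X ^ orderOf t - 1` also vanishes at `t`. Its degree is less than the order
of `t`, and the powers of `t` below that order are distinct basis elements of the group algebra, so
all its coefficients are zero. -/
theorem X_pow_sub_one_dvd_of_aeval_eq_zero {t : P} {f : Polynomial (Coeff G)}
    (hf : Polynomial.aeval (MonoidAlgebra.of (Coeff G) P t) f = 0) :
    Polynomial.X ^ orderOf t - 1 ∣ f := by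
  classical
  have hpos : 0 < orderOf t := orderOf_pos t
  have hm : (Polynomial.X ^ orderOf t - 1 : Polynomial (Coeff G)).Monic := by
    simpa using Polynomial.monic_X_pow_sub_C (1 : Coeff G) hpos.ne'
  rw [← Polynomial.modByMonic_eq_zero_iff_dvd hm]
  set r := f %ₘ (Polynomial.X ^ orderOf t - 1) with hr
  have hdeg : r = 0 ∨ r.natDegree < orderOf t := by
    by_cases h0 : r = 0
    · exact .inl h0
    · right
      have hd : (Polynomial.X ^ orderOf t - 1 : Polynomial (Coeff G)).natDegree = orderOf t := by
        simpa using Polynomial.natDegree_X_pow_sub_C (n := orderOf t) (r := (1 : Coeff G))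
      have := Polynomial.natDegree_modByMonic_lt f hm (by
        intro h1
        rw [h1, Polynomial.natDegree_one] at hd
        omega)
      rwa [hd] at this
  rcases hdeg with h | hdeg
  · exact h
  have h0 : Polynomial.aeval (MonoidAlgebra.of (Coeff G) P t) r = 0 := by
    have e := Polynomial.modByMonic_add_div f (Polynomial.X ^ orderOf t - 1 : Polynomial (Coeff G))
    rw [← e, map_add, map_mul, map_sub, map_pow, Polynomial.aeval_X, ← map_pow,
      pow_orderOf_eq_one, map_one, map_one, sub_self, zero_mul, add_zero] at hf
    exact hf
  rw [Polynomial.aeval_eq_sum_range' hdeg] at h0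
  refine Polynomial.ext fun i => ?_
  by_cases hi : i < orderOf t
  · have h1 := congrArg (fun y : MonoidAlgebra (Coeff G) P => y.coeff (t ^ i)) h0
    simp only [MonoidAlgebra.coeff_sum, ← map_pow, MonoidAlgebra.smul_of,
      MonoidAlgebra.coeff_single, Finsupp.finsetSum_apply, Finsupp.single_apply,
      MonoidAlgebra.coeff_zero, Finsupp.zero_apply] at h1
    rw [Finset.sum_eq_single i] at h1
    · simpa using h1
    · intro j hj hji
      rw [if_neg]
      intro h
      exact hji (pow_injOn_Iio_orderOf (by simpa using hj) (by simpa using hi) h)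
    · intro h
      simp [hi] at h
  · rw [Polynomial.coeff_eq_zero_of_natDegree_lt (by omega)]
    simp

/-- Lift `x` to a polynomial `p` in `t`. For `e ∣ d` the lift is determined modulo `X ^ orderOf t -
1`, which `Φ_e` divides, so `Φ_e ∣ p`. Hence `X ^ d - 1 ∣ p`, and this factor dies under `f` because
`f t ^ d = 1`. -/
theorem algRes_eq_zero_of_mem_span {Q : Type*} [CommGroup Q] (f : P →* Q) {t : P}
    (ht : ∀ χ, χ ∈ Subgroup.zpowers t) {d : ℕ} (hd : d ∣ orderOf t) (hf : f t ^ d = 1)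
    {x : MonoidAlgebra (Coeff G) P}
    (hx : ∀ e, e ∣ d → x ∈ Ideal.span {Polynomial.aeval (MonoidAlgebra.of (Coeff G) P t)
      (Polynomial.cyclotomic e (Coeff G))}) : algRes f x = 0 := by
  obtain ⟨p, rfl⟩ := exists_aeval_of_generator ht x
  have hd0 : 0 < d := Nat.pos_of_dvd_of_pos hd (orderOf_pos t)
  have key : Polynomial.X ^ d - 1 ∣ p := by
    refine X_pow_sub_one_dvd_of_cyclotomic_dvd hd0 fun e he => ?_
    have hed : e ∣ d := Nat.dvd_of_mem_divisors he
    obtain ⟨y, hy⟩ := Ideal.mem_span_singleton'.1 (hx e hed)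
    obtain ⟨g, rfl⟩ := exists_aeval_of_generator ht y
    rw [← map_mul, ← sub_eq_zero, ← map_sub] at hy
    have h1 := X_pow_sub_one_dvd_of_aeval_eq_zero hy
    have h2 : Polynomial.cyclotomic e (Coeff G) ∣ Polynomial.X ^ orderOf t - 1 := by
      rw [← Polynomial.prod_cyclotomic_eq_X_pow_sub_one (orderOf_pos t)]
      exact Finset.dvd_prod_of_mem _ (Nat.mem_divisors.2 ⟨hed.trans hd, (orderOf_pos t).ne'⟩)
    exact (dvd_sub_right (dvd_mul_left _ _)).1 (h2.trans h1)
  obtain ⟨g, rfl⟩ := key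
  rw [map_mul, map_mul, map_sub, map_pow, Polynomial.aeval_X, map_sub, map_pow,
    MonoidAlgebra.of_apply, algRes_single, MonoidAlgebra.single_pow, one_pow, hf,
    map_one, map_one, ← MonoidAlgebra.one_def, sub_self, zero_mul]

omit [Finite G] in
-- The converse direction. By the projection formula the sum of `ψ x` over `ψ` in the kernel is
-- zero, so `|ker f| x` is the sum of the elements `(1 - ψ) x`. Each such `ψ` is a power of `t ^ d`,
-- hence `1 - ψ` is a multiple of `t ^ d - 1` and of `Φ_d(t)`.
theorem mem_span_of_algRes_eq_zero {Q : Type*} [CommGroup Q] (f : P →* Q)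
    (hf : IsUnit (Nat.card f.ker : Coeff G)) {t : P} {d : ℕ} (hd : 0 < d)
    (hker : f.ker ≤ Subgroup.zpowers (t ^ d)) {x : MonoidAlgebra (Coeff G) P}
    (hx : algRes f x = 0) :
    x ∈ Ideal.span {Polynomial.aeval (MonoidAlgebra.of (Coeff G) P t)
      (Polynomial.cyclotomic d (Coeff G))} := by
  classical
  have := Fintype.ofFinite P
  have hz : algInd f 1 * x = 0 := by rw [← algInd_algRes, hx, map_zero]
  have hsum : (Nat.card f.ker : Coeff G) • x = ∑ ψ : P,
      if f ψ = 1 then (1 - MonoidAlgebra.of (Coeff G) P ψ) * x else 0 := by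
    rw [algInd_one, Finset.sum_mul] at hz
    rw [natCast_card_ker_eq, Finset.sum_smul]
    refine Eq.trans ?_ ((congrArg (_ + ·) hz).trans (add_zero _))
    rw [← Finset.sum_add_distrib]
    refine Finset.sum_congr rfl fun ψ _ => ?_
    split_ifs
    · rw [one_smul, sub_mul, one_mul, MonoidAlgebra.of_apply, sub_add_cancel]
    · simp
  have hmem : (Nat.card f.ker : Coeff G) • x ∈
      Ideal.span {Polynomial.aeval (MonoidAlgebra.of (Coeff G) P t)
        (Polynomial.cyclotomic d (Coeff G))} := by
    rw [hsum]
    refine Ideal.sum_mem _ fun ψ _ => ?_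
    split_ifs with hψ
    · refine Ideal.mul_mem_right _ _ ?_
      obtain ⟨i, rfl⟩ := mem_powers_iff_mem_zpowers.2 (hker hψ)
      rw [← neg_sub, neg_mem_iff]
      simp only [map_pow]
      refine Ideal.mem_of_dvd _ (sub_one_dvd_pow_sub_one _ i) ?_
      rw [Ideal.mem_span_singleton]
      have h2 : Polynomial.cyclotomic d (Coeff G) ∣ Polynomial.X ^ d - 1 := by
        rw [← Polynomial.prod_cyclotomic_eq_X_pow_sub_one hd]
        exact Finset.dvd_prod_of_mem _ (Nat.mem_divisors_self d hd.ne')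
      simpa using map_dvd (Polynomial.aeval (MonoidAlgebra.of (Coeff G) P t)) h2
    · exact Ideal.zero_mem _
  obtain ⟨v, hv⟩ := hf
  have : x = ((v⁻¹ : (Coeff G)ˣ) : Coeff G) • ((Nat.card f.ker : Coeff G) • x) := by
    rw [← hv, smul_smul, Units.inv_mul, one_smul]
  rw [this]
  exact Submodule.smul_of_tower_mem _ _ hmem

end Cyclotomic

/-! ### The primitive part -/

section Primitive

variable {k : Type u} [Field k] {G : Type u} [Group G]

/-- Composition of characters with `j : D → σ`. -/
def charComp {C D : Type*} [Group C] [Group D] (j : D →* C) : (C →* kˣ) →* (D →* kˣ) where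
  toFun χ := χ.comp j
  map_one' := rfl
  map_mul' _ _ := rfl

/-- The map `Rσ → RD` given by composition of characters with `j : D → σ`. -/
def charRes {σ D : Subgroup G} (j : D →* σ) : RepRing k σ →ₗ[Coeff G] RepRing k D :=
  (algRes (charComp j)).toLinearMap

@[simp] theorem charRes_single {σ D : Subgroup G} (j : D →* σ) (χ : σ →* kˣ) (c : Coeff G) :
    charRes j (MonoidAlgebra.single χ c : RepRing k σ) = MonoidAlgebra.single (χ.comp j) c :=
  algRes_single (charComp j) χ c

variable [Finite G] [HasEnoughRootsOfUnity k (Nat.card G)]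

instance hasEnoughRootsOfUnity_subgroup (σ : Subgroup G) :
    HasEnoughRootsOfUnity k (Nat.card σ) :=
  HasEnoughRootsOfUnity.of_dvd k (Subgroup.card_subgroup_dvd_card σ)

instance fintypeCharacters (σ : Subgroup G) : Fintype (σ →* kˣ) := Fintype.ofFinite _

theorem card_characters (σ : Subgroup G) [IsCyclic σ] : Nat.card (σ →* kˣ) = Nat.card σ := by
  obtain ⟨t, ht, ho⟩ := exists_character_generator (k := k) (C := σ)
  rw [← orderOf_eq_card_of_forall_mem_zpowers ht, ho]

/-- The map `RD → Rσ` that carries a character of `D` to the sum of its extensions to `σ`. -/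
def charInd {σ D : Subgroup G} (j : D →* σ) : RepRing k D →ₗ[Coeff G] RepRing k σ :=
  algInd (charComp j)

open scoped Classical in
theorem charInd_single {σ D : Subgroup G} (j : D →* σ) (φ : D →* kˣ) (c : Coeff G) :
    charInd j (MonoidAlgebra.single φ c : RepRing k D) =
      c • ∑ ψ : σ →* kˣ,
        if ψ.comp j = φ then (MonoidAlgebra.single ψ 1 : RepRing k σ) else 0 :=
  algInd_single (charComp j) φ c

theorem isUnit_card_ker_charComp {σ D : Subgroup G} [IsCyclic σ] (j : D →* σ) :
    IsUnit (Nat.card (charComp (k := k) j).ker : Coeff G) := by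
  refine isUnit_natCast_coeff (dvd_trans (Subgroup.card_subgroup_dvd_card _) ?_)
  rw [card_characters]
  exact Subgroup.card_subgroup_dvd_card σ

/-- Elements of the primitive part are those that restrict to zero on proper subgroups. -/
theorem mem_primitivePart_iff {σ : Subgroup G} [IsCyclic σ] {x : RepRing k σ} :
    x ∈ PrimitivePart k σ ↔
      ∀ (D : Subgroup G) (h : D < σ), charRes (Subgroup.inclusion h.le) x = 0 := by
  classical
  constructor
  · intro hx D hD
    obtain ⟨t, ht, ho⟩ := exists_character_generator (k := k) (C := σ)
    have hcard : Nat.card D ∣ Nat.card σ := Subgroup.card_dvd_of_le hD.le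
    have hlt : Nat.card D < Nat.card σ :=
      lt_of_le_of_ne (Nat.le_of_dvd Nat.card_pos hcard) fun h =>
        hD.ne (Subgroup.eq_of_le_of_card_ge hD.le h.ge)
    -- Applied with `d = |D|`: every divisor of `|D|` is a proper divisor of `|σ|`, and characters
    -- of `D` have order dividing `|D|`.
    refine algRes_eq_zero_of_mem_span (charComp (Subgroup.inclusion hD.le)) ht (ho ▸ hcard) ?_
      fun e he => hx t ht e (Nat.mem_properDivisors.2
        ⟨he.trans hcard, (Nat.le_of_dvd Nat.card_pos he).trans_lt hlt⟩)
    refine MonoidHom.ext fun s => ?_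
    change t (Subgroup.inclusion hD.le s) ^ Nat.card D = 1
    rw [← map_pow, ← map_pow, pow_card_eq_one', map_one, map_one]
  · intro hx t ht d hd
    obtain ⟨hdvd, hlt⟩ := Nat.mem_properDivisors.1 hd
    have ho := orderOf_eq_card_of_generates ht
    have hd0 : 0 < d := Nat.pos_of_dvd_of_pos hdvd Nat.card_pos
    -- The subgroup that detects `Φ_d`: the characters of `σ` trivial on the kernel of `t ^ d` are
    -- the powers of `t ^ d`. It is proper because `t` has order `|σ| > d`.
    let D : Subgroup G := (t ^ d).ker.map σ.subtype
    have hDle : D ≤ σ := by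
      rintro _ ⟨s, -, rfl⟩
      exact s.2
    have hDmem : ∀ s : σ, (s : G) ∈ D ↔ s ∈ (t ^ d).ker := fun s => by
      constructor
      · rintro ⟨s', hs', h⟩
        rwa [← Subtype.ext h]
      · exact fun h => ⟨s, h, rfl⟩
    have hDlt : D < σ := by
      refine lt_of_le_of_ne hDle fun h => ?_
      have h1 : ∀ s : σ, t s ^ d = 1 := fun s => by
        have hs : (s : G) ∈ D := by
          rw [h]
          exact s.2
        exact (hDmem s).1 hs
      have h2 : orderOf t ∣ d := orderOf_dvd_of_pow_eq_one (MonoidHom.ext h1)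
      rw [ho] at h2
      exact absurd (Nat.le_of_dvd hd0 h2) (by omega)
    refine mem_span_of_algRes_eq_zero (charComp (Subgroup.inclusion hDle))
      (isUnit_card_ker_charComp _) hd0 (fun ψ hψ => ?_) (hx D hDlt)
    have hker : (t ^ d).ker ≤ ψ.ker := fun s hs =>
      DFunLike.congr_fun hψ (⟨s, (hDmem s).2 hs⟩ : D)
    obtain ⟨i, hi⟩ := mem_zpowers_pow_of_ker_le ht hdvd hker
    exact ⟨i, hi.symm⟩

variable (k) in
/-- The idempotent of `Rσ` that generates the primitive part. -/
def primitiveIdempotent (σ : Subgroup G) [IsCyclic σ] : RepRing k σ :=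
  letI := Fintype.ofFinite {D : Subgroup G // D < σ}
  ∏ D : {D : Subgroup G // D < σ}, coInd (Coeff G) (charComp (Subgroup.inclusion D.2.le))

variable (k) in
/-- The projection of `Rσ` to the primitive part. -/
def primitiveProj (σ : Subgroup G) [IsCyclic σ] : RepRing k σ →ₗ[Coeff G] PrimitivePart k σ :=
  (LinearMap.mulLeft (Coeff G) (primitiveIdempotent k σ)).codRestrict _ fun x =>
    mem_primitivePart_iff.2 fun D hD =>
      letI := Fintype.ofFinite {D : Subgroup G // D < σ}
      algRes_prod_coInd_mul (fun D : {D : Subgroup G // D < σ} =>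
        charComp (k := k) (Subgroup.inclusion D.2.le)) ⟨D, hD⟩ (isUnit_card_ker_charComp _) x

theorem primitiveProj_apply_coe (σ : Subgroup G) [IsCyclic σ] (x : PrimitivePart k σ) :
    primitiveProj k σ x = x :=
  letI := Fintype.ofFinite {D : Subgroup G // D < σ}
  Subtype.ext <| prod_coInd_mul_eq_self (fun D : {D : Subgroup G // D < σ} =>
    charComp (k := k) (Subgroup.inclusion D.2.le)) fun D => mem_primitivePart_iff.1 x.2 D D.2

/-- The idempotent contains the factor `coInd` of the restriction to `D`, which annihilates whatever
is induced from `D`. -/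
theorem primitiveProj_charInd {σ D : Subgroup G} [IsCyclic σ] (hD : D < σ)
    (y : RepRing k D) : primitiveProj k σ (charInd (Subgroup.inclusion hD.le) y) = 0 :=
  letI := Fintype.ofFinite {D : Subgroup G // D < σ}
  Subtype.ext <| prod_coInd_mul_algInd (fun D : {D : Subgroup G // D < σ} =>
    charComp (k := k) (Subgroup.inclusion D.2.le)) ⟨D, hD⟩ (isUnit_card_ker_charComp _) y

theorem primitiveIdempotent_mem (σ : Subgroup G) [IsCyclic σ] :
    primitiveIdempotent k σ ∈ PrimitivePart k σ := by
  rw [← mul_one (primitiveIdempotent k σ)]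
  exact (primitiveProj k σ 1).2

/-- The idempotent is the identity element of the ideal `PrimitivePart`, which the normalizer
preserves. The translate by `g` is an identity element too, and there is only one. -/
theorem normalizerActRep_primitiveIdempotent (σ : Subgroup G) [IsCyclic σ]
    (g : Subgroup.normalizer (σ : Set G)) :
    normalizerActRep k σ g (primitiveIdempotent k σ) = primitiveIdempotent k σ := by
  have hmem := primitiveIdempotent_mem (k := k) σ
  have hmul : ∀ x ∈ PrimitivePart k σ, primitiveIdempotent k σ * x = x := fun x hx =>
    congrArg Subtype.val (primitiveProj_apply_coe σ ⟨x, hx⟩)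
  have hinv : (normalizerActRep k σ g).symm (primitiveIdempotent k σ) =
      normalizerActRep k σ g⁻¹ (primitiveIdempotent k σ) := by
    have : (normalizerActChar k σ g).symm = normalizerActChar k σ g⁻¹ := by
      refine MulEquiv.ext fun χ => (normalizerActChar k σ g).injective ?_
      rw [MulEquiv.apply_symm_apply]
      refine MonoidHom.ext fun s => ?_
      simp [normalizerActChar]
    rw [normalizerActRep, normalizerActRep, MonoidAlgebra.domCongr_symm, this]
  have h1 := hmul _ (normalizerActRep_mem k σ g _ hmem)
  have h2 := hmul _ (normalizerActRep_mem k σ g⁻¹ _ hmem)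
  rw [← hinv] at h2
  have h3 := congrArg (normalizerActRep k σ g) h2
  rw [map_mul, AlgEquiv.apply_symm_apply] at h3
  exact h1.symm.trans ((mul_comm (primitiveIdempotent k σ) _).trans h3)

theorem primitiveProj_normalizerActRep (σ : Subgroup G) [IsCyclic σ]
    (g : Subgroup.normalizer (σ : Set G)) (x : RepRing k σ) :
    primitiveProj k σ (normalizerActRep k σ g x) =
      normalizerActPrimitive k σ g (primitiveProj k σ x) := by
  refine Subtype.ext ?_
  change primitiveIdempotent k σ * normalizerActRep k σ g x =
    normalizerActRep k σ g (primitiveIdempotent k σ * x)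
  rw [map_mul, normalizerActRep_primitiveIdempotent]

end Primitive

/-! ### Ranks of idempotents on modules over a split semisimple algebra -/

section IdempotentRank

variable (K : Type*) [Field K] {R : Type*} [Ring R] [Algebra K R]

/-- The dimension of `e V`. -/
def actionRank (V : Type*) [AddCommGroup V] [Module K V] [Module R V] [IsScalarTower K R V]
    (e : R) : ℕ :=
  Module.finrank K (LinearMap.range (Algebra.lsmul K K V e))

section

variable {V W : Type*} [AddCommGroup V] [Module K V] [Module R V] [IsScalarTower K R V]
  [AddCommGroup W] [Module K W] [Module R W] [IsScalarTower K R W]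

theorem mem_range_lsmul_iff {e : R} (he : IsIdempotentElem e)
    {v : V} : v ∈ LinearMap.range (Algebra.lsmul K K V e) ↔ e • v = v := by
  constructor
  · rintro ⟨w, rfl⟩
    rw [Algebra.lsmul_coe, ← mul_smul, he.eq]
  · exact fun h => ⟨v, h⟩

theorem actionRank_congr (f : V ≃ₗ[R] W) (e : R) : actionRank K V e = actionRank K W e := by
  let g : V ≃ₗ[K] W := f.restrictScalars K
  have h : (LinearMap.range (Algebra.lsmul K K V e)).map (g : V →ₗ[K] W) =
      LinearMap.range (Algebra.lsmul K K W e) := by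
    ext w
    constructor
    · rintro ⟨_, ⟨v, rfl⟩, rfl⟩
      exact ⟨f v, (f.map_smul e v).symm⟩
    · rintro ⟨w, rfl⟩
      exact ⟨e • f.symm w, ⟨f.symm w, rfl⟩, (f.map_smul e _).trans (by simp)⟩
  rw [actionRank, actionRank, ← h]
  exact (g.submoduleMap _).finrank_eq

theorem actionRank_pi {ι : Type*} [Fintype ι] (U : ι → Type*) [∀ i, AddCommGroup (U i)]
    [∀ i, Module K (U i)] [∀ i, Module R (U i)] [∀ i, IsScalarTower K R (U i)]
    [∀ i, FiniteDimensional K (U i)] {e : R} (he : IsIdempotentElem e) :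
    actionRank K (∀ i, U i) e = ∑ i, actionRank K (U i) e := by
  have φ : LinearMap.range (Algebra.lsmul K K (∀ i, U i) e) ≃ₗ[K]
      ∀ i, LinearMap.range (Algebra.lsmul K K (U i) e) :=
    { toFun := fun v i => ⟨v.1 i, (mem_range_lsmul_iff K he).2
        (congrFun ((mem_range_lsmul_iff K he).1 v.2) i)⟩
      invFun := fun v => ⟨fun i => (v i).1, (mem_range_lsmul_iff K he).2
        (funext fun i => (mem_range_lsmul_iff K he).1 (v i).2)⟩
      left_inv := fun _ => rfl
      right_inv := fun _ => rfl
      map_add' := fun _ _ => rfl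
      map_smul' := fun _ _ => rfl }
  rw [actionRank, φ.finrank_eq, Module.finrank_pi_fintype]
  rfl

/-- Traces are linear in `e`, unlike ranks; the price is that they see the rank only as an element
of `K`. -/
theorem trace_lsmul_of_isIdempotentElem [FiniteDimensional K V] {e : R}
    (he : IsIdempotentElem e) :
    LinearMap.trace K V (Algebra.lsmul K K V e) = (actionRank K V e : K) := by
  have h : LinearMap.IsProj (LinearMap.range (Algebra.lsmul K K V e)) (Algebra.lsmul K K V e) :=
    ⟨fun v => ⟨v, rfl⟩, fun v hv => (mem_range_lsmul_iff K he).1 hv⟩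
  exact h.trace

end

/-- Primitive idempotents of the blocks of a split semisimple algebra. -/
structure IsSplitSystem {ι : Type*} (ε : ι → R) : Prop where
  ne_zero : ∀ i, ε i ≠ 0
  idem : ∀ i, IsIdempotentElem (ε i)
  scalar : ∀ i x, ∃ c : K, ε i * x * ε i = c • ε i
  orthogonal : ∀ i j x, i ≠ j → ε i * x * ε j = 0
  nondegenerate : ∀ i x, x * ε i ≠ 0 → ∃ y, ε i * y * (x * ε i) = ε i
  one_mem : (1 : R) ∈ AddSubgroup.closure {z | ∃ i x y, z = x * ε i * y}

/-- By Wedderburn's theorem the algebra is a product of matrix algebras over `K`; the system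
consists of the matrix unit at `(0, 0)` in each block. -/
theorem exists_isSplitSystem [IsAlgClosed K] [FiniteDimensional K R] [IsSemisimpleRing R] :
    ∃ (n : ℕ) (ε : Fin n → R), IsSplitSystem K ε := by
  classical
  obtain ⟨n, d, hd, ⟨φ⟩⟩ := IsSemisimpleRing.exists_algEquiv_pi_matrix_of_isAlgClosed K R
  -- The matrix unit at `(a, b)` in block `i`.
  let E (i : Fin n) (a b : Fin (d i)) : Π i, Matrix (Fin (d i)) (Fin (d i)) K :=
    Pi.single i (Matrix.single a b 1)
  have hE (i : Fin n) (a b : Fin (d i)) (X : Π i, Matrix (Fin (d i)) (Fin (d i)) K)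
      (a' b' : Fin (d i)) : E i a b * X * E i a' b' = X i b a' • E i a b' := by
    funext j
    by_cases h : j = i
    · subst h
      ext p q
      simp [E, Matrix.single_mul_mul_single, Matrix.single_apply]
    · simp [E, h]
  have hE' (i j : Fin n) (hij : i ≠ j) (a b : Fin (d i))
      (X : Π i, Matrix (Fin (d i)) (Fin (d i)) K)
      (a' b' : Fin (d j)) : E i a b * X * E j a' b' = 0 := by
    funext l
    by_cases h : l = i
    · subst h
      simp [E, hij]
    · simp [E, h]
  have hmul (i : Fin n) (a b c : Fin (d i)) : E i a b * E i b c = E i a c := by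
    simpa using hE i a b 1 b c
  refine ⟨n, fun i => φ.symm (E i 0 0), ?_, ?_, ?_, ?_, ?_, ?_⟩
  · intro i h
    have h1 : E i 0 0 = 0 := by simpa using h
    have := congrFun (congrFun (congrFun h1 i) 0) 0
    simp [E] at this
  · intro i
    change φ.symm (E i 0 0) * φ.symm (E i 0 0) = φ.symm (E i 0 0)
    rw [← map_mul, hmul]
  · intro i x
    refine ⟨φ x i 0 0, φ.injective ?_⟩
    simp only [map_mul, AlgEquiv.apply_symm_apply, map_smul, hE]
  · intro i j x hij
    refine φ.injective ?_
    simp only [map_mul, AlgEquiv.apply_symm_apply, map_zero, hE' i j hij]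
  · intro i x hx
    have hx' : φ x * E i 0 0 ≠ 0 := by
      intro h
      refine hx (φ.injective ?_)
      simpa using h
    obtain ⟨b, hb⟩ : ∃ b, φ x i b 0 ≠ 0 := by
      by_contra! h
      refine hx' (funext fun j => ?_)
      by_cases hj : j = i
      · subst hj
        ext p q
        by_cases hq : q = 0
        · simp [E, hq, h]
        · simp [E, hq]
      · simp [E, hj]
    -- The product `x ε_i` is column `0` of block `i` of `x`; a scaled `E i 0 b` moves its nonzero
    -- entry in row `b` back to `(0, 0)` with value `1`.
    refine ⟨φ.symm ((φ x i b 0)⁻¹ • E i 0 b), φ.injective ?_⟩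
    simp only [map_mul, AlgEquiv.apply_symm_apply, mul_smul_comm, smul_mul_assoc]
    rw [hmul, ← mul_assoc, hE, smul_smul, inv_mul_cancel₀ hb, one_smul]
  · have h1 : (1 : Π i, Matrix (Fin (d i)) (Fin (d i)) K) =
        ∑ i, ∑ a, E i a 0 * E i 0 0 * E i 0 a := by
      simp only [hmul]
      funext j
      rw [Finset.sum_apply, Finset.sum_eq_single j]
      · rw [Finset.sum_apply]
        simp only [E, Pi.single_eq_same, Pi.one_apply]
        rw [Matrix.sum_single_one]
      · intro i _ hij
        simp [E, hij.symm]
      · simp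
    have h2 : (1 : R) = ∑ i, ∑ a, φ.symm (E i a 0) * φ.symm (E i 0 0) * φ.symm (E i 0 a) := by
      rw [← map_one φ.symm, h1]
      simp only [map_sum, map_mul]
    rw [h2]
    exact AddSubgroup.sum_mem _ fun i _ => AddSubgroup.sum_mem _ fun a _ =>
      AddSubgroup.subset_closure ⟨i, _, _, rfl⟩

end IdempotentRank

/-! ### Multiplicities of simple modules over a split semisimple algebra -/

section SplitSystem

variable {K : Type*} [Field K] {R : Type*} [Ring R] [Algebra K R]
  {ι : Type*} {ε : ι → R} (hε : IsSplitSystem K ε)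

namespace IsSplitSystem

include hε

/-- Otherwise the two-sided ideal generated by all `ε i` would kill `v`, but it contains `1`. -/
theorem exists_smul_ne_zero {V : Type*} [AddCommGroup V] [Module R V] {v : V} (hv : v ≠ 0) :
    ∃ (i : ι) (y : R), ε i • (y • v) ≠ 0 := by
  by_contra! h
  have : ∀ z ∈ AddSubgroup.closure {z | ∃ i x y, z = x * ε i * y}, z • v = 0 := fun z hz => by
    induction hz using AddSubgroup.closure_induction with
    | mem z hz =>
      obtain ⟨i, x, y, rfl⟩ := hz
      rw [mul_smul, mul_smul, h, smul_zero]
    | zero => exact zero_smul _ _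
    | add a b _ _ ha hb => rw [add_smul, ha, hb, add_zero]
    | neg a _ ha => rw [neg_smul, ha, neg_zero]
  exact hv (by simpa using this 1 hε.one_mem)

/-- If `x ε_i ≠ 0`, nondegeneracy recovers `ε_i` as a left multiple of `x ε_i`, so `s = ε_i s` would
be a multiple of `x s = 0`. -/
theorem mul_eq_zero_of_smul_eq_zero {S : Type*} [AddCommGroup S] [Module R S] {i : ι} {s : S}
    (hs : s ≠ 0) (hes : ε i • s = s) {x : R} (h : x • s = 0) : x * ε i = 0 := by
  by_contra hx
  obtain ⟨y, hy⟩ := hε.nondegenerate i x hx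
  refine hs ?_
  rw [← hes, ← hy, mul_smul, mul_smul x, hes, h, smul_zero]

/-- The embedding of `R ε_i` that carries `ε_i` to `s`. -/
theorem exists_injective {S : Type*} [AddCommGroup S] [Module R S] {i : ι} {s : S}
    (hs : s ≠ 0) (hes : ε i • s = s) :
    ∃ f : Submodule.span R {ε i} →ₗ[R] S, Function.Injective f ∧
      ∀ x, f x = (x : R) • s := by
  let f : Submodule.span R {ε i} →ₗ[R] S :=
    (LinearMap.toSpanSingleton R S s) ∘ₗ (Submodule.span R {ε i}).subtype
  have hf : ∀ x, f x = (x : R) • s := fun x => by simp [f]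
  refine ⟨f, ?_, hf⟩
  rw [injective_iff_map_eq_zero]
  rintro ⟨x, hx⟩ h
  obtain ⟨a, rfl⟩ := Submodule.mem_span_singleton.1 hx
  refine Subtype.ext ?_
  rw [hf] at h
  have := hε.mul_eq_zero_of_smul_eq_zero hs hes h
  change a * ε i * ε i = 0 at this
  change a * ε i = 0
  rwa [mul_assoc, (hε.idem i).eq] at this

theorem nonempty_linearEquiv_of_isSimpleModule {S : Type*} [AddCommGroup S] [Module R S]
    [IsSimpleModule R S] {i : ι} {s : S} (hs : s ≠ 0) (hes : ε i • s = s) :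
    Nonempty (Submodule.span R {ε i} ≃ₗ[R] S) := by
  obtain ⟨f, hf, hfs⟩ := hε.exists_injective hs hes
  refine ⟨LinearEquiv.ofBijective f ⟨hf, LinearMap.range_eq_top.1 ?_⟩⟩
  refine (eq_bot_or_eq_top (LinearMap.range f)).resolve_left fun h => hs ?_
  have : s ∈ LinearMap.range f :=
    ⟨⟨ε i, Submodule.mem_span_singleton_self _⟩, (hfs _).trans hes⟩
  rw [h] at this
  simpa using this

open scoped Classical in
-- The space `ε_j R ε_i` is the line through `ε_i` for `i = j` and zero otherwise. Hence the rank of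
-- `ε_j` counts the copies of the simple module `R ε_j`.
theorem actionRank_span [FiniteDimensional K R] (i j : ι) :
    actionRank K (Submodule.span R {ε i}) (ε j) = if i = j then 1 else 0 := by
  split_ifs with h
  · subst h
    rw [actionRank]
    refine finrank_eq_one (⟨⟨ε i, Submodule.mem_span_singleton_self _⟩,
      ⟨⟨ε i, Submodule.mem_span_singleton_self _⟩, Subtype.ext (hε.idem i)⟩⟩) ?_ ?_
    · intro h0
      exact hε.ne_zero i (congrArg (fun x => (x.1 : R)) h0)
    · rintro ⟨_, ⟨⟨x, hx⟩, rfl⟩⟩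
      obtain ⟨a, rfl⟩ := Submodule.mem_span_singleton.1 hx
      obtain ⟨c, hc⟩ := hε.scalar i a
      refine ⟨c, Subtype.ext (Subtype.ext ?_)⟩
      change c • ε i = ε i * (a * ε i)
      rw [← mul_assoc, hc]
  · rw [actionRank, Module.finrank_zero_iff]
    refine ⟨fun a b => ?_⟩
    have h0 : ∀ a : LinearMap.range (Algebra.lsmul K K (Submodule.span R {ε i}) (ε j)), a = 0 := by
      rintro ⟨_, ⟨⟨x, hx⟩, rfl⟩⟩
      obtain ⟨a, rfl⟩ := Submodule.mem_span_singleton.1 hx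
      refine Subtype.ext (Subtype.ext ?_)
      change ε j * (a * ε i) = 0
      rw [← mul_assoc, hε.orthogonal j i a (Ne.symm h)]
    rw [h0 a, h0 b]

/-- Decompose `V` into simple modules. Each is isomorphic to some `R ε_i`, and the number of those
is the rank of `ε_i` on `V`. -/
theorem actionRank_eq_sum [FiniteDimensional K R] [IsSemisimpleRing R] [Fintype ι]
    (V : Type*) [AddCommGroup V] [Module K V] [Module R V] [IsScalarTower K R V]
    [FiniteDimensional K V] {e : R} (he : IsIdempotentElem e) :
    actionRank K V e =
      ∑ i, actionRank K V (ε i) * actionRank K (Submodule.span R {ε i}) e := by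
  classical
  have : Module.Finite R V := Module.Finite.of_restrictScalars_finite K R V
  obtain ⟨n, S, φ, hS⟩ := IsSemisimpleModule.exists_linearEquiv_fin_dfinsupp R V
  have hfin : ∀ i, FiniteDimensional K (S i) := fun i =>
    inferInstanceAs (FiniteDimensional K ((S i).restrictScalars K))
  let φ' : V ≃ₗ[R] ∀ i, S i := φ.trans DFinsupp.linearEquivFunOnFintype
  have hpi : ∀ {e : R}, IsIdempotentElem e →
      actionRank K V e = ∑ i, actionRank K (S i) e := fun {e} he => by
    rw [actionRank_congr K φ', actionRank_pi K _ he]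
  have hsimple : ∀ j, ∃ i, Nonempty (Submodule.span R {ε i} ≃ₗ[R] S j) := fun j => by
    have := IsSimpleModule.nontrivial R (S j)
    obtain ⟨v, hv⟩ := exists_ne (0 : S j)
    obtain ⟨i, y, h⟩ := hε.exists_smul_ne_zero hv
    exact ⟨i, hε.nonempty_linearEquiv_of_isSimpleModule h (by rw [← mul_smul, (hε.idem i).eq])⟩
  choose t ht using hsimple
  have hk : ∀ j e, actionRank K (S j) e = actionRank K (Submodule.span R {ε (t j)}) e :=
    fun j e => (actionRank_congr K (ht j).some e).symm
  simp_rw [hpi he, hpi (hε.idem _), Finset.sum_mul]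
  rw [Finset.sum_comm]
  refine Finset.sum_congr rfl fun j _ => ?_
  simp_rw [hk, hε.actionRank_span]
  simp

/-- Two modules on which a spanning set of idempotents has the same ranks have the same
multiplicities. The proof divides the difference of the multiplicities by its content: the traces
show that all entries of the quotient vanish in `K`. -/
theorem actionRank_eq_of_forall [FiniteDimensional K R] [IsSemisimpleRing R] [Fintype ι]
    {E : Set R} (hE : ∀ e ∈ E, IsIdempotentElem e) (hspan : Submodule.span K E = ⊤)
    {V W : Type*} [AddCommGroup V] [Module K V] [Module R V] [IsScalarTower K R V]
    [FiniteDimensional K V] [AddCommGroup W] [Module K W] [Module R W] [IsScalarTower K R W]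
    [FiniteDimensional K W] (h : ∀ e ∈ E, actionRank K V e = actionRank K W e) (i : ι) :
    actionRank K V (ε i) = actionRank K W (ε i) := by
  classical
  let a : ι → ℤ := fun i => (actionRank K V (ε i) : ℤ) - actionRank K W (ε i)
  have hfin : ∀ i, FiniteDimensional K (Submodule.span R {ε i}) := fun i =>
    inferInstanceAs (FiniteDimensional K ((Submodule.span R {ε i}).restrictScalars K))
  have ha : ∀ e ∈ E, ∑ i, a i * (actionRank K (Submodule.span R {ε i}) e : ℤ) = 0 :=
    fun e he => by
      simp only [a, sub_mul, Finset.sum_sub_distrib]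
      have h1 := hε.actionRank_eq_sum V (hE e he)
      have h2 := hε.actionRank_eq_sum W (hE e he)
      rw [h e he, h2] at h1
      rw [sub_eq_zero]
      exact_mod_cast h1.symm
  suffices hz : a i = 0 by
    have := sub_eq_zero.1 hz
    exact_mod_cast this
  by_contra hai
  obtain ⟨b, hb, hb1⟩ := Finset.extract_gcd a (s := Finset.univ) ⟨i, Finset.mem_univ i⟩
  set g := Finset.univ.gcd a
  have hg : g ≠ 0 := fun h0 => hai (by rw [hb i (Finset.mem_univ i), h0, zero_mul])
  have hb0 : ∀ e ∈ E, ∑ i, b i * (actionRank K (Submodule.span R {ε i}) e : ℤ) = 0 :=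
    fun e he => by
      have := ha e he
      simp_rw [fun i => hb i (Finset.mem_univ i), mul_assoc] at this
      rw [← Finset.mul_sum] at this
      exact (mul_eq_zero.1 this).resolve_left hg
  -- The combination of the traces on the modules `R ε_i` with weights `b i`. It vanishes on `E`,
  -- hence everywhere by linearity, whereas its value at `ε_j` is the image of `b j` in `K`.
  let T : R →ₗ[K] K := ∑ i, (b i : K) •
    (LinearMap.trace K (Submodule.span R {ε i}) ∘ₗ
      (Algebra.lsmul K K (Submodule.span R {ε i}) : R →ₐ[K] _).toLinearMap)
  have hTe : ∀ e, IsIdempotentElem e → T e =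
      ((∑ i, b i * (actionRank K (Submodule.span R {ε i}) e : ℤ) : ℤ) : K) := fun e he => by
    simp [T, trace_lsmul_of_isIdempotentElem K he]
  have hT : T = 0 := by
    refine LinearMap.ext_on hspan fun e he => ?_
    rw [hTe e (hE e he), hb0 e he]
    simp
  have hbK : ∀ j, (b j : K) = 0 := fun j => by
    have := hTe (ε j) (hε.idem j)
    simp_rw [hε.actionRank_span] at this
    simpa [hT] using this.symm
  -- The characteristic, zero or not, divides all `b j`, whose gcd is `1`; this is absurd in both
  -- cases.
  have hp : ∀ j, ((ringChar K : ℕ) : ℤ) ∣ b j := fun j =>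
    (CharP.intCast_eq_zero_iff K (ringChar K) (b j)).1 (hbK j)
  have h1 := Finset.dvd_gcd fun j (_ : j ∈ Finset.univ) => hp j
  rw [hb1] at h1
  have h2 : ringChar K = 1 := by
    have := Int.isUnit_iff_natAbs_eq.1 (isUnit_of_dvd_one h1)
    simpa using this
  exact CharP.ringChar_ne_one h2

/-- A nonzero map `S → V` makes some `ε_i` nonzero on both sides. By equality of multiplicities `ε_i
W ≠ 0`, so `R ε_i` embeds in both `S` and `W`, and by semisimplicity its map to `W` extends to `S`.
-/
theorem exists_linearMap_ne_zero [FiniteDimensional K R] [IsSemisimpleRing R] [Fintype ι]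
    {E : Set R} (hE : ∀ e ∈ E, IsIdempotentElem e) (hspan : Submodule.span K E = ⊤)
    {V W S : Type*} [AddCommGroup V] [Module K V] [Module R V] [IsScalarTower K R V]
    [FiniteDimensional K V] [AddCommGroup W] [Module K W] [Module R W] [IsScalarTower K R W]
    [FiniteDimensional K W] [AddCommGroup S] [Module R S]
    (h : ∀ e ∈ E, actionRank K V e = actionRank K W e) {f : S →ₗ[R] V} (hf : f ≠ 0) :
    ∃ f' : S →ₗ[R] W, f' ≠ 0 := by
  obtain ⟨s, hs⟩ : ∃ s, f s ≠ 0 := by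
    by_contra! h
    exact hf (LinearMap.ext h)
  obtain ⟨i, y, hi⟩ := hε.exists_smul_ne_zero hs
  rw [← map_smul] at hi
  have hpos : actionRank K V (ε i) ≠ 0 := by
    rw [actionRank, Ne, Submodule.finrank_eq_zero]
    intro h0
    have : ε i • f (y • s) ∈ LinearMap.range (Algebra.lsmul K K V (ε i)) := ⟨_, rfl⟩
    rw [h0] at this
    exact hi (by simpa using this)
  rw [hε.actionRank_eq_of_forall hE hspan h i, actionRank, Ne, Submodule.finrank_eq_zero] at hpos
  obtain ⟨w, ⟨w', rfl⟩, hw0⟩ := Submodule.exists_mem_ne_zero_of_ne_bot hpos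
  have hs0 : ε i • (y • s) ≠ 0 := fun h0 => hi (by rw [← map_smul, h0, map_zero])
  obtain ⟨p, hp, hps⟩ := hε.exists_injective hs0 (by rw [← mul_smul, (hε.idem i).eq])
  obtain ⟨q, -, hqs⟩ := hε.exists_injective (s := ε i • w') hw0
    (by rw [← mul_smul, (hε.idem i).eq])
  obtain ⟨r, hr⟩ := IsSemisimpleModule.extension_property p hp q
  refine ⟨r, fun h0 => hw0 ?_⟩
  have := LinearMap.congr_fun hr ⟨ε i, Submodule.mem_span_singleton_self _⟩
  rw [h0, LinearMap.zero_comp, LinearMap.zero_apply, hqs] at this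
  change ε i • w' = 0
  rw [this, ← mul_smul, (hε.idem i).eq]

end IsSplitSystem

end SplitSystem

/-! ### Projectors to the eigenspaces of a cyclic group -/

section Projector

variable {k : Type*} [Field k] {C : Type*} [Group C] [Finite C]

/-- The element `|C|⁻¹ ∑ ψ(s)⁻¹ s` that projects to the `ψ`-eigenspace. -/
def charProj {A : Type*} [Ring A] [Algebra k A] (r : C →* A) (ψ : C →* kˣ) : A :=
  letI := Fintype.ofFinite C
  (Nat.card C : k)⁻¹ • ∑ s, ((ψ s⁻¹ : kˣ) : k) • r s

variable {A : Type*} [Ring A] [Algebra k A] (r : C →* A) (ψ : C →* kˣ)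

theorem map_charProj {B : Type*} [Ring B] [Algebra k B] (f : A →ₐ[k] B) :
    f (charProj r ψ) = charProj ((f : A →* B).comp r) ψ := by
  simp [charProj]

theorem mul_charProj (s : C) : r s * charProj r ψ = ((ψ s : kˣ) : k) • charProj r ψ := by
  let := Fintype.ofFinite C
  have h : ∑ x, r s * (((ψ x⁻¹ : kˣ) : k) • r x) =
      ∑ x, ((ψ s : kˣ) : k) • ((ψ x⁻¹ : kˣ) : k) • r x := by
    refine Fintype.sum_equiv (Equiv.mulLeft s) _ _ fun x => ?_
    rw [Equiv.coe_mulLeft, mul_smul_comm, ← map_mul, smul_smul, ← Units.val_mul, ← map_mul]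
    simp
  rw [charProj, mul_smul_comm, Finset.mul_sum, h, ← Finset.smul_sum, smul_comm]

theorem smul_charProj_smul {V : Type*} [AddCommGroup V] [Module k V] [Module A V]
    [IsScalarTower k A V] (v : V) (s : C) :
    r s • charProj r ψ • v = ((ψ s : kˣ) : k) • charProj r ψ • v := by
  rw [← mul_smul, mul_charProj, smul_assoc]

theorem charProj_mul_of_ne {ψ φ : C →* kˣ} (h : ψ ≠ φ) : charProj r ψ * charProj r φ = 0 := by
  let := Fintype.ofFinite C
  rw [charProj, smul_mul_assoc, Finset.sum_mul]
  have : ∀ s : C, (((ψ s⁻¹ : kˣ) : k) • r s) * charProj r φ =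
      ((((φ * ψ⁻¹) s : kˣ)) : k) • charProj r φ := fun s => by
    rw [smul_mul_assoc, mul_charProj, smul_smul, ← Units.val_mul, mul_comm]
    simp
  simp only [this]
  rw [← Finset.sum_smul, sum_character_eq_zero, zero_smul, smul_zero]
  intro h'
  exact h (mul_inv_eq_one.1 h').symm

variable [HasEnoughRootsOfUnity k (Nat.card C)]

theorem charProj_smul_of_forall {V : Type*} [AddCommGroup V] [Module k V] [Module A V]
    [IsScalarTower k A V] {v : V} (h : ∀ s, r s • v = ((ψ s : kˣ) : k) • v) :
    charProj r ψ • v = v := by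
  let := Fintype.ofFinite C
  have hC := natCast_ne_zero_of_hasEnoughRootsOfUnity k (Nat.card C)
  rw [charProj, smul_assoc, Finset.sum_smul]
  have : ∀ s : C, (((ψ s⁻¹ : kˣ) : k) • r s) • v = v := fun s => by
    rw [smul_assoc, h, smul_smul, ← Units.val_mul, ← map_mul]
    simp
  simp only [this, Finset.sum_const, Finset.card_univ]
  rw [← Nat.cast_smul_eq_nsmul k, smul_smul, Nat.card_eq_fintype_card,
    inv_mul_cancel₀ (by rwa [← Nat.card_eq_fintype_card]), one_smul]

theorem isIdempotentElem_charProj : IsIdempotentElem (charProj r ψ) :=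
  charProj_smul_of_forall r ψ fun s => mul_charProj r ψ s

theorem sum_charProj [IsCyclic C] [Fintype (C →* kˣ)] : ∑ ψ : C →* kˣ, charProj r ψ = 1 := by
  classical
  let := Fintype.ofFinite C
  have hC := natCast_ne_zero_of_hasEnoughRootsOfUnity k (Nat.card C)
  simp only [charProj]
  rw [← Finset.smul_sum, Finset.sum_comm]
  simp only [← Finset.sum_smul, sum_characters_apply, inv_eq_one, ite_smul, zero_smul]
  rw [Finset.sum_ite_eq' Finset.univ 1]
  rw [if_pos (Finset.mem_univ _), smul_smul, inv_mul_cancel₀ hC, one_smul, map_one]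

/-- Consequently the projectors of the cyclic subgroups span the group algebra of any finite group
with enough roots of unity in the field. -/
theorem apply_eq_sum_charProj [IsCyclic C] [Fintype (C →* kˣ)] (s : C) :
    r s = ∑ ψ : C →* kˣ, ((ψ s : kˣ) : k) • charProj r ψ := by
  conv_lhs => rw [← mul_one (r s), ← sum_charProj (k := k) r, Finset.mul_sum]
  exact Finset.sum_congr rfl fun ψ _ => mul_charProj r ψ s

end Projector

/-! ### Eigenspaces of cyclic subgroups determine the embedded representations -/

section Representation

/-- The space of vectors on which the elements `s` of `C` act as the scalars `ψ s`. -/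
def charEigenspace {F C V : Type*} [Field F] [Group C] [AddCommGroup V]
    [Module F V] (ρ : Representation F C V) (ψ : C →* Fˣ) : Submodule F V where
  carrier := {v | ∀ s, ρ s v = ((ψ s : Fˣ) : F) • v}
  add_mem' hv hw s := by rw [map_add, hv s, hw s, smul_add]
  zero_mem' s := by simp
  smul_mem' c v hv s := by rw [map_smul, hv s, smul_comm]

theorem range_charProj_eq_charEigenspace {F C V : Type*} [Field F] [Group C] [Finite C]
    [HasEnoughRootsOfUnity F (Nat.card C)] [AddCommGroup V] [Module F V]
    (ρ : Representation F C V) (ψ : C →* Fˣ) :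
    LinearMap.range (charProj (A := Module.End F V) ρ ψ) = charEigenspace ρ ψ := by
  ext v
  constructor
  · rintro ⟨w, rfl⟩ s
    exact smul_charProj_smul (A := Module.End F V) ρ ψ w s
  · intro hv
    exact ⟨v, charProj_smul_of_forall (A := Module.End F V) ρ ψ hv⟩

theorem finrank_range_baseChange {F V : Type*} [Field F] [AddCommGroup V] [Module F V]
    (K : Type*) [Field K] [Algebra F K] (P : Module.End F V) :
    Module.finrank K (LinearMap.range (P.baseChange K)) =
      Module.finrank F (LinearMap.range P) := by
  have h : P.baseChange K =
      (LinearMap.range P).subtype.baseChange K ∘ₗ P.rangeRestrict.baseChange K := by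
    rw [← LinearMap.baseChange_comp]
    rfl
  have hsurj : Function.Surjective (P.rangeRestrict.baseChange K) :=
    LinearMap.lTensor_surjective K (LinearMap.surjective_rangeRestrict P)
  have hinj : Function.Injective ((LinearMap.range P).subtype.baseChange K) :=
    Module.Flat.lTensor_preserves_injective_linearMap _ (LinearMap.range P).injective_subtype
  rw [h, LinearMap.range_comp_of_range_eq_top _ (LinearMap.range_eq_top.2 hsurj),
    ← (LinearEquiv.ofInjective _ hinj).finrank_eq, Module.finrank_baseChange]

/-- A coordinate functional of a basis of `K` over `F` does it. This is how maps found over the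
algebraic closure are brought back to `F`. -/
theorem exists_rTensor_apply_ne_zero {F V : Type*} [Field F] [AddCommGroup V] [Module F V]
    {K : Type*} [Field K] [Algebra F K] {x : K ⊗[F] V} (hx : x ≠ 0) :
    ∃ c : K →ₗ[F] F, TensorProduct.lid F V (c.rTensor V x) ≠ 0 := by
  by_contra! h
  let b := Module.Free.chooseBasis F K
  refine hx ((TensorProduct.equivFinsuppOfBasisLeft b).injective (Finsupp.ext fun i => ?_))
  rw [map_zero, Finsupp.zero_apply, ← h (b.coord i)]
  clear hx h
  induction x with
  | zero => simp
  | tmul a v => simp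
  | add x y hx hy => rw [map_add, map_add, map_add, Finsupp.add_apply, hx, hy]

/-- The extension of scalars of a representation. -/
def repBaseChange {F I V : Type*} [Field F] [Group I] [AddCommGroup V] [Module F V]
    (K : Type*) [Field K] [Algebra F K] (ρ : Representation F I V) :
    Representation K I (K ⊗[F] V) where
  toFun g := (ρ g).baseChange K
  map_one' := by rw [map_one]; exact LinearMap.baseChange_id
  map_mul' a b := by rw [map_mul]; exact LinearMap.baseChange_comp _ _

/-- Since `ψ` has values in `F`, its projector is defined over `F`, and the dimension of its image
is unchanged by extension of scalars. -/
theorem actionRank_charProj {F I V : Type*} [Field F] [Group I] [Finite I]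
    [AddCommGroup V] [Module F V] (K : Type*) [Field K] [Algebra F K]
    (ρ : Representation F I V) (τ : Subgroup I) [HasEnoughRootsOfUnity F (Nat.card τ)]
    (ψ : τ →* Fˣ) :
    actionRank K (repBaseChange K ρ).asModule
        (charProj (((MonoidAlgebra.of K I).comp τ.subtype)) ψ) =
      Module.finrank F (charEigenspace (ρ.comp τ.subtype) ψ) := by
  rw [← range_charProj_eq_charEigenspace, ← finrank_range_baseChange K, actionRank]
  have : (charProj (A := Module.End F V) (ρ.comp τ.subtype) ψ).baseChange K =
      (repBaseChange K ρ).asAlgebraHom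
        (charProj (((MonoidAlgebra.of K I).comp τ.subtype)) ψ) := by
    have h1 := map_charProj (A := Module.End F V) (B := Module.End K (K ⊗[F] V))
      (ρ.comp τ.subtype) ψ (Module.End.baseChangeHom F K V)
    have h2 := map_charProj (B := Module.End K (K ⊗[F] V))
      ((MonoidAlgebra.of K I).comp τ.subtype) ψ
      ((repBaseChange K ρ).asAlgebraHom.restrictScalars F)
    refine h1.trans (Eq.trans ?_ h2.symm)
    congr 1
    ext1 s
    exact ((repBaseChange K ρ).asAlgebraHom_of s).symm
  rw [this]
  rfl

theorem exists_asModule_linearMap {F I V W : Type*} [Field F] [Group I]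
    [AddCommGroup V] [Module F V] [AddCommGroup W] [Module F W]
    {ρV : Representation F I V} {ρW : Representation F I W} (f : V →ₗ[F] W)
    (hf : ∀ g v, f (ρV g v) = ρW g (f v)) :
    ∃ f' : ρV.asModule →ₗ[MonoidAlgebra F I] ρW.asModule, ∀ v : V, f' v = f v := by
  refine ⟨{ toFun := f, map_add' := f.map_add, map_smul' := fun x v => ?_ }, fun v => rfl⟩
  have key (x : MonoidAlgebra F I) (v : V) :
      f (ρV.asAlgebraHom x v) = ρW.asAlgebraHom x (f v) := by
    induction x using MonoidAlgebra.induction_on with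
    | of g => rw [Representation.asAlgebraHom_of, Representation.asAlgebraHom_of, hf]
    | add x y hx hy =>
      rw [map_add, map_add, LinearMap.add_apply, LinearMap.add_apply, map_add, hx, hy]
    | smul c x hx =>
      rw [map_smul, map_smul, LinearMap.smul_apply, LinearMap.smul_apply, map_smul, hx]
  exact key x v

theorem exists_intertwining_of_asModule {F I V W : Type*} [Field F] [Group I]
    [AddCommGroup V] [Module F V] [AddCommGroup W] [Module F W]
    {ρV : Representation F I V} {ρW : Representation F I W}
    (f : ρV.asModule →ₗ[MonoidAlgebra F I] ρW.asModule) :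
    ∃ f' : V →ₗ[F] W, (∀ g v, f' (ρV g v) = ρW g (f' v)) ∧ ∀ v : V, f' v = f v := by
  refine ⟨(f.restrictScalars F : ρV.asModule →ₗ[F] ρW.asModule), fun g v => ?_, fun v => rfl⟩
  have h := f.map_smul (MonoidAlgebra.of F I g) v
  rw [← Representation.asAlgebraHom_of, ← Representation.asAlgebraHom_of]
  exact h

theorem IsSplitSystem.exists_intertwining_ne_zero {K I ι V W S : Type*} [Field K] [Group I]
    [Finite I] [NeZero (Nat.card I : K)] [Fintype ι] {ε : ι → MonoidAlgebra K I}
    (hε : IsSplitSystem K ε) {E : Set (MonoidAlgebra K I)} (hE : ∀ e ∈ E, IsIdempotentElem e)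
    (hspan : Submodule.span K E = ⊤) [AddCommGroup V] [Module K V] [FiniteDimensional K V]
    [AddCommGroup W] [Module K W] [FiniteDimensional K W] [AddCommGroup S] [Module K S]
    {ρV : Representation K I V} {ρW : Representation K I W} {ρS : Representation K I S}
    (h : ∀ e ∈ E, actionRank K ρV.asModule e = actionRank K ρW.asModule e)
    {f : S →ₗ[K] V} (hf : ∀ g s, f (ρS g s) = ρV g (f s)) (hf0 : f ≠ 0) :
    ∃ f' : S →ₗ[K] W, (∀ g s, f' (ρS g s) = ρW g (f' s)) ∧ f' ≠ 0 := by
  obtain ⟨p, hp⟩ := exists_asModule_linearMap f hf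
  have hp0 : p ≠ 0 := fun h0 => hf0 (LinearMap.ext fun s => (hp s).symm.trans (by rw [h0]; rfl))
  have : FiniteDimensional K ρV.asModule := inferInstanceAs (FiniteDimensional K V)
  have : FiniteDimensional K ρW.asModule := inferInstanceAs (FiniteDimensional K W)
  obtain ⟨q, hq⟩ := hε.exists_linearMap_ne_zero hE hspan h hp0
  obtain ⟨q', hq'g, hq'⟩ := exists_intertwining_of_asModule q
  exact ⟨q', hq'g, fun h0 => hq (LinearMap.ext fun s => (hq' s).symm.trans (by rw [h0]; rfl))⟩

/-- If the eigenspaces of all cyclic subgroups have the same dimensions in `V` and in `W`, then a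
representation that maps to `V` also maps to `W`. -/
theorem exists_intertwining_ne_zero {F I V W S : Type*} [Field F] [Group I] [Finite I]
    [HasEnoughRootsOfUnity F (Nat.card I)]
    [AddCommGroup V] [Module F V] [FiniteDimensional F V]
    [AddCommGroup W] [Module F W] [FiniteDimensional F W] [AddCommGroup S] [Module F S]
    (ρV : Representation F I V) (ρW : Representation F I W) (ρS : Representation F I S)
    (h : ∀ (τ : Subgroup I), IsCyclic τ → ∀ ψ : τ →* Fˣ,
      Module.finrank F (charEigenspace (ρV.comp τ.subtype) ψ) =
        Module.finrank F (charEigenspace (ρW.comp τ.subtype) ψ))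
    {f : S →ₗ[F] V} (hf : ∀ g s, f (ρS g s) = ρV g (f s)) (hf0 : f ≠ 0) :
    ∃ f' : S →ₗ[F] W, (∀ g s, f' (ρS g s) = ρW g (f' s)) ∧ f' ≠ 0 := by
  classical
  let K := AlgebraicClosure F
  have hcard := natCast_ne_zero_of_hasEnoughRootsOfUnity F (Nat.card I)
  have : NeZero (Nat.card I : K) := ⟨fun h0 => hcard (by
    rwa [← map_natCast (algebraMap F K), map_eq_zero] at h0)⟩
  obtain ⟨n, ε, hε⟩ := exists_isSplitSystem (K := K) (R := MonoidAlgebra K I)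
  let r (τ : Subgroup I) : τ →* MonoidAlgebra K I := (MonoidAlgebra.of K I).comp τ.subtype
  let E : Set (MonoidAlgebra K I) :=
    {e | ∃ (τ : Subgroup I) (_ : IsCyclic τ) (ψ : τ →* Fˣ), e = charProj (r τ) ψ}
  have hroots (τ : Subgroup I) : HasEnoughRootsOfUnity F (Nat.card τ) :=
    HasEnoughRootsOfUnity.of_dvd F (Subgroup.card_subgroup_dvd_card τ)
  have hE : ∀ e ∈ E, IsIdempotentElem e := by
    rintro _ ⟨τ, hτ, ψ, rfl⟩
    have := hroots τ
    exact isIdempotentElem_charProj _ _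
  -- Each `g` is a combination of the projectors of the cyclic group it generates.
  have hspan : Submodule.span K E = ⊤ := by
    rw [eq_top_iff]
    rintro x -
    induction x using MonoidAlgebra.induction_on with
    | of g =>
      have := hroots (Subgroup.zpowers g)
      let := Fintype.ofFinite (Subgroup.zpowers g →* Fˣ)
      have hg := apply_eq_sum_charProj (k := F) (r (Subgroup.zpowers g))
        ⟨g, Subgroup.mem_zpowers g⟩
      change MonoidAlgebra.of K I g = _ at hg
      rw [hg]
      refine Submodule.sum_mem _ fun ψ _ => ?_
      rw [← algebraMap_smul K]
      exact Submodule.smul_mem _ _ (Submodule.subset_span ⟨_, inferInstance, ψ, rfl⟩)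
    | add x y hx hy => exact Submodule.add_mem _ hx hy
    | smul c x hx => exact Submodule.smul_mem _ c hx
  have hfK (g : I) (x : K ⊗[F] S) :
      f.baseChange K (repBaseChange K ρS g x) = repBaseChange K ρV g (f.baseChange K x) := by
    have : f ∘ₗ ρS g = ρV g ∘ₗ f := LinearMap.ext (hf g)
    change (f.baseChange K ∘ₗ (ρS g).baseChange K) x = ((ρV g).baseChange K ∘ₗ f.baseChange K) x
    rw [← LinearMap.baseChange_comp, ← LinearMap.baseChange_comp, this]
  have hf0K : f.baseChange K ≠ 0 := fun h0 => hf0 (LinearMap.ext fun s =>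
    Module.FaithfullyFlat.tensorProduct_mk_injective (A := F) (B := K) V
      ((LinearMap.congr_fun h0 ((1 : K) ⊗ₜ[F] s)).trans (map_zero _).symm))
  have hrank : ∀ e ∈ E, actionRank K (repBaseChange K ρV).asModule e =
      actionRank K (repBaseChange K ρW).asModule e := by
    rintro _ ⟨τ, hτ, ψ, rfl⟩
    have := hroots τ
    rw [actionRank_charProj K ρV τ ψ, actionRank_charProj K ρW τ ψ, h τ hτ ψ]
  obtain ⟨q', hq'g, hq'⟩ := hε.exists_intertwining_ne_zero hE hspan hrank hfK hf0K
  obtain ⟨s, hs⟩ : ∃ s : S, q' ((1 : K) ⊗ₜ[F] s) ≠ 0 := by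
    by_contra! h0
    exact hq' (TensorProduct.AlgebraTensorModule.curry_injective
      (LinearMap.ext_ring (LinearMap.ext h0)))
  obtain ⟨c, hc⟩ := exists_rTensor_apply_ne_zero hs
  -- The group acts on the factor `W` only, so applying an `F`-linear functional to the factor `K`
  -- is equivariant.
  let l : K ⊗[F] W →ₗ[F] W := (TensorProduct.lid F W).toLinearMap ∘ₗ c.rTensor W
  have hl (g : I) (x : K ⊗[F] W) : l (repBaseChange K ρW g x) = ρW g (l x) := by
    change l ((ρW g).baseChange K x) = _
    induction x with
    | zero => simp
    | tmul a w => simp [l]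
    | add x y hx hy => rw [map_add, map_add, map_add, map_add, hx, hy]
  refine ⟨l ∘ₗ q'.restrictScalars F ∘ₗ TensorProduct.mk F K S 1, fun g s => ?_, fun h0 => hc ?_⟩
  · change l (q' (1 ⊗ₜ ρS g s)) = ρW g (l (q' (1 ⊗ₜ s)))
    rw [← hl, ← hq'g]
    rfl
  · exact LinearMap.congr_fun h0 s

end Representation

/-! ### The rank at a maximal ideal of modules over a semisimple ring -/

section Rank

variable {A : Type*} [CommRing A] (𝔪 : Ideal A)

/-- The dimension over `A / 𝔪` of the part of `N` that is killed by `𝔪`. -/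
def rankAt (N : Type*) [AddCommGroup N] [Module A N] : ℕ :=
  Module.finrank (A ⧸ 𝔪) (Submodule.torsionBySet A N (𝔪 : Set A))

variable {𝔪}

theorem mem_torsionBySet_ideal {N : Type*} [AddCommGroup N] [Module A N] {x : N} :
    x ∈ Submodule.torsionBySet A N (𝔪 : Set A) ↔ ∀ a ∈ 𝔪, a • x = 0 := by
  rw [Submodule.mem_torsionBySet_iff]
  exact ⟨fun h a ha => h ⟨a, ha⟩, fun h a => h a a.2⟩

/-- The restriction of a linear map to the parts that are killed by `𝔪`. -/
def torsionMap (𝔪 : Ideal A) {N N' : Type*} [AddCommGroup N] [Module A N] [AddCommGroup N']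
    [Module A N'] (f : N →ₗ[A] N') :
    Submodule.torsionBySet A N (𝔪 : Set A) →ₗ[A ⧸ 𝔪]
      Submodule.torsionBySet A N' (𝔪 : Set A) :=
  LinearMap.extendScalarsOfSurjective (R := A) Ideal.Quotient.mk_surjective
    (f.restrict (q := Submodule.torsionBySet A N' (𝔪 : Set A)) fun x hx =>
      mem_torsionBySet_ideal.2 fun a ha => by
        rw [← map_smul, mem_torsionBySet_ideal.1 hx a ha, map_zero])

@[simp] theorem torsionMap_coe {N N' : Type*} [AddCommGroup N] [Module A N] [AddCommGroup N']
    [Module A N'] (f : N →ₗ[A] N') (x : Submodule.torsionBySet A N (𝔪 : Set A)) :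
    (torsionMap 𝔪 f x : N') = f x := rfl

variable {N N' P : Type*} [AddCommGroup N] [Module A N] [AddCommGroup N'] [Module A N']
  [AddCommGroup P] [Module A P]

theorem rankAt_congr (e : N ≃ₗ[A] N') : rankAt 𝔪 N = rankAt 𝔪 N' := by
  refine LinearEquiv.finrank_eq (LinearEquiv.ofLinearMap (torsionMap 𝔪 (e : N →ₗ[A] N'))
    (torsionMap 𝔪 (e.symm : N' →ₗ[A] N)) ?_ ?_) <;>
  · refine LinearMap.ext fun x => Subtype.ext ?_
    simp

theorem rankAt_eq_of_semilinear {N N' : Type u} [AddCommGroup N] [Module A N] [AddCommGroup N']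
    [Module A N'] {𝔫 : Ideal A} (i : A ≃+* A) (hi : ∀ a, i a ∈ 𝔫 ↔ a ∈ 𝔪) (e : N ≃+ N')
    (he : ∀ a n, e (a • n) = i a • e n) : rankAt 𝔪 N = rankAt 𝔫 N' := by
  have hmap : 𝔫 = 𝔪.map (i : A →+* A) := by
    ext a
    rw [Ideal.mem_map_iff_of_surjective (i : A →+* A) i.surjective]
    constructor
    · intro ha
      exact ⟨i.symm a, (hi _).1 (by simpa using ha), i.apply_symm_apply a⟩
    · rintro ⟨b, hb, rfl⟩
      exact (hi b).2 hb
  have hmem (n : N) : n ∈ Submodule.torsionBySet A N (𝔪 : Set A) ↔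
      e n ∈ Submodule.torsionBySet A N' (𝔫 : Set A) := by
    rw [mem_torsionBySet_ideal, mem_torsionBySet_ideal]
    constructor
    · intro h a ha
      have := he (i.symm a) n
      rw [h _ ((hi _).1 (by simpa using ha)), map_zero] at this
      simpa using this.symm
    · intro h a ha
      refine e.injective ?_
      rw [he, h _ ((hi a).2 ha), map_zero]
  let j : Submodule.torsionBySet A N (𝔪 : Set A) ≃+ Submodule.torsionBySet A N' (𝔫 : Set A) :=
    { toFun := fun n => ⟨e n, (hmem n).1 n.2⟩
      invFun := fun n => ⟨e.symm n, (hmem _).2 (by simp)⟩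
      left_inv := fun n => Subtype.ext (e.symm_apply_apply n.1)
      right_inv := fun n => Subtype.ext (e.apply_symm_apply n.1)
      map_add' := fun _ _ => Subtype.ext (map_add e _ _) }
  refine congrArg Cardinal.toNat (rank_eq_of_equiv_equiv (Ideal.quotientEquiv 𝔪 𝔫 i hmap) j
    (Ideal.quotientEquiv 𝔪 𝔫 i hmap).bijective fun r n => ?_)
  obtain ⟨a, rfl⟩ := Ideal.Quotient.mk_surjective r
  exact Subtype.ext (he a n)

/-- Exact sequences of modules over a semisimple ring split, so taking the part killed by `𝔪` is
exact also on the right. -/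
theorem rankAt_of_exact [IsSemisimpleRing A] [𝔪.IsMaximal] [Module.Finite A N']
    (f : N →ₗ[A] N') (g : N' →ₗ[A] P) (hf : Function.Injective f) (hfg : Function.Exact f g)
    (hg : Function.Surjective g) : rankAt 𝔪 N' = rankAt 𝔪 N + rankAt 𝔪 P := by
  let := Ideal.Quotient.field 𝔪
  have : Module.Finite (A ⧸ 𝔪) (Submodule.torsionBySet A N' (𝔪 : Set A)) :=
    Module.Finite.of_restrictScalars_finite A _ _
  have hsurj : Function.Surjective (torsionMap 𝔪 g) := fun p => by
    obtain ⟨s, hs⟩ := IsSemisimpleModule.lifting_property g hg LinearMap.id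
    have hs' (p : P) : g (s p) = p := LinearMap.congr_fun hs p
    exact ⟨torsionMap 𝔪 s p, Subtype.ext (hs' p)⟩
  have hinj : Function.Injective (torsionMap 𝔪 f) := fun x y h =>
    Subtype.ext (hf (congrArg Subtype.val h))
  have hker : LinearMap.ker (torsionMap 𝔪 g) = LinearMap.range (torsionMap 𝔪 f) := by
    ext x
    constructor
    · intro hx
      obtain ⟨n, hn⟩ := (hfg x.1).1 (congrArg Subtype.val hx)
      refine ⟨⟨n, mem_torsionBySet_ideal.2 fun a ha => hf ?_⟩, Subtype.ext hn⟩
      rw [map_smul, hn, mem_torsionBySet_ideal.1 x.2 a ha, map_zero]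
    · rintro ⟨n, rfl⟩
      exact Subtype.ext (hfg.apply_apply_eq_zero n.1)
  have h := LinearMap.finrank_range_add_finrank_ker (torsionMap 𝔪 g)
  rw [LinearMap.range_eq_top.2 hsurj, finrank_top, hker, LinearMap.finrank_range_of_inj hinj] at h
  rw [rankAt, ← h, add_comm]
  rfl

theorem exists_torsionBySet_ne_bot [IsSemisimpleRing A] [Nontrivial N] :
    ∃ 𝔪 : Ideal A, 𝔪.IsMaximal ∧ Submodule.torsionBySet A N (𝔪 : Set A) ≠ ⊥ := by
  obtain ⟨T, hT⟩ := IsSemisimpleModule.exists_simple_submodule A N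
  refine ⟨Module.annihilator A T, IsSimpleModule.annihilator_isMaximal, fun h => ?_⟩
  have := IsSimpleModule.nontrivial A T
  obtain ⟨t, ht⟩ := exists_ne (0 : T)
  refine ht (Subtype.ext ?_)
  have hmem : (t : N) ∈ Submodule.torsionBySet A N ((Module.annihilator A T : Ideal A) : Set A) :=
    mem_torsionBySet_ideal.2 fun a ha =>
      congrArg Subtype.val (Module.mem_annihilator.1 ha t)
  rw [h] at hmem
  simpa using hmem

end Rank

/-! ### Equivariant maps from inertia-equivariant maps -/

section Inertia

variable {G : Type u} [Group G] {A : Type u} [CommRing A] (ρ : G →* RingAut A) (𝔪 : Ideal A)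

theorem ringAut_mul_apply (g h : G) (a : A) : ρ (g * h) a = ρ g (ρ h a) := by
  rw [map_mul]; rfl

theorem ringAut_one_apply (a : A) : ρ 1 a = a := by
  rw [map_one]; rfl

theorem EquivSheaf.act_mul_apply {ρ : G →* RingAut A} (M : EquivSheaf ρ) (g h : G)
    (m : M.carrier) : M.act (g * h) m = M.act g (M.act h m) := by
  rw [map_mul]; rfl

theorem EquivSheaf.act_one_apply {ρ : G →* RingAut A} (M : EquivSheaf ρ) (m : M.carrier) :
    M.act 1 m = m := by
  rw [map_one]; rfl

/-- The elements of `G` that act trivially on `A / 𝔪`. -/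
def inertia : Subgroup G where
  carrier := {g | ∀ a, ρ g a - a ∈ 𝔪}
  one_mem' a := by simp
  mul_mem' {g h} hg hh a := by
    have := 𝔪.add_mem (hg (ρ h a)) (hh a)
    rw [ringAut_mul_apply]
    convert this using 1
    ring
  inv_mem' {g} hg a := by
    have := 𝔪.neg_mem (hg (ρ g⁻¹ a))
    rw [← ringAut_mul_apply, mul_inv_cancel, ringAut_one_apply] at this
    convert this using 1
    ring

/-- Geometrically, the left side says that the point `𝔪` lies on `X^τ`; the equivalence itself holds
for every ideal. -/
theorem fixedIdeal_le_iff {τ : Subgroup G} : fixedIdeal ρ τ ≤ 𝔪 ↔ τ ≤ inertia ρ 𝔪 := by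
  rw [fixedIdeal, Ideal.span_le]
  constructor
  · intro h s hs a
    exact h ⟨s, hs, a, rfl⟩
  · rintro h _ ⟨s, hs, a, rfl⟩
    exact h hs a

theorem inertia_apply_mem {g : G} (hg : g ∈ inertia ρ 𝔪) {a : A} (ha : a ∈ 𝔪) : ρ g a ∈ 𝔪 := by
  have := 𝔪.add_mem (hg a) ha
  rwa [sub_add_cancel] at this

variable {ρ}

theorem EquivSheaf.act_mem_torsionBySet (M : EquivSheaf ρ) {g : G} (hg : g ∈ inertia ρ 𝔪)
    {m : M.carrier} (hm : m ∈ Submodule.torsionBySet A M.carrier (𝔪 : Set A)) :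
    M.act g m ∈ Submodule.torsionBySet A M.carrier (𝔪 : Set A) := by
  refine mem_torsionBySet_ideal.2 fun a ha => ?_
  have h := M.act_smul g (ρ g⁻¹ a) m
  rw [← ringAut_mul_apply, mul_inv_cancel, ringAut_one_apply] at h
  rw [← h, mem_torsionBySet_ideal.1 hm _ (inertia_apply_mem ρ 𝔪 (inv_mem hg) ha), map_zero]

/-- The representation of the inertia group on the part of `M` that is killed by `𝔪`. -/
def inertiaRep (M : EquivSheaf ρ) :
    Representation (A ⧸ 𝔪) (inertia ρ 𝔪) (Submodule.torsionBySet A M.carrier (𝔪 : Set A)) where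
  toFun g := LinearMap.extendScalarsOfSurjective (R := A) Ideal.Quotient.mk_surjective
    { toFun := fun m => ⟨M.act g m, M.act_mem_torsionBySet 𝔪 g.2 m.2⟩
      map_add' := fun m m' => Subtype.ext (map_add _ _ _)
      map_smul' := fun a m => Subtype.ext (by
        have h : (ρ (g : G) a - a) • M.act g m.1 = 0 :=
          mem_torsionBySet_ideal.1 (M.act_mem_torsionBySet 𝔪 g.2 m.2) _ (g.2 a)
        rw [sub_smul, sub_eq_zero] at h
        exact (M.act_smul g a m.1).trans h) }
  map_one' := LinearMap.ext fun m => Subtype.ext (M.act_one_apply m.1)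
  map_mul' g h := LinearMap.ext fun m => Subtype.ext (M.act_mul_apply g h m.1)

/-- The conjugate by `g` of an additive map, followed by the action of `g`. -/
def conjugateMap {S M : EquivSheaf ρ} (f : S.carrier →ₗ[A] M.carrier) (g : G) :
    S.carrier →ₗ[A] M.carrier where
  toFun s := M.act g (f (S.act g⁻¹ s))
  map_add' s t := by simp
  map_smul' a s := by
    rw [S.act_smul, map_smul, M.act_smul, ← ringAut_mul_apply, mul_inv_cancel, ringAut_one_apply]
    rfl

/-- Extend `f` to an `A`-linear map `F` and average its conjugates with weights `ρ g c`, for all `c`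
in `A`. If all averages vanished, independence of the characters `c ↦ ρ g c mod 𝔪` would isolate the
elements `g` in the inertia group. For these the conjugate of `F` still restricts to `f`, so the
order of the inertia group would kill `f`. -/
theorem exists_equivariant_ne_zero [IsSemisimpleRing A] [Finite G] [𝔪.IsMaximal]
    (hG : (Nat.card G : A ⧸ 𝔪) ≠ 0) {S M : EquivSheaf ρ}
    (f : Submodule.torsionBySet A S.carrier (𝔪 : Set A) →ₗ[A ⧸ 𝔪]
      Submodule.torsionBySet A M.carrier (𝔪 : Set A))
    (hf : ∀ g s, f (inertiaRep 𝔪 S g s) = inertiaRep 𝔪 M g (f s)) (hf0 : f ≠ 0) :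
    ∃ f' : S.carrier →ₗ[A] M.carrier, EquivSheaf.IsEquivariant f' ∧ f' ≠ 0 := by
  classical
  let := Fintype.ofFinite G
  let := Ideal.Quotient.field 𝔪
  set T := Submodule.torsionBySet A S.carrier (𝔪 : Set A)
  set T' := Submodule.torsionBySet A M.carrier (𝔪 : Set A)
  obtain ⟨F, hF⟩ := IsSemisimpleModule.extension_property T.subtype T.injective_subtype
    (T'.subtype ∘ₗ f.restrictScalars A)
  -- A retraction to the part of `M` killed by `𝔪`: for `g` outside the inertia group the conjugates
  -- of `F` need not map `T` to `T'`.
  obtain ⟨p, hp⟩ := IsSemisimpleModule.extension_property T'.subtype T'.injective_subtype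
    LinearMap.id
  have hF' (s : T) : F s = f s := LinearMap.congr_fun hF s
  have hp' (m : T') : p m = m := LinearMap.congr_fun hp m
  let Φ (c : A) : S.carrier →ₗ[A] M.carrier := ∑ g, ρ g c • conjugateMap F g
  have hΦ (c : A) : EquivSheaf.IsEquivariant (Φ c) := fun h s => by
    simp only [Φ, LinearMap.sum_apply, map_sum, LinearMap.smul_apply]
    refine Fintype.sum_equiv (Equiv.mulLeft h⁻¹) _ _ fun g => ?_
    rw [M.act_smul, ← ringAut_mul_apply]
    change _ • M.act g (F (S.act g⁻¹ (S.act h s))) =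
      _ • M.act h (M.act (h⁻¹ * g) (F (S.act (h⁻¹ * g)⁻¹ s)))
    rw [← S.act_mul_apply, ← M.act_mul_apply]
    simp
  by_contra! hcon
  obtain ⟨s, hs⟩ : ∃ s, f s ≠ 0 := by
    by_contra! h0
    exact hf0 (LinearMap.ext h0)
  let χ (g : G) : A →* A ⧸ 𝔪 :=
    ((Ideal.Quotient.mk 𝔪).comp (ρ g : A ≃+* A).toRingHom : A →+* A ⧸ 𝔪)
  have hχ (g : G) (c : A) : χ g c = Ideal.Quotient.mk 𝔪 (ρ g c) := rfl
  let w (g : G) : T' := p (conjugateMap F g s)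
  have hsum (c : A) : ∑ g, χ g c • w g = 0 := by
    have h0 := congrArg (fun m => p (m (s : S.carrier))) (hcon (Φ c) (hΦ c))
    simp only [Φ, LinearMap.sum_apply, map_sum, LinearMap.smul_apply, map_smul,
      LinearMap.zero_apply, map_zero] at h0
    exact h0
  have hker (g : G) (hg : χ g = χ 1) : w g = f s := by
    have hgI : g ∈ inertia ρ 𝔪 := fun a => by
      have := DFunLike.congr_fun hg a
      rw [hχ, hχ, ringAut_one_apply] at this
      exact Ideal.Quotient.eq.1 this
    have h1 := hf ⟨g, hgI⟩⁻¹ s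
    change p (M.act g (F (S.act g⁻¹ s))) = f s
    have h2 : F (S.act g⁻¹ s) = M.act g⁻¹ (f s) :=
      (hF' (inertiaRep 𝔪 S ⟨g, hgI⟩⁻¹ s)).trans (congrArg Subtype.val h1)
    rw [h2, ← M.act_mul_apply, mul_inv_cancel, M.act_one_apply, hp']
  have hlin : ∑ g with χ g = χ 1, w g = 0 := by
    refine (Module.forall_dual_apply_eq_zero_iff (A ⧸ 𝔪) _).1 fun l => ?_
    -- A functional `l` turns the relation between vectors into one between `A ⧸ 𝔪`-valued
    -- characters of `A`; terms with the same character are collected before independence is used.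
    have hind := linearIndependent_iff'.1 (linearIndependent_monoidHom A (A ⧸ 𝔪))
      (Finset.univ.image χ) (fun ψ => l (∑ g with χ g = ψ, w g)) (by
        funext c
        have := congrArg l (hsum c)
        rw [map_zero, map_sum] at this
        rw [Finset.sum_apply, Pi.zero_apply, ← this,
          ← Finset.sum_fiberwise_of_maps_to (t := Finset.univ.image χ) (g := χ)
            fun g hg => Finset.mem_image_of_mem χ hg]
        refine Finset.sum_congr rfl fun ψ _ => ?_
        rw [Pi.smul_apply, map_sum, smul_eq_mul, Finset.sum_mul]
        refine Finset.sum_congr rfl fun g hg => ?_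
        rw [map_smul, smul_eq_mul, mul_comm, (Finset.mem_filter.1 hg).2])
      (χ 1) (Finset.mem_image_of_mem χ (Finset.mem_univ 1))
    exact hind
  rw [Finset.sum_congr rfl fun g hg => hker g (Finset.mem_filter.1 hg).2, Finset.sum_const,
    ← Nat.cast_smul_eq_nsmul (A ⧸ 𝔪), smul_eq_zero] at hlin
  refine hs (hlin.resolve_left fun h0 => hG ?_)
  have hcard : Finset.univ.filter (fun g => χ g = χ 1) =
      Finset.univ.filter (fun g => g ∈ inertia ρ 𝔪) := by
    refine Finset.filter_congr fun g _ => ⟨fun hg a => ?_, fun hg => MonoidHom.ext fun a => ?_⟩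
    · have := DFunLike.congr_fun hg a
      rw [hχ, hχ, ringAut_one_apply] at this
      exact Ideal.Quotient.eq.1 this
    · rw [hχ, hχ, ringAut_one_apply]
      exact Ideal.Quotient.eq.2 (hg a)
  rw [hcard, ← Fintype.card_subtype, ← Nat.card_eq_fintype_card] at h0
  obtain ⟨d, hd⟩ := Subgroup.card_subgroup_dvd_card (inertia ρ 𝔪)
  rw [hd, Nat.cast_mul]
  exact mul_eq_zero_of_left h0 _

end Inertia

/-! ### Eigensheaves on the fixed point subschemes -/

section Eigen

variable {k : Type u} [Field k] {G : Type u} [Group G] {A : Type u} [CommRing A]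
  (κ : k →+* A) {ρ : G →* RingAut A} (τ : Subgroup G) (ψ : τ →* kˣ)

/-- The sections of `M` over `X^τ` on which `τ` acts through the character `ψ`. -/
def eigen (M : EquivSheaf ρ) : Submodule A M.carrier where
  carrier := {m | (∀ a ∈ fixedIdeal ρ τ, a • m = 0) ∧
    ∀ s : τ, M.act s m = κ ((ψ s : kˣ) : k) • m}
  add_mem' hm hm' := ⟨fun a ha => by rw [smul_add, hm.1 a ha, hm'.1 a ha, add_zero],
    fun s => by rw [map_add, hm.2 s, hm'.2 s, smul_add]⟩
  zero_mem' := ⟨fun a _ => smul_zero a, fun s => by rw [map_zero, smul_zero]⟩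
  smul_mem' a m hm := ⟨fun b hb => by rw [smul_comm, hm.1 b hb, smul_zero], fun s => by
    have h : (ρ (s : G) a - a) • m = 0 := hm.1 _ (Ideal.subset_span ⟨s, s.2, a, rfl⟩)
    rw [sub_smul, sub_eq_zero] at h
    rw [M.act_smul, hm.2 s, smul_comm, h, smul_comm]⟩

variable {κ τ ψ}

theorem isTorsionBySet_eigen (M : EquivSheaf ρ) :
    Module.IsTorsionBySet A (eigen κ τ ψ M) (fixedIdeal ρ τ : Set A) := by
  intro m a
  exact Subtype.ext (m.2.1 a a.2)

variable (κ τ ψ)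

/-- The restriction of an equivariant map to the eigensheaves. -/
def eigenMap {M N : EquivSheaf ρ} (f : M.carrier →ₗ[A] N.carrier)
    (hf : EquivSheaf.IsEquivariant f) : eigen κ τ ψ M →ₗ[A] eigen κ τ ψ N :=
  f.restrict fun m hm => ⟨fun a ha => by rw [← map_smul, hm.1 a ha, map_zero],
    fun s => by rw [← hf, hm.2 s, map_smul]⟩

@[simp] theorem eigenMap_coe {M N : EquivSheaf ρ} (f : M.carrier →ₗ[A] N.carrier)
    (hf : EquivSheaf.IsEquivariant f) (m : eigen κ τ ψ M) :
    (eigenMap κ τ ψ f hf m : N.carrier) = f m := rfl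

theorem exact_eigenMap {M N P : EquivSheaf ρ} {f : M.carrier →ₗ[A] N.carrier}
    {g : N.carrier →ₗ[A] P.carrier} (h : EquivSheaf.IsShortExact f g) :
    Function.Exact (eigenMap κ τ ψ f h.equivariant_left)
      (eigenMap κ τ ψ g h.equivariant_right) := by
  intro n
  constructor
  · intro hn
    obtain ⟨m, hm⟩ := (h.exact n.1).1 (congrArg Subtype.val hn)
    refine ⟨⟨m, fun a ha => h.injective ?_, fun s => h.injective ?_⟩, Subtype.ext hm⟩
    · rw [map_smul, hm, n.2.1 a ha, map_zero]
    · rw [h.equivariant_left, hm, n.2.2 s, map_smul, hm]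
  · rintro ⟨m, rfl⟩
    exact Subtype.ext (h.exact.apply_apply_eq_zero m.1)

theorem eigenMap_injective {M N P : EquivSheaf ρ} {f : M.carrier →ₗ[A] N.carrier}
    {g : N.carrier →ₗ[A] P.carrier} (h : EquivSheaf.IsShortExact f g) :
    Function.Injective (eigenMap κ τ ψ f h.equivariant_left) := fun _ _ h' =>
  Subtype.ext (h.injective (congrArg Subtype.val h'))

theorem act_smul_eq_zero {M : EquivSheaf ρ} {m : M.carrier}
    (hm : ∀ a ∈ fixedIdeal ρ τ, a • m = 0) (s : τ) :
    ∀ a ∈ fixedIdeal ρ τ, a • M.act s m = 0 := fun a ha => by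
  have hle : τ ≤ inertia ρ (fixedIdeal ρ τ) := (fixedIdeal_le_iff ρ _).1 le_rfl
  exact mem_torsionBySet_ideal.1
    (M.act_mem_torsionBySet _ (hle s.2) (mem_torsionBySet_ideal.2 hm)) a ha

section

variable [Finite G] [HasEnoughRootsOfUnity k (Nat.card G)] [IsSemisimpleRing A]
  (hκ : ∀ g c, ρ g (κ c) = κ c)

include hκ in
-- A section of `p` lifts by an `A`-linear splitting, which need not be equivariant; the character
-- projector of `τ` then moves the lift into the eigensheaf without changing its image.
theorem eigenMap_surjective {M N P : EquivSheaf ρ} {f : M.carrier →ₗ[A] N.carrier}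
    {g : N.carrier →ₗ[A] P.carrier} (h : EquivSheaf.IsShortExact f g) :
    Function.Surjective (eigenMap κ τ ψ g h.equivariant_right) := by
  let := Fintype.ofFinite τ
  obtain ⟨l, hl⟩ := IsSemisimpleModule.lifting_property g h.surjective LinearMap.id
  have hl' (p : P.carrier) : g (l p) = p := LinearMap.congr_fun hl p
  have hcard : (Nat.card τ : k) ≠ 0 := natCast_ne_zero_of_hasEnoughRootsOfUnity k (Nat.card τ)
  intro p
  let n : N.carrier := κ (Nat.card τ : k)⁻¹ • ∑ s : τ, κ ((ψ s⁻¹ : kˣ) : k) • N.act s (l p)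
  have hlp : ∀ a ∈ fixedIdeal ρ τ, a • l p = 0 := fun a ha => by
    rw [← map_smul, p.2.1 a ha, map_zero]
  refine ⟨⟨n, fun a ha => ?_, fun t => ?_⟩, Subtype.ext ?_⟩
  · simp only [n]
    rw [smul_comm, Finset.smul_sum, Finset.sum_eq_zero, smul_zero]
    intro s _
    rw [smul_comm, act_smul_eq_zero τ hlp s a ha, smul_zero]
  · simp only [n]
    have hsum : ∑ s : τ, N.act t (κ ((ψ s⁻¹ : kˣ) : k) • N.act s (l p)) =
        ∑ s : τ, κ ((ψ t : kˣ) : k) • κ ((ψ s⁻¹ : kˣ) : k) • N.act s (l p) := by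
      refine Fintype.sum_equiv (Equiv.mulLeft t) _ _ fun s => ?_
      rw [N.act_smul, hκ, ← N.act_mul_apply, Equiv.coe_mulLeft, smul_smul, ← map_mul,
        ← Units.val_mul, ← map_mul]
      simp
    rw [N.act_smul, hκ, smul_comm (κ ((ψ t : kˣ) : k)), map_sum, hsum, ← Finset.smul_sum]
  · simp only [n, eigenMap_coe, map_smul, map_sum]
    have : ∀ s : τ, κ ((ψ s⁻¹ : kˣ) : k) • g (N.act s (l p)) = p := fun s => by
      rw [h.equivariant_right, hl', p.2.2 s, smul_smul, ← map_mul, ← Units.val_mul, ← map_mul]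
      simp
    rw [Finset.sum_congr rfl fun s _ => this s, Finset.sum_const, Finset.card_univ,
      ← Nat.cast_smul_eq_nsmul A, smul_smul, ← map_natCast κ, ← map_mul,
      ← Nat.card_eq_fintype_card, inv_mul_cancel₀ hcard, map_one, one_smul]

/-- The eigensheaf as a coherent sheaf on `X^τ`. -/
def eigenSheaf (M : EquivSheaf ρ) :
    EquivSheaf (1 : PUnit.{u + 1} →* RingAut (FixedRing ρ τ)) where
  carrier := eigen κ τ ψ M
  module := (isTorsionBySet_eigen M).module
  finite := by
    let : Module (FixedRing ρ τ) (eigen κ τ ψ M) := (isTorsionBySet_eigen M).module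
    have : IsScalarTower A (FixedRing ρ τ) (eigen κ τ ψ M) := (isTorsionBySet_eigen M).isScalarTower
    exact Module.Finite.of_restrictScalars_finite A _ _
  act := 1
  act_smul _ _ _ := rfl

include hκ in
theorem isExactOn_eigenSheaf : IsExactOn (eigenSheaf (ρ := ρ) κ τ ψ) := by
  intro M N P f g h
  refine ⟨{ toFun := eigenMap κ τ ψ f h.equivariant_left, map_add' := map_add _,
            map_smul' := fun a m => ?_ },
    { toFun := eigenMap κ τ ψ g h.equivariant_right, map_add' := map_add _,
      map_smul' := fun a m => ?_ }, ⟨fun _ _ => rfl, fun _ _ => rfl, eigenMap_injective κ τ ψ h,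
      exact_eigenMap κ τ ψ h, eigenMap_surjective κ τ ψ hκ h⟩⟩
  · obtain ⟨a, rfl⟩ := Ideal.Quotient.mk_surjective a
    exact LinearMap.map_smul (eigenMap κ τ ψ f h.equivariant_left) a m
  · obtain ⟨a, rfl⟩ := Ideal.Quotient.mk_surjective a
    exact LinearMap.map_smul (eigenMap κ τ ψ g h.equivariant_right) a m

/-- The map `[M] ↦ [M_ψ]` to the Grothendieck group of the fixed point subscheme. -/
def eigenK0 : EquivK0 ρ →+ OrdK0 (FixedRing ρ τ) :=
  EquivK0.map (eigenSheaf κ τ ψ) (isExactOn_eigenSheaf κ τ ψ hκ)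

@[simp] theorem eigenK0_mk (M : EquivSheaf ρ) :
    eigenK0 κ τ ψ hκ (EquivK0.mk M) = EquivK0.mk (eigenSheaf κ τ ψ M) :=
  EquivK0.map_mk _ _ M

end

end Eigen

/-! ### Extension of characters to a larger field -/

section ExtendCharacter

variable {k F C : Type*} [Field k] [Field F] [Group C] (i : k →+* F)

/-- The character with values in `F` given by a character with values in `k`. -/
def extendChar (ψ : C →* kˣ) : C →* Fˣ := (Units.map (i : k →* F)).comp ψ

theorem extendChar_injective : Function.Injective (extendChar i : (C →* kˣ) → (C →* Fˣ)) :=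
  fun _ _ h => MonoidHom.ext fun s => Units.ext (i.injective
    (congrArg (fun u : Fˣ => (u : F)) (DFunLike.congr_fun h s)))

include i in
theorem hasEnoughRootsOfUnity_of_ringHom (n : ℕ) [NeZero n] [HasEnoughRootsOfUnity k n] :
    HasEnoughRootsOfUnity F n := by
  obtain ⟨ζ, hζ⟩ := HasEnoughRootsOfUnity.exists_primitiveRoot k n
  exact ⟨⟨i ζ, hζ.map_of_injective i.injective⟩, inferInstance⟩

/-- Both character groups have `|C|` elements, as both fields contain enough roots of unity. So
residue field extensions bring no new characters of cyclic groups. -/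
theorem extendChar_bijective [Finite C] [IsCyclic C] [HasEnoughRootsOfUnity k (Nat.card C)] :
    Function.Bijective (extendChar i : (C →* kˣ) → (C →* Fˣ)) := by
  have := hasEnoughRootsOfUnity_of_ringHom i (Nat.card C)
  refine (extendChar_injective i).bijective_of_nat_card_le ?_
  obtain ⟨t, ht, ho⟩ := exists_character_generator (k := k) (C := C)
  obtain ⟨t', ht', ho'⟩ := exists_character_generator (k := F) (C := C)
  rw [← orderOf_eq_card_of_forall_mem_zpowers ht, ← orderOf_eq_card_of_forall_mem_zpowers ht', ho,
    ho']

end ExtendCharacter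

/-! ### Eigenspaces under restriction to a subgroup -/

section EigenspaceDimension

theorem charEigenspace_comp_of_surjective {F C D V : Type*} [Field F] [Group C] [Group D]
    [AddCommGroup V] [Module F V] (ρ : Representation F C V) (ψ : C →* Fˣ) {j : D →* C}
    (hj : Function.Surjective j) :
    charEigenspace (ρ.comp j) (ψ.comp j) = charEigenspace ρ ψ := by
  ext v
  constructor
  · intro hv s
    obtain ⟨t, rfl⟩ := hj s
    exact hv t
  · exact fun hv t => hv (j t)

open scoped Classical in
-- The projectors decompose `V` into eigenspaces of `C`; the `φ`-eigenspace for `j` is the sum of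
-- those whose character restricts to `φ`.
theorem finrank_charEigenspace_comp {F C D V : Type*} [Field F] [Group C] [Finite C] [IsCyclic C]
    [HasEnoughRootsOfUnity F (Nat.card C)] [Fintype (C →* Fˣ)] [Group D] [AddCommGroup V]
    [Module F V] [FiniteDimensional F V] (ρ : Representation F C V) (j : D →* C) (φ : D →* Fˣ) :
    Module.finrank F (charEigenspace (ρ.comp j) φ) = ∑ χ : C →* Fˣ,
      if χ.comp j = φ then Module.finrank F (charEigenspace ρ χ) else 0 := by
  rw [← Finset.sum_filter, ← Finset.sum_subtype_eq_sum_filter,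
    Finset.subtype_univ]
  let p (χ : C →* Fˣ) : Module.End F V := charProj (A := Module.End F V) ρ χ
  have hp (χ : C →* Fˣ) (v : V) : p χ v ∈ charEigenspace ρ χ := fun s =>
    smul_charProj_smul (A := Module.End F V) ρ χ v s
  have hself {χ : C →* Fˣ} {v : V} (hv : v ∈ charEigenspace ρ χ) : p χ v = v :=
    charProj_smul_of_forall (A := Module.End F V) ρ χ hv
  have hne {χ χ' : C →* Fˣ} {v : V} (hv : v ∈ charEigenspace ρ χ') (h : χ ≠ χ') : p χ v = 0 := by
    rw [← hself hv]
    exact LinearMap.congr_fun (charProj_mul_of_ne (A := Module.End F V) ρ h) v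
  have hsum (v : V) : ∑ χ, p χ v = v := by
    have := LinearMap.congr_fun (sum_charProj (k := F) (A := Module.End F V) ρ) v
    rwa [LinearMap.sum_apply] at this
  have hle {χ : C →* Fˣ} (h : χ.comp j = φ) : charEigenspace ρ χ ≤ charEigenspace (ρ.comp j) φ :=
    fun v hv s => by
      subst h
      exact hv (j s)
  have hres {χ : C →* Fˣ} (h : χ.comp j ≠ φ) {v : V} (hv : v ∈ charEigenspace (ρ.comp j) φ) :
      p χ v = 0 := by
    obtain ⟨s, hs⟩ : ∃ s, χ (j s) ≠ φ s := by
      by_contra! h0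
      exact h (MonoidHom.ext h0)
    -- The cyclic group `C` is abelian, so `p χ v` has the eigenvalue `φ s` as well as `χ (j s)`,
    -- and must vanish when these differ.
    have hcomm : ρ (j s) * p χ = p χ * ρ (j s) := by
      let := Fintype.ofFinite C
      let : CommGroup C := IsCyclic.commGroup
      simp only [p, charProj]
      rw [mul_smul_comm, smul_mul_assoc, Finset.mul_sum, Finset.sum_mul]
      congr 1
      refine Finset.sum_congr rfl fun t _ => ?_
      rw [mul_smul_comm, smul_mul_assoc, ← map_mul, ← map_mul, mul_comm]
    have h1 : ρ (j s) (p χ v) = p χ (ρ (j s) v) := LinearMap.congr_fun hcomm v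
    rw [hp χ v (j s), show ρ (j s) v = ((φ s : Fˣ) : F) • v from hv s, map_smul, ← sub_eq_zero,
      ← sub_smul, smul_eq_zero] at h1
    refine h1.resolve_left fun h2 => hs (Units.ext (sub_eq_zero.1 h2))
  rw [← Module.finrank_pi_fintype F]
  refine LinearEquiv.finrank_eq
    { toFun := fun v χ => ⟨p χ v, hp χ v⟩
      invFun := fun v => ⟨∑ χ, (v χ : V), Submodule.sum_mem _ fun χ _ => hle χ.2 (v χ).2⟩
      map_add' := fun v w => funext fun χ => Subtype.ext (map_add (p χ) _ _)
      map_smul' := fun c v => funext fun χ => Subtype.ext (map_smul (p χ) _ _)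
      left_inv := fun v => Subtype.ext ?_
      right_inv := fun v => funext fun χ => Subtype.ext ?_ }
  · change ∑ χ : {χ : C →* Fˣ // χ.comp j = φ}, p χ v = v
    conv_rhs => rw [← hsum v]
    rw [← Finset.sum_filter_add_sum_filter_not Finset.univ fun χ : C →* Fˣ => χ.comp j = φ,
      Finset.sum_eq_zero (s := Finset.univ.filter fun χ : C →* Fˣ => ¬ χ.comp j = φ)
        fun χ hχ => hres (Finset.mem_filter.1 hχ).2 v.2, add_zero,
      ← Finset.sum_subtype_eq_sum_filter, Finset.subtype_univ]
  · change p χ (∑ χ', (v χ' : V)) = v χ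
    rw [map_sum, Finset.sum_eq_single χ, hself (v χ).2]
    · intro χ' _ hχ'
      exact hne (v χ').2 fun h => hχ' (Subtype.ext h.symm)
    · simp

end EigenspaceDimension

/-! ### The ranks of the eigensheaves determine the class of a sheaf -/

section Ranks

variable {k : Type u} [Field k] {G : Type u} [Group G] {A : Type u} [CommRing A]
  (κ : k →+* A) {ρ : G →* RingAut A} {𝔪 : Ideal A}

/-- The residue field at `𝔪` as an extension of `k`. -/
def residueHom (𝔪 : Ideal A) : k →+* A ⧸ 𝔪 := (Ideal.Quotient.mk 𝔪).comp κ

/-- Both sides describe the same vectors: as `𝔪` lies on `X^τ`, being killed by `𝔪` includes being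
killed by `fixedIdeal ρ τ`. -/
theorem finrank_charEigenspace_inertiaRep [𝔪.IsMaximal] (M : EquivSheaf ρ) {τ : Subgroup G}
    (hτ : τ ≤ inertia ρ 𝔪) (ψ : τ →* kˣ) :
    letI := Ideal.Quotient.field 𝔪
    Module.finrank (A ⧸ 𝔪) (charEigenspace ((inertiaRep 𝔪 M).comp (Subgroup.inclusion hτ))
      (extendChar (residueHom κ 𝔪) ψ)) = rankAt 𝔪 (eigen κ τ ψ M) := by
  let := Ideal.Quotient.field 𝔪
  have hle := (fixedIdeal_le_iff ρ 𝔪).2 hτ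
  have hsc (c : k) (v : Submodule.torsionBySet A M.carrier (𝔪 : Set A)) :
      ((residueHom κ 𝔪 c • v : Submodule.torsionBySet A M.carrier (𝔪 : Set A)) : M.carrier) =
        κ c • (v : M.carrier) := rfl
  refine LinearEquiv.finrank_eq
    { toFun := fun v => ⟨⟨v.1.1, fun a ha => mem_torsionBySet_ideal.1 v.1.2 a (hle ha),
          fun s => congrArg Subtype.val (v.2 s)⟩,
        mem_torsionBySet_ideal.2 fun a ha => Subtype.ext (mem_torsionBySet_ideal.1 v.1.2 a ha)⟩
      invFun := fun v => ⟨⟨v.1.1, mem_torsionBySet_ideal.2 fun a ha =>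
          congrArg Subtype.val (mem_torsionBySet_ideal.1 v.2 a ha)⟩,
        fun s => Subtype.ext (v.1.2.2 s)⟩
      map_add' := fun _ _ => rfl
      map_smul' := fun r v => ?_
      left_inv := fun _ => rfl
      right_inv := fun _ => rfl }
  obtain ⟨a, rfl⟩ := Ideal.Quotient.mk_surjective r
  rfl

theorem finiteDimensional_torsionBySet [IsNoetherianRing A] (M : EquivSheaf ρ) :
    Module.Finite (A ⧸ 𝔪) (Submodule.torsionBySet A M.carrier (𝔪 : Set A)) :=
  Module.Finite.of_restrictScalars_finite A _ _

variable [Finite G] [HasEnoughRootsOfUnity k (Nat.card G)] [IsSemisimpleRing A]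

open scoped Classical in
theorem rankAt_eigen_eq_sum [𝔪.IsMaximal] (M : EquivSheaf ρ) {τ D : Subgroup G} [IsCyclic τ]
    (hτ : fixedIdeal ρ τ ≤ 𝔪) (hD : D ≤ τ) (φ : D →* kˣ) :
    rankAt 𝔪 (eigen κ D φ M) = ∑ χ : τ →* kˣ,
      if χ.comp (Subgroup.inclusion hD) = φ then rankAt 𝔪 (eigen κ τ χ M) else 0 := by
  let := Ideal.Quotient.field 𝔪
  have := finiteDimensional_torsionBySet (𝔪 := 𝔪) M
  have hτI := (fixedIdeal_le_iff ρ 𝔪).1 hτ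
  let i := residueHom κ 𝔪
  have := hasEnoughRootsOfUnity_of_ringHom i (Nat.card τ)
  let := Fintype.ofFinite (τ →* (A ⧸ 𝔪)ˣ)
  have h := finrank_charEigenspace_comp ((inertiaRep 𝔪 M).comp (Subgroup.inclusion hτI))
    (Subgroup.inclusion hD) (extendChar i φ)
  have h0 := finrank_charEigenspace_inertiaRep κ M (hD.trans hτI) φ
  refine h0.symm.trans (h.trans ?_)
  refine (Fintype.sum_equiv (Equiv.ofBijective _ (extendChar_bijective i)) _ _ fun χ => ?_).symm
  have hiff : (extendChar i χ).comp (Subgroup.inclusion hD) = extendChar i φ ↔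
      χ.comp (Subgroup.inclusion hD) = φ :=
    ⟨fun h => extendChar_injective i h, fun h => congrArg (extendChar i) h⟩
  rw [Equiv.ofBijective_apply]
  by_cases hχ : χ.comp (Subgroup.inclusion hD) = φ
  · rw [if_pos hχ, if_pos (hiff.2 hχ), ← finrank_charEigenspace_inertiaRep κ M hτI]
  · rw [if_neg hχ, if_neg fun h => hχ (hiff.1 h)]

/-- If the eigensheaves of `M` and `M'` have the same ranks, then an equivariant sheaf that maps to
`M` also maps to `M'`. -/
theorem exists_equivariant_of_rankAt_eigen [𝔪.IsMaximal] {M M' S : EquivSheaf ρ}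
    (h : ∀ τ : Subgroup G, IsCyclic τ → fixedIdeal ρ τ ≤ 𝔪 → ∀ ψ : τ →* kˣ,
      rankAt 𝔪 (eigen κ τ ψ M) = rankAt 𝔪 (eigen κ τ ψ M'))
    {f : S.carrier →ₗ[A] M.carrier} (hf : EquivSheaf.IsEquivariant f) (hf0 : torsionMap 𝔪 f ≠ 0) :
    ∃ f' : S.carrier →ₗ[A] M'.carrier, EquivSheaf.IsEquivariant f' ∧ f' ≠ 0 := by
  let := Ideal.Quotient.field 𝔪
  have := finiteDimensional_torsionBySet (𝔪 := 𝔪) M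
  have := finiteDimensional_torsionBySet (𝔪 := 𝔪) M'
  let i := residueHom κ 𝔪
  have := hasEnoughRootsOfUnity_of_ringHom i (Nat.card (inertia ρ 𝔪))
  have hG : (Nat.card G : A ⧸ 𝔪) ≠ 0 := by
    rw [← map_natCast i]
    exact (map_ne_zero i).2 (natCast_ne_zero_of_hasEnoughRootsOfUnity k (Nat.card G))
  have hdim (τ : Subgroup (inertia ρ 𝔪)) (hτ : IsCyclic τ) (ψ : τ →* (A ⧸ 𝔪)ˣ) :
      Module.finrank (A ⧸ 𝔪) (charEigenspace ((inertiaRep 𝔪 M).comp τ.subtype) ψ) =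
        Module.finrank (A ⧸ 𝔪) (charEigenspace ((inertiaRep 𝔪 M').comp τ.subtype) ψ) := by
    let τ' : Subgroup G := τ.map (inertia ρ 𝔪).subtype
    let e : τ ≃* τ' := τ.equivMapOfInjective _ (Subgroup.subtype_injective _)
    have hτ' : τ' ≤ inertia ρ 𝔪 := by
      rintro _ ⟨s, -, rfl⟩
      exact s.2
    have hcyc : IsCyclic τ' := isCyclic_of_surjective e e.surjective
    have hroots := hasEnoughRootsOfUnity_of_ringHom i (Nat.card τ')
    -- The characters over the residue field come from `k`, where the hypothesis on ranks applies.
    obtain ⟨φ, hφ⟩ := (extendChar_bijective (C := τ') i).2 (ψ.comp e.symm.toMonoidHom)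
    have hψ : ψ = (extendChar i φ).comp e.toMonoidHom := by
      rw [hφ]
      ext s
      simp
    have key (N : EquivSheaf ρ) : Module.finrank (A ⧸ 𝔪)
        (charEigenspace ((inertiaRep 𝔪 N).comp τ.subtype) ψ) = rankAt 𝔪 (eigen κ τ' φ N) := by
      rw [← finrank_charEigenspace_inertiaRep κ N hτ',
        ← charEigenspace_comp_of_surjective _ _ (j := e.toMonoidHom) e.surjective, hψ]
      rfl
    rw [key M, key M']
    exact h τ' hcyc ((fixedIdeal_le_iff ρ 𝔪).2 hτ') φ
  obtain ⟨f', hf', hf'0⟩ := exists_intertwining_ne_zero (inertiaRep 𝔪 M) (inertiaRep 𝔪 M')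
    (inertiaRep 𝔪 S) hdim (f := torsionMap 𝔪 f) (fun g s => Subtype.ext (hf g s.1)) hf0
  exact exists_equivariant_ne_zero 𝔪 hG f' hf' hf'0

end Ranks

/-! ### Equality of classes from equality of ranks -/

section ClassOfRanks

variable {k : Type u} [Field k] {G : Type u} [Group G] {A : Type u} [CommRing A]
  {ρ : G →* RingAut A}

/-- The equivariant subsheaf given by a stable submodule. -/
def EquivSheaf.sub [IsNoetherianRing A] (M : EquivSheaf ρ) (N : Submodule A M.carrier)
    (hN : ∀ g, ∀ n ∈ N, M.act g n ∈ N) : EquivSheaf ρ where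
  carrier := N
  act :=
    { toFun := fun g =>
        { toFun := fun n => ⟨M.act g n, hN g n n.2⟩
          map_zero' := Subtype.ext (map_zero _)
          map_add' := fun _ _ => Subtype.ext (map_add _ _ _) }
      map_one' := AddMonoidHom.ext fun n => Subtype.ext (M.act_one_apply n.1)
      map_mul' := fun g h => AddMonoidHom.ext fun n => Subtype.ext (M.act_mul_apply g h n.1) }
  act_smul g a m := Subtype.ext (M.act_smul g a m)

theorem EquivSheaf.exists_isShortExact {S M : EquivSheaf ρ} {f : S.carrier →ₗ[A] M.carrier}
    (hf : EquivSheaf.IsEquivariant f) (hinj : Function.Injective f) :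
    ∃ (Q : EquivSheaf ρ) (g : M.carrier →ₗ[A] Q.carrier), EquivSheaf.IsShortExact f g := by
  let N := LinearMap.range f
  have hN (g : G) : N.toAddSubgroup ≤ N.toAddSubgroup.comap (M.act g) := by
    rintro _ ⟨s, rfl⟩
    exact ⟨S.act g s, hf g s⟩
  let act (g : G) : M.carrier ⧸ N →+ M.carrier ⧸ N := QuotientAddGroup.map _ _ (M.act g) (hN g)
  let Q : EquivSheaf ρ :=
    { carrier := M.carrier ⧸ N
      act :=
        { toFun := act
          map_one' := AddMonoidHom.ext fun n => by
            obtain ⟨m, rfl⟩ := N.mkQ_surjective n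
            exact congrArg N.mkQ (M.act_one_apply m)
          map_mul' := fun g h => AddMonoidHom.ext fun n => by
            obtain ⟨m, rfl⟩ := N.mkQ_surjective n
            exact congrArg N.mkQ (M.act_mul_apply g h m) }
      act_smul := fun g a n => by
        obtain ⟨m, rfl⟩ := N.mkQ_surjective n
        exact congrArg N.mkQ (M.act_smul g a m) }
  exact ⟨Q, N.mkQ, hf, fun _ _ => rfl, hinj, fun m => Submodule.Quotient.mk_eq_zero N,
    N.mkQ_surjective⟩

theorem EquivK0.mk_eq_zero (M : EquivSheaf ρ) [Subsingleton M.carrier] : EquivK0.mk M = 0 := by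
  have h : EquivSheaf.IsShortExact (M := M) (N := M) (P := M) LinearMap.id 0 :=
    ⟨fun _ _ => rfl, fun _ _ => Subsingleton.elim _ _, fun _ _ h => h,
      fun m => ⟨fun _ => ⟨m, rfl⟩, fun _ => rfl⟩, fun m => ⟨m, Subsingleton.elim _ _⟩⟩
  simpa using EquivK0.mk_eq_add h

theorem EquivK0.mk_congr {M N : EquivSheaf ρ} (e : M.carrier ≃ₗ[A] N.carrier)
    (he : EquivSheaf.IsEquivariant (e : M.carrier →ₗ[A] N.carrier)) :
    EquivK0.mk M = EquivK0.mk N := by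
  let Z : EquivSheaf ρ :=
    { carrier := PUnit, act := 1, act_smul := fun _ _ _ => rfl }
  have : Subsingleton Z.carrier := inferInstanceAs (Subsingleton PUnit)
  have h : EquivSheaf.IsShortExact (P := Z) (e : M.carrier →ₗ[A] N.carrier) 0 :=
    ⟨he, fun _ _ => Subsingleton.elim _ _, e.injective,
      fun n => ⟨fun _ => ⟨e.symm n, e.apply_symm_apply n⟩, fun _ => rfl⟩,
      fun z => ⟨0, Subsingleton.elim _ _⟩⟩
  rw [EquivK0.mk_eq_add h, EquivK0.mk_eq_zero Z, add_zero]

/-- A nonzero equivariant sheaf has a subsheaf on which all equivariant maps are zero or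
injective. -/
theorem EquivSheaf.exists_simple_sub [IsSemisimpleRing A] (M : EquivSheaf ρ)
    [Nontrivial M.carrier] : ∃ (S : EquivSheaf ρ) (f : S.carrier →ₗ[A] M.carrier),
      IsEquivariant f ∧ Function.Injective f ∧ Nontrivial S.carrier ∧
      ∀ (N : EquivSheaf ρ) (g : S.carrier →ₗ[A] N.carrier), IsEquivariant g → g ≠ 0 →
        Function.Injective g := by
  let T : Set (Submodule A M.carrier) := {N | N ≠ ⊥ ∧ ∀ g, ∀ n ∈ N, M.act g n ∈ N}
  have hT : T.Nonempty := ⟨⊤, top_ne_bot, fun _ _ _ => Submodule.mem_top⟩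
  obtain ⟨S, ⟨hS0, hS⟩, hmin⟩ := WellFounded.has_min
    (wellFounded_lt : WellFounded ((· < ·) : Submodule A M.carrier → _ → Prop)) T hT
  refine ⟨M.sub S hS, S.subtype, fun _ _ => rfl, S.injective_subtype,
    Submodule.nontrivial_iff_ne_bot.2 hS0, fun N g hg hg0 => ?_⟩
  by_contra hinj
  -- A stable submodule of `M` contained in the minimal one; if it is nonzero, it is all of `S` and
  -- `g = 0`.
  let K : Submodule A M.carrier := (LinearMap.ker g).map S.subtype
  have hK : K ∈ T := by
    refine ⟨fun h => hinj ?_, ?_⟩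
    · rw [← LinearMap.ker_eq_bot]
      exact Submodule.map_injective_of_injective S.injective_subtype
        (h.trans (Submodule.map_bot _).symm)
    · rintro h _ ⟨n, hn, rfl⟩
      refine ⟨(M.sub S hS).act h n, ?_, rfl⟩
      exact (hg h n).trans ((congrArg (N.act h) hn).trans (map_zero _))
  refine hmin K hK (lt_of_le_of_ne (Submodule.map_subtype_le _ _) fun h => hg0 ?_)
  refine LinearMap.ext fun s => ?_
  have hs : S.subtype s ∈ K := h.ge (Subtype.property (p := fun m => m ∈ S) s)
  obtain ⟨s', hs', hss⟩ := hs
  exact (congrArg g (S.injective_subtype hss)).symm.trans hs'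

theorem rankAt_eq_zero {𝔪 : Ideal A} [𝔪.IsMaximal] (N : Type*) [AddCommGroup N] [Module A N]
    [Subsingleton N] : rankAt 𝔪 N = 0 :=
  let := Ideal.Quotient.field 𝔪
  Module.finrank_zero_of_subsingleton

/-- For the trivial subgroup the eigensheaf is `M` itself, and a nonzero module over a semisimple
ring has nonzero rank at the annihilator of a simple submodule. -/
theorem subsingleton_of_rankAt_eigen [IsSemisimpleRing A] (κ : k →+* A) {M : EquivSheaf ρ}
    (h : ∀ 𝔪 : Ideal A, 𝔪.IsMaximal → rankAt 𝔪 (eigen κ (⊥ : Subgroup G) 1 M) = 0) :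
    Subsingleton M.carrier := by
  by_contra hM
  rw [not_subsingleton_iff_nontrivial] at hM
  obtain ⟨𝔪, hmax, hne⟩ := exists_torsionBySet_ne_bot (A := A) (N := M.carrier)
  let := Ideal.Quotient.field 𝔪
  have hbot : fixedIdeal ρ ⊥ = ⊥ := by
    rw [eq_bot_iff, fixedIdeal, Ideal.span_le]
    rintro _ ⟨s, hs, a, rfl⟩
    rw [Subgroup.mem_bot.1 hs, ringAut_one_apply, sub_self]
    exact Submodule.zero_mem _
  have htop : eigen κ (⊥ : Subgroup G) 1 M = ⊤ := by
    rw [eq_top_iff]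
    refine fun m _ => ⟨fun a ha => ?_, fun s => ?_⟩
    · rw [hbot] at ha
      rw [show a = 0 from ha, zero_smul]
    · rw [Subgroup.mem_bot.1 s.2, M.act_one_apply]
      simp
  have h0 := h 𝔪 hmax
  rw [htop, rankAt_congr Submodule.topEquiv, rankAt] at h0
  have := finiteDimensional_torsionBySet (𝔪 := 𝔪) M
  rw [Module.finrank_zero_iff] at h0
  exact hne ((Submodule.subsingleton_iff_eq_bot).1 h0)

variable (κ : k →+* A) [Finite G] [HasEnoughRootsOfUnity k (Nat.card G)] [IsSemisimpleRing A]
  (hκ : ∀ g c, ρ g (κ c) = κ c)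

include hκ in
theorem rankAt_eigen_of_isShortExact {𝔪 : Ideal A} [𝔪.IsMaximal] (τ : Subgroup G) (ψ : τ →* kˣ)
    {M N P : EquivSheaf ρ} {f : M.carrier →ₗ[A] N.carrier} {g : N.carrier →ₗ[A] P.carrier}
    (h : EquivSheaf.IsShortExact f g) : rankAt 𝔪 (eigen κ τ ψ N) =
      rankAt 𝔪 (eigen κ τ ψ M) + rankAt 𝔪 (eigen κ τ ψ P) :=
  rankAt_of_exact _ _ (eigenMap_injective κ τ ψ h) (exact_eigenMap κ τ ψ h)
    (eigenMap_surjective κ τ ψ hκ h)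

include hκ in
-- Induction on the length of `M`. A simple subsheaf of `M` also embeds in `M'`, and by additivity
-- of the ranks the two quotients satisfy the hypothesis again.
theorem EquivK0.mk_eq_of_rankAt_eigen {M M' : EquivSheaf ρ}
    (h : ∀ 𝔪 : Ideal A, 𝔪.IsMaximal → ∀ τ : Subgroup G, IsCyclic τ → fixedIdeal ρ τ ≤ 𝔪 →
      ∀ ψ : τ →* kˣ, rankAt 𝔪 (eigen κ τ ψ M) = rankAt 𝔪 (eigen κ τ ψ M')) :
    EquivK0.mk M = EquivK0.mk M' := by
  induction hn : (Module.length A M.carrier).toNat using Nat.strong_induction_on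
    generalizing M M' with
  | _ n ih =>
    rcases subsingleton_or_nontrivial M.carrier with hM | hM
    · have : Subsingleton M'.carrier := subsingleton_of_rankAt_eigen κ fun 𝔪 hm => by
        rw [← h 𝔪 hm ⊥ inferInstance ((fixedIdeal_le_iff ρ 𝔪).2 bot_le)]
        exact rankAt_eq_zero _
      rw [EquivK0.mk_eq_zero M, EquivK0.mk_eq_zero M']
    · obtain ⟨S, f, hf, hinj, hS, hsimple⟩ := M.exists_simple_sub
      obtain ⟨𝔪, hmax, hne⟩ := exists_torsionBySet_ne_bot (A := A) (N := S.carrier)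
      have hf0 : torsionMap 𝔪 f ≠ 0 := fun h0 => hne <| by
        rw [eq_bot_iff]
        exact fun s hs => hinj ((congrArg Subtype.val
          (LinearMap.congr_fun h0 ⟨s, hs⟩)).trans (map_zero f).symm)
      obtain ⟨f', hf', hf'0⟩ := exists_equivariant_of_rankAt_eigen κ (h 𝔪 hmax) hf hf0
      obtain ⟨Q, g, hQ⟩ := EquivSheaf.exists_isShortExact hf hinj
      obtain ⟨Q', g', hQ'⟩ := EquivSheaf.exists_isShortExact hf' (hsimple _ f' hf' hf'0)
      rw [EquivK0.mk_eq_add hQ, EquivK0.mk_eq_add hQ']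
      congr 1
      refine ih _ ?_ (fun 𝔫 hn τ hτ hle ψ => ?_) rfl
      · have hlen := Module.length_eq_add_of_exact f g hQ.injective hQ.surjective hQ.exact
        have h1 : Module.length A S.carrier ≠ ⊤ := Module.length_ne_top
        have h2 : Module.length A Q.carrier ≠ ⊤ := Module.length_ne_top
        have hpos : 0 < Module.length A S.carrier := Module.length_pos
        rw [← hn, hlen, ENat.toNat_add h1 h2]
        have : (Module.length A S.carrier).toNat ≠ 0 := fun h0 =>
          (ENat.toNat_eq_zero.1 h0).elim hpos.ne' h1
        omega
      · have := h 𝔫 hn τ hτ hle ψ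
        rw [rankAt_eigen_of_isShortExact κ hκ τ ψ hQ,
          rankAt_eigen_of_isShortExact κ hκ τ ψ hQ'] at this
        exact Nat.add_left_cancel this

end ClassOfRanks

/-! ### Conjugation of eigensheaves -/

section Conjugation

variable {k : Type u} [Field k] {G : Type u} [Group G] {A : Type u} [CommRing A]
  (κ : k →+* A) {ρ : G →* RingAut A}

theorem fixedIdeal_apply_mem {g : G} {τ τ' : Subgroup G} (h : ∀ s ∈ τ, g * s * g⁻¹ ∈ τ') {a : A}
    (ha : a ∈ fixedIdeal ρ τ) : ρ g a ∈ fixedIdeal ρ τ' := by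
  suffices fixedIdeal ρ τ ≤ (fixedIdeal ρ τ').comap (ρ g : A ≃+* A).toRingHom from this ha
  rw [fixedIdeal, Ideal.span_le]
  rintro _ ⟨s, hs, a, rfl⟩
  refine Ideal.subset_span ⟨g * s * g⁻¹, h s hs, ρ g a, ?_⟩
  change ρ g (ρ s a - a) = _
  rw [map_sub, ← ringAut_mul_apply, ← ringAut_mul_apply]
  simp

/-- Conjugation by `g` carries `τ` to `τ'` and the character `ψ` of `τ` to `ψ'`. -/
structure IsConjugateBy (g : G) {τ τ' : Subgroup G} (ψ : τ →* kˣ) (ψ' : τ' →* kˣ) : Prop where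
  mem_iff : ∀ s, s ∈ τ ↔ g * s * g⁻¹ ∈ τ'
  apply_eq : ∀ s (hs : s ∈ τ) (hs' : g * s * g⁻¹ ∈ τ'), ψ' ⟨g * s * g⁻¹, hs'⟩ = ψ ⟨s, hs⟩

theorem IsConjugateBy.symm {g : G} {τ τ' : Subgroup G} {ψ : τ →* kˣ} {ψ' : τ' →* kˣ}
    (h : IsConjugateBy g ψ ψ') : IsConjugateBy g⁻¹ ψ' ψ := by
  have e (s : G) : g * (g⁻¹ * s * g⁻¹⁻¹) * g⁻¹ = s := by group
  refine ⟨fun s => by rw [h.mem_iff, e], fun s hs hs' => ?_⟩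
  rw [← h.apply_eq _ hs' (by rwa [e])]
  exact congrArg ψ' (Subtype.ext (e s))

variable (hκ : ∀ g c, ρ g (κ c) = κ c)

include hκ in
theorem IsConjugateBy.act_mem_eigen {g : G} {τ τ' : Subgroup G} {ψ : τ →* kˣ} {ψ' : τ' →* kˣ}
    (h : IsConjugateBy g ψ ψ') {M : EquivSheaf ρ} {m : M.carrier} (hm : m ∈ eigen κ τ ψ M) :
    M.act g m ∈ eigen κ τ' ψ' M := by
  refine ⟨fun a ha => ?_, fun s => ?_⟩
  · have h1 := M.act_smul g (ρ g⁻¹ a) m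
    rw [← ringAut_mul_apply, mul_inv_cancel, ringAut_one_apply] at h1
    rw [← h1, hm.1 _ (fixedIdeal_apply_mem (fun s hs => (h.symm.mem_iff s).1 hs) ha), map_zero]
  · have hs := (h.symm.mem_iff s).1 s.2
    have h1 := hm.2 ⟨_, hs⟩
    have h2 := h.symm.apply_eq s s.2 hs
    rw [h2] at h1
    have h3 := congrArg (M.act g) h1
    rw [M.act_smul, hκ, ← M.act_mul_apply] at h3
    rw [← h3, ← M.act_mul_apply]
    congr 2
    group

/-- The action of `g` on eigensheaves. -/
def IsConjugateBy.eigenEquiv {g : G} {τ τ' : Subgroup G} {ψ : τ →* kˣ} {ψ' : τ' →* kˣ}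
    (h : IsConjugateBy g ψ ψ') (M : EquivSheaf ρ) : eigen κ τ ψ M ≃+ eigen κ τ' ψ' M where
  toFun m := ⟨M.act g m, h.act_mem_eigen κ hκ m.2⟩
  invFun m := ⟨M.act g⁻¹ m, h.symm.act_mem_eigen κ hκ m.2⟩
  left_inv m := Subtype.ext ((M.act_mul_apply g⁻¹ g m).symm.trans (by
    rw [inv_mul_cancel, M.act_one_apply]))
  right_inv m := Subtype.ext ((M.act_mul_apply g g⁻¹ m).symm.trans (by
    rw [mul_inv_cancel, M.act_one_apply]))
  map_add' _ _ := Subtype.ext (map_add _ _ _)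

theorem IsConjugateBy.eigenEquiv_smul {g : G} {τ τ' : Subgroup G} {ψ : τ →* kˣ} {ψ' : τ' →* kˣ}
    (h : IsConjugateBy g ψ ψ') (M : EquivSheaf ρ) (a : A) (m : eigen κ τ ψ M) :
    h.eigenEquiv κ hκ M (a • m) = ρ g a • h.eigenEquiv κ hκ M m :=
  Subtype.ext (M.act_smul g a m.1)

include hκ in
theorem IsConjugateBy.rankAt_eigen {g : G} {τ τ' : Subgroup G} {ψ : τ →* kˣ} {ψ' : τ' →* kˣ}
    (h : IsConjugateBy g ψ ψ') (M : EquivSheaf ρ) {𝔪 𝔪' : Ideal A}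
    (h𝔪 : ∀ a, ρ g a ∈ 𝔪' ↔ a ∈ 𝔪) :
    rankAt 𝔪 (eigen κ τ ψ M) = rankAt 𝔪' (eigen κ τ' ψ' M) :=
  rankAt_eq_of_semilinear (ρ g) h𝔪 (h.eigenEquiv κ hκ M) (h.eigenEquiv_smul κ hκ M)

end Conjugation

/-! ### Additive invariants of the Grothendieck group -/

section EigenRank

theorem EquivK0.hom_ext {H : Type u} [Group H] {A : Type u} [CommRing A] {ρ : H →* RingAut A}
    {B : Type*} [AddCommGroup B] {f g : EquivK0 ρ →+ B}
    (h : ∀ M, f (EquivK0.mk M) = g (EquivK0.mk M)) : f = g :=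
  QuotientAddGroup.addMonoidHom_ext _ (FreeAbelianGroup.lift_ext _ _ h)

/-- The direct sum of two equivariant sheaves. -/
def EquivSheaf.prod {H : Type u} [Group H] {A : Type u} [CommRing A] {ρ : H →* RingAut A}
    (M N : EquivSheaf ρ) : EquivSheaf ρ where
  carrier := M.carrier × N.carrier
  act :=
    { toFun := fun g => (M.act g : M.carrier →+ M.carrier).prodMap (N.act g)
      map_one' := AddMonoidHom.ext fun m => Prod.ext (M.act_one_apply m.1) (N.act_one_apply m.2)
      map_mul' := fun g h => AddMonoidHom.ext fun m =>
        Prod.ext (M.act_mul_apply g h m.1) (N.act_mul_apply g h m.2) }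
  act_smul g a m := Prod.ext (M.act_smul g a m.1) (N.act_smul g a m.2)

theorem EquivK0.mk_prod {H : Type u} [Group H] {A : Type u} [CommRing A] {ρ : H →* RingAut A}
    (M N : EquivSheaf ρ) : EquivK0.mk (M.prod N) = EquivK0.mk M + EquivK0.mk N :=
  EquivK0.mk_eq_add (M := M) (N := M.prod N) (P := N)
    (f := LinearMap.inl A M.carrier N.carrier) (g := LinearMap.snd A M.carrier N.carrier)
    ⟨fun h _ => Prod.ext rfl (map_zero (N.act h)).symm, fun _ _ => rfl, LinearMap.inl_injective,
      Function.Exact.inl_snd, LinearMap.snd_surjective⟩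

theorem EquivK0.exists_eq_sub {H : Type u} [Group H] {A : Type u} [CommRing A]
    {ρ : H →* RingAut A} (x : EquivK0 ρ) :
    ∃ M N : EquivSheaf ρ, x = EquivK0.mk M - EquivK0.mk N := by
  obtain ⟨x, rfl⟩ := QuotientAddGroup.mk_surjective x
  let Z : EquivSheaf ρ :=
    { carrier := PUnit, act := 1, act_smul := fun _ _ _ => rfl }
  have : Subsingleton Z.carrier := inferInstanceAs (Subsingleton PUnit)
  have hZ : EquivK0.mk Z = 0 := EquivK0.mk_eq_zero Z
  induction x using FreeAbelianGroup.induction_on with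
  | zero => exact ⟨Z, Z, by rw [sub_self]; rfl⟩
  | of M => exact ⟨M, Z, by rw [hZ, sub_zero]; rfl⟩
  | neg M => exact ⟨Z, M, by rw [hZ, zero_sub]; rfl⟩
  | add x y hx hy =>
    obtain ⟨M, N, h⟩ := hx
    obtain ⟨M', N', h'⟩ := hy
    refine ⟨M.prod M', N.prod N', ?_⟩
    rw [QuotientAddGroup.mk_add, h, h', EquivK0.mk_prod, EquivK0.mk_prod]
    abel

variable {k : Type u} [Field k] {G : Type u} [Group G] {A : Type u} [CommRing A]
  (κ : k →+* A) {ρ : G →* RingAut A} [IsSemisimpleRing A] (𝔪 : Ideal A) [𝔪.IsMaximal]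

/-- The rank at `𝔪` of coherent sheaves. -/
def rankOrd : OrdK0 A →+ ℤ :=
  QuotientAddGroup.lift _ (FreeAbelianGroup.lift fun M => (rankAt 𝔪 M.carrier : ℤ)) (by
    rw [exactRelations, AddSubgroup.closure_le]
    rintro _ ⟨M, N, P, f, g, h, rfl⟩
    simp [rankAt_of_exact (𝔪 := 𝔪) f g h.injective h.exact h.surjective])

/-- The rank at `𝔪` of coherent sheaves on a fixed point subscheme. -/
def rankFixed (ρ : G →* RingAut A) (τ : Subgroup G) : OrdK0 (FixedRing ρ τ) →+ ℤ :=
  (rankOrd 𝔪).comp (EquivK0.map (EquivSheaf.pushforward (Ideal.Quotient.mk (fixedIdeal ρ τ))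
    (RingHom.Finite.of_surjective _ Ideal.Quotient.mk_surjective) fun _ _ => rfl)
    (EquivSheaf.isExactOn_pushforward _ _ _))

variable [Finite G] [HasEnoughRootsOfUnity k (Nat.card G)] (hκ : ∀ g c, ρ g (κ c) = κ c)

/-- The rank of the eigensheaves as an invariant of the Grothendieck group. -/
def eigenRank (τ : Subgroup G) (ψ : τ →* kˣ) : EquivK0 ρ →+ ℤ :=
  (rankFixed 𝔪 ρ τ).comp (eigenK0 κ τ ψ hκ)

theorem eigenRank_mk (τ : Subgroup G) (ψ : τ →* kˣ) (M : EquivSheaf ρ) :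
    eigenRank κ 𝔪 hκ τ ψ (EquivK0.mk M) = rankAt 𝔪 (eigen κ τ ψ M) := by
  rw [eigenRank, AddMonoidHom.comp_apply, eigenK0_mk, rankFixed, AddMonoidHom.comp_apply,
    EquivK0.map_mk]
  change ((FreeAbelianGroup.lift _) (FreeAbelianGroup.of _) : ℤ) = _
  rw [FreeAbelianGroup.lift_apply_of]
  rfl

theorem eq_zero_of_eigenRank {x : EquivK0 ρ}
    (h : ∀ (𝔪 : Ideal A) (_ : 𝔪.IsMaximal) (τ : Subgroup G), IsCyclic τ → fixedIdeal ρ τ ≤ 𝔪 →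
      ∀ ψ : τ →* kˣ, eigenRank κ 𝔪 hκ τ ψ x = 0) : x = 0 := by
  obtain ⟨M, N, rfl⟩ := EquivK0.exists_eq_sub x
  rw [sub_eq_zero]
  refine EquivK0.mk_eq_of_rankAt_eigen κ hκ fun 𝔪 hm τ hτ hle ψ => ?_
  have := h 𝔪 hm τ hτ hle ψ
  rw [map_sub, eigenRank_mk, eigenRank_mk, sub_eq_zero] at this
  exact_mod_cast this

theorem IsConjugateBy.eigenRank {g : G} {τ τ' : Subgroup G} {ψ : τ →* kˣ} {ψ' : τ' →* kˣ}
    (h : IsConjugateBy g ψ ψ') {𝔪 𝔪' : Ideal A} [𝔪.IsMaximal] [𝔪'.IsMaximal]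
    (h𝔪 : ∀ a, ρ g a ∈ 𝔪' ↔ a ∈ 𝔪) :
    eigenRank κ 𝔪 hκ τ ψ = VistoliK.eigenRank κ 𝔪' hκ τ' ψ' :=
  EquivK0.hom_ext fun M => by rw [eigenRank_mk, eigenRank_mk, h.rankAt_eigen κ hκ M h𝔪]

open scoped Classical in
theorem eigenRank_eq_sum {τ D : Subgroup G} [IsCyclic τ] (hτ : fixedIdeal ρ τ ≤ 𝔪) (hD : D ≤ τ)
    (φ : D →* kˣ) : eigenRank κ 𝔪 hκ D φ = ∑ χ : τ →* kˣ,
      if χ.comp (Subgroup.inclusion hD) = φ then eigenRank κ 𝔪 hκ τ χ else 0 :=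
  EquivK0.hom_ext fun M => by
    rw [eigenRank_mk, rankAt_eigen_eq_sum κ M hτ hD φ, Nat.cast_sum, AddMonoidHom.finsetSum_apply]
    refine Finset.sum_congr rfl fun χ _ => ?_
    split_ifs
    · rw [eigenRank_mk]
    · rfl

end EigenRank

/-! ### The map to the equivariant pieces -/

section Decomposition

variable {k : Type u} [Field k] {G : Type u} [Group G]

/-- Clearing denominators by a power of `n` reduces vanishing in `Λ ⊗ B` to vanishing of an integral
class, whose ranks are integers. -/
theorem exists_isUnit_smul_eq_one_tmul {B : Type*} [AddCommGroup B] (x : Coeff G ⊗[ℤ] B) :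
    ∃ (r : ℕ) (y : B), ((Nat.card G : Coeff G) ^ r) • x = 1 ⊗ₜ y := by
  induction x with
  | zero => exact ⟨0, 0, by simp⟩
  | tmul c b =>
    obtain ⟨r, z, hz⟩ := IsLocalization.Away.surj (Nat.card G : ℤ) c
    refine ⟨r, z • b, ?_⟩
    rw [TensorProduct.smul_tmul', ← TensorProduct.smul_tmul]
    congr 1
    simp at hz
    simp [← hz, mul_comm]
  | add x y hx hy =>
    obtain ⟨r, a, ha⟩ := hx
    obtain ⟨s, b, hb⟩ := hy
    refine ⟨r + s, (Nat.card G : ℤ) ^ s • a + (Nat.card G : ℤ) ^ r • b, ?_⟩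
    have key (m : ℕ) (c : B) : (1 : Coeff G) ⊗ₜ[ℤ] ((Nat.card G : ℤ) ^ m • c) =
        (Nat.card G : Coeff G) ^ m • (1 : Coeff G) ⊗ₜ[ℤ] c := by
      rw [← TensorProduct.smul_tmul, TensorProduct.smul_tmul']
      congr 1
      simp
    rw [TensorProduct.tmul_add, key, key, ← ha, ← hb, smul_add, smul_smul, smul_smul, ← pow_add,
      ← pow_add, add_comm s r]

theorem isConjugateBy_normalizerActChar (τ : Subgroup G) (g : Subgroup.normalizer (τ : Set G))
    (ψ : τ →* kˣ) : IsConjugateBy (g : G) ψ (normalizerActChar k τ g ψ) := by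
  refine ⟨fun s => g.2 s, fun s hs hs' => congrArg ψ (Subtype.ext ?_)⟩
  change (g : G)⁻¹ * (g * s * (g : G)⁻¹) * (g : G)⁻¹⁻¹ = s
  group

variable [Finite G] [HasEnoughRootsOfUnity k (Nat.card G)]

open scoped Classical in
-- By `hres` the element `∑ v χ • χ` restricts to zero on proper subgroups, so it belongs to the
-- primitive part, where the projection is the identity; by `hproj` it is zero.
theorem eq_zero_of_primitiveProj_sum {σ : Subgroup G} [IsCyclic σ] {v : (σ →* kˣ) → ℤ}
    (hres : ∀ (D : Subgroup G) (hD : D < σ) (φ : D →* kˣ),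
      ∑ χ : σ →* kˣ, (if χ.comp (Subgroup.inclusion hD.le) = φ then v χ else 0) = 0)
    (hproj : ∑ χ : σ →* kˣ, v χ • primitiveProj k σ (MonoidAlgebra.single χ 1) = 0)
    (χ : σ →* kˣ) : v χ = 0 := by
  let x : RepRing k σ := ∑ χ : σ →* kˣ, v χ • MonoidAlgebra.single χ 1
  have hx : x ∈ PrimitivePart k σ := mem_primitivePart_iff.2 fun D hD => by
    simp only [x, map_sum, map_zsmul, charRes_single]
    rw [← Finset.sum_fiberwise (s := Finset.univ)
      (g := fun χ : σ →* kˣ => χ.comp (Subgroup.inclusion hD.le))]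
    refine Finset.sum_eq_zero fun φ _ => ?_
    rw [Finset.sum_congr rfl fun χ hχ => by
      rw [(Finset.mem_filter.1 hχ).2], ← Finset.sum_smul, Finset.sum_filter, hres D hD φ, zero_smul]
  have hx0 : x = 0 := by
    have h1 := primitiveProj_apply_coe σ ⟨x, hx⟩
    have h2 : primitiveProj k σ x = 0 := by
      simp only [x, map_sum, map_zsmul]
      exact hproj
    exact congrArg Subtype.val (h1.symm.trans h2)
  have h3 : x.coeff χ = ((v χ : ℤ) : Coeff G) := by
    simp [x, Finsupp.single_apply]
  rw [hx0] at h3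
  exact coeff_intCast_injective (G := G) (by simpa using h3.symm)

variable {A : Type u} [CommRing A] [IsSemisimpleRing A] (κ : k →+* A) {ρ : G →* RingAut A}
  (hκ : ∀ g c, ρ g (κ c) = κ c)

/-- The map `c ⊗ [M] ↦ c ∑ π(ψ) ⊗ [M_ψ]`, the sum over the characters of `τ`, where `π` is the
projection to the primitive part. -/
def primitiveComponent (τ : Subgroup G) [IsCyclic τ] :
    Coeff G ⊗[ℤ] EquivK0 ρ →ₗ[Coeff G] PrimitivePart k τ ⊗[ℤ] OrdK0 (FixedRing ρ τ) :=
  ∑ ψ : τ →* kˣ, TensorProduct.AlgebraTensorModule.map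
    (LinearMap.toSpanSingleton (Coeff G) (PrimitivePart k τ)
      (primitiveProj k τ (MonoidAlgebra.single ψ 1)))
    (eigenK0 κ τ ψ hκ).toIntLinearMap

theorem primitiveComponent_tmul (τ : Subgroup G) [IsCyclic τ] (c : Coeff G) (x : EquivK0 ρ) :
    primitiveComponent κ hκ τ (c ⊗ₜ x) = ∑ ψ : τ →* kˣ,
      (c • primitiveProj k τ (MonoidAlgebra.single ψ 1)) ⊗ₜ eigenK0 κ τ ψ hκ x := by
  simp [primitiveComponent]

/-- The action of `g` on `M` is itself the isomorphism; push-forward along `g` twists the module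
structure by `g⁻¹`, which makes this semilinear map linear. -/
theorem normalizerActK0_eigenK0 (τ : Subgroup G) (g : Subgroup.normalizer (τ : Set G))
    (ψ : τ →* kˣ) (x : EquivK0 ρ) : normalizerActK0 ρ τ g (eigenK0 κ τ ψ hκ x) =
      eigenK0 κ τ (normalizerActChar k τ g ψ) hκ x := by
  have hconj := isConjugateBy_normalizerActChar (k := k) τ g ψ
  refine DFunLike.congr_fun (EquivK0.hom_ext (f := (normalizerActK0 ρ τ g).comp
    (eigenK0 κ τ ψ hκ)) fun M => ?_) x
  rw [AddMonoidHom.comp_apply, eigenK0_mk, eigenK0_mk, normalizerActK0, EquivK0.map_mk]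
  refine EquivK0.mk_congr
    { (hconj.eigenEquiv κ hκ M : eigen κ τ ψ M ≃+ _) with
      map_smul' := fun a m => ?_ } fun _ _ => rfl
  obtain ⟨a, rfl⟩ := Ideal.Quotient.mk_surjective a
  refine (hconj.eigenEquiv_smul κ hκ M (ρ (g : G)⁻¹ a) m).trans ?_
  rw [← ringAut_mul_apply, mul_inv_cancel, ringAut_one_apply]
  rfl

theorem primitiveComponent_mem_invariants (τ : Subgroup G) [IsCyclic τ]
    (x : Coeff G ⊗[ℤ] EquivK0 ρ) : primitiveComponent κ hκ τ x ∈ invariants k ρ τ := by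
  intro g
  induction x with
  | zero => simp
  | add x y hx hy => rw [map_add, map_add, hx, hy]
  | tmul c x =>
    rw [primitiveComponent_tmul, map_sum]
    refine Fintype.sum_equiv (normalizerActChar k τ g).toEquiv _ _ fun ψ => ?_
    rw [TensorProduct.AlgebraTensorModule.map_tmul, map_smul, ← primitiveProj_normalizerActRep]
    change (c • primitiveProj k τ (normalizerActRep k τ g (MonoidAlgebra.single ψ 1))) ⊗ₜ
      normalizerActK0 ρ τ g (eigenK0 κ τ ψ hκ x) = _
    rw [normalizerActK0_eigenK0, normalizerActRep, MonoidAlgebra.domCongr_single]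
    rfl

/-- After clearing denominators, all ranks of eigensheaves are shown to vanish by induction on the
order of `τ`. Conjugation reduces to `τ` in `S`, at the cost of moving the point `𝔪`. -/
theorem eq_zero_of_primitiveComponent {S : Finset (Subgroup G)} (hS : IsCyclicRepresentatives S)
    {x : Coeff G ⊗[ℤ] EquivK0 ρ}
    (hx : ∀ σ ∈ S, ∀ _ : IsCyclic σ, primitiveComponent κ hκ σ x = 0) : x = 0 := by
  classical
  obtain ⟨r, y, hy⟩ := exists_isUnit_smul_eq_one_tmul x
  have hu : IsUnit ((Nat.card G : Coeff G) ^ r) := (isUnit_natCast_coeff dvd_rfl).pow r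
  suffices hy0 : y = 0 by
    rw [hy0, TensorProduct.tmul_zero] at hy
    exact hu.smul_eq_zero.1 hy
  suffices h : ∀ (n : ℕ) (τ : Subgroup G), IsCyclic τ → Nat.card τ = n →
      ∀ (𝔪 : Ideal A) (_ : 𝔪.IsMaximal), fixedIdeal ρ τ ≤ 𝔪 →
        ∀ ψ : τ →* kˣ, eigenRank κ 𝔪 hκ τ ψ y = 0 from
    eq_zero_of_eigenRank κ hκ fun 𝔪 hm τ hτ hle ψ => h _ τ hτ rfl 𝔪 hm hle ψ
  intro n
  induction n using Nat.strong_induction_on with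
  | _ n ih =>
  have main (σ : Subgroup G) (hσ : σ ∈ S) (hc : IsCyclic σ) (hn : Nat.card σ = n) (𝔪 : Ideal A)
      (hm : 𝔪.IsMaximal) (hle : fixedIdeal ρ σ ≤ 𝔪) (ψ : σ →* kˣ) :
      eigenRank κ 𝔪 hκ σ ψ y = 0 := by
    refine eq_zero_of_primitiveProj_sum (v := fun ψ => eigenRank κ 𝔪 hκ σ ψ y)
      (fun D hD φ => ?_) ?_ ψ
    · have hDlt : Nat.card D < n := by
        rw [← hn]
        exact Set.ncard_lt_ncard hD
      have hDc : IsCyclic D :=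
        isCyclic_of_injective (Subgroup.inclusion hD.le) (Subgroup.inclusion_injective hD.le)
      have h0 := ih _ hDlt D hDc rfl 𝔪 hm
        ((fixedIdeal_le_iff ρ 𝔪).2 (hD.le.trans ((fixedIdeal_le_iff ρ 𝔪).1 hle))) φ
      rw [eigenRank_eq_sum κ 𝔪 hκ hle hD.le φ, AddMonoidHom.finsetSum_apply] at h0
      refine Eq.trans (Finset.sum_congr rfl fun χ _ => ?_) h0
      split_ifs <;> rfl
    · have h0 := hx σ hσ hc
      have h1 : primitiveComponent κ hκ σ ((1 : Coeff G) ⊗ₜ y) = 0 := by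
        rw [← hy, map_smul, h0, smul_zero]
      rw [primitiveComponent_tmul] at h1
      -- Taking the rank at `𝔪` in the second tensor factor turns the vanishing of the component
      -- into a relation in the primitive part.
      have h2 := congrArg (fun z => TensorProduct.rid ℤ (PrimitivePart k σ)
        ((rankFixed 𝔪 ρ σ).toIntLinearMap.lTensor (PrimitivePart k σ) z)) h1
      simp only [map_sum, LinearMap.lTensor_tmul, TensorProduct.rid_tmul, map_zero, one_smul] at h2
      exact h2
  intro τ hτ hn 𝔪 hm hle ψ
  obtain ⟨σ, ⟨hσ, g, rfl⟩, -⟩ := hS.2 τ hτ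
  have hσc := hS.1 σ hσ
  have hmem : ∀ s, s ∈ σ ↔ g * s * g⁻¹ ∈ σ.map (MulAut.conj g).toMonoidHom := fun s =>
    ⟨fun hs => ⟨s, hs, rfl⟩, by
      rintro ⟨t, ht, h⟩
      have : t = s := (MulAut.conj g).injective h
      rwa [← this]⟩
  let j : σ →* σ.map (MulAut.conj g).toMonoidHom := (MulAut.conj g).toMonoidHom.subgroupMap σ
  have hconj : IsConjugateBy g (ψ.comp j) ψ := ⟨hmem, fun s hs hs' => rfl⟩
  let 𝔫 : Ideal A := 𝔪.comap (ρ g : A ≃+* A)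
  have h𝔫 : 𝔫.IsMaximal := Ideal.comap_isMaximal_of_equiv (ρ g : A ≃+* A)
  rw [← hconj.eigenRank κ hκ (𝔪 := 𝔫) (𝔪' := 𝔪) fun a => Iff.rfl]
  refine main σ hσ hσc ?_ 𝔫 h𝔫 (fun a ha => ?_) _
  · rw [← hn]
    exact Nat.card_congr (σ.equivMapOfInjective _ (MulAut.conj g).injective).toEquiv
  · exact hle (fixedIdeal_apply_mem (fun s hs => (hmem s).1 hs) ha)

end Decomposition

/-! ### Restriction of sheaves to closed subschemes -/

section Restrict

theorem EquivSheaf.isEquivariant_of_subsingleton {H : Type u} [Group H] [Subsingleton H]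
    {A : Type u} [CommRing A] {ρ : H →* RingAut A} {M N : EquivSheaf ρ}
    (f : M.carrier →ₗ[A] N.carrier) : IsEquivariant f := fun h m => by
  rw [Subsingleton.elim h 1, M.act_one_apply, N.act_one_apply]

variable {A : Type u} [CommRing A]

/-- The sections of a coherent sheaf that are killed by `I`. For a semisimple ring this is the
restriction to the closed subscheme of `I`. -/
def EquivSheaf.restrict [IsNoetherianRing A] (I : Ideal A)
    (N : EquivSheaf (1 : PUnit.{u + 1} →* RingAut A)) :
    EquivSheaf (1 : PUnit.{u + 1} →* RingAut (A ⧸ I)) where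
  carrier := Submodule.torsionBySet A N.carrier (I : Set A)
  finite := Module.Finite.of_restrictScalars_finite A _ _
  act := 1
  act_smul _ _ _ := rfl

theorem EquivSheaf.isExactOn_restrict [IsSemisimpleRing A] (I : Ideal A) :
    IsExactOn (EquivSheaf.restrict I) := by
  intro M N P f g h
  refine ⟨torsionMap I f, torsionMap I g, isEquivariant_of_subsingleton _,
    isEquivariant_of_subsingleton _, fun x y hxy => Subtype.ext (h.injective
      (congrArg Subtype.val hxy)), fun n => ⟨fun hn => ?_, ?_⟩, fun p => ?_⟩
  · obtain ⟨m, hm⟩ := (h.exact n.1).1 (congrArg Subtype.val hn)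
    refine ⟨⟨m, mem_torsionBySet_ideal.2 fun a ha => h.injective ?_⟩, Subtype.ext hm⟩
    rw [map_smul, hm, mem_torsionBySet_ideal.1 n.2 a ha, map_zero]
  · rintro ⟨m, rfl⟩
    exact Subtype.ext (h.exact.apply_apply_eq_zero m.1)
  · obtain ⟨l, hl⟩ := IsSemisimpleModule.lifting_property g h.surjective LinearMap.id
    have hl' (p : P.carrier) : g (l p) = p := LinearMap.congr_fun hl p
    exact ⟨torsionMap I l p, Subtype.ext (hl' p.1)⟩

theorem EquivK0.mk_sub_eq_add [IsNoetherianRing A] {H : Type u} [Group H] {ρ : H →* RingAut A}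
    {M P : EquivSheaf ρ} (f : M.carrier →ₗ[A] P.carrier) (hf : EquivSheaf.IsEquivariant f)
    {N N' : Submodule A M.carrier} (hle : N ≤ N') (hN : ∀ h, ∀ n ∈ N, M.act h n ∈ N)
    (hN' : ∀ h, ∀ n ∈ N', M.act h n ∈ N') (hz : ∀ n ∈ N, f n = 0)
    (hker : ∀ n ∈ N', f n = 0 → n ∈ N) (hsurj : ∀ p, ∃ n ∈ N', f n = p) :
    EquivK0.mk (M.sub N' hN') = EquivK0.mk (M.sub N hN) + EquivK0.mk P := by
  refine EquivK0.mk_eq_add (M := M.sub N hN) (N := M.sub N' hN') (P := P)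
    (f := (Submodule.inclusion hle : N →ₗ[A] N'))
    (g := (f ∘ₗ N'.subtype : N' →ₗ[A] P.carrier)) ⟨fun _ _ => rfl, fun h m => hf h m.1,
      Submodule.inclusion_injective hle, fun m => ⟨fun hm => ⟨⟨m.1, hker _ m.2 hm⟩, rfl⟩, ?_⟩,
      fun p => ?_⟩
  · rintro ⟨m, rfl⟩
    exact hz _ m.2
  · obtain ⟨n, hn, h⟩ := hsurj p
    exact ⟨⟨n, hn⟩, h⟩

theorem EquivK0.mk_sub_of_eq_top [IsNoetherianRing A] {H : Type u} [Group H] {ρ : H →* RingAut A}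
    {M : EquivSheaf ρ} {N : Submodule A M.carrier} (hN : ∀ h, ∀ n ∈ N, M.act h n ∈ N)
    (htop : N = ⊤) : EquivK0.mk (M.sub N hN) = EquivK0.mk M :=
  EquivK0.mk_congr (M := M.sub N hN) (LinearEquiv.ofTop N htop) fun _ _ => rfl

theorem EquivK0.mk_eq_sum_of_bijective [IsNoetherianRing A] {H : Type u} [Group H]
    {ρ : H →* RingAut A} {ι : Type*} [Fintype ι] {M : EquivSheaf ρ} (P : ι → EquivSheaf ρ)
    (f : ∀ i, M.carrier →ₗ[A] (P i).carrier) (hf : ∀ i, EquivSheaf.IsEquivariant (f i))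
    (hbij : Function.Bijective (LinearMap.pi f)) : EquivK0.mk M = ∑ i, EquivK0.mk (P i) := by
  classical
  -- The filtration of `M` by the elements whose components outside `s` vanish; adding one index to
  -- `s` adds one graded piece `P i`.
  let N (s : Finset ι) : Submodule A M.carrier := ⨅ i ∈ sᶜ, LinearMap.ker (f i)
  have hN {s : Finset ι} {m : M.carrier} : m ∈ N s ↔ ∀ i ∉ s, f i m = 0 := by
    simp [N]
  have hstab (s : Finset ι) (h : H) : ∀ n ∈ N s, M.act h n ∈ N s := fun n hn =>
    hN.2 fun i hi => by rw [hf, hN.1 hn i hi, map_zero]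
  have key (s : Finset ι) : EquivK0.mk (M.sub (N s) (hstab s)) = ∑ i ∈ s, EquivK0.mk (P i) := by
    induction s using Finset.induction_on with
    | empty =>
      have : Subsingleton (M.sub (N ∅) (hstab ∅)).carrier := by
        refine ⟨fun m m' => Subtype.ext (hbij.1 (funext fun i => ?_))⟩
        exact (hN.1 m.2 i (Finset.notMem_empty i)).trans
          (hN.1 m'.2 i (Finset.notMem_empty i)).symm
      rw [EquivK0.mk_eq_zero, Finset.sum_empty]
    | insert i s hi ih =>
      have hle : N s ≤ N (insert i s) := fun m hm => hN.2 fun j hj =>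
        hN.1 hm j fun hj' => hj (Finset.mem_insert_of_mem hj')
      have hker : ∀ m ∈ N (insert i s), f i m = 0 → m ∈ N s := fun m hm h0 => hN.2 fun j hj => by
        by_cases hji : j = i
        · subst hji
          exact h0
        · exact hN.1 hm j fun hj' => (Finset.mem_insert.1 hj').elim hji hj
      have hsurj : ∀ p, ∃ m ∈ N (insert i s), f i m = p := fun p => by
        obtain ⟨m, hm⟩ := hbij.2 (Pi.single i p)
        refine ⟨m, hN.2 fun j hj => ?_, ?_⟩
        · exact (congrFun hm j).trans
            (Pi.single_eq_of_ne (M := fun i => (P i).carrier)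
            (show j ≠ i from fun h => hj (h ▸ Finset.mem_insert_self i s)) p)
        · exact (congrFun hm i).trans (Pi.single_eq_same (M := fun i => (P i).carrier) i p)
      rw [EquivK0.mk_sub_eq_add (f i) (hf i) hle (hstab s) (hstab _) (fun m hm => hN.1 hm i hi) hker
        hsurj, ih, Finset.sum_insert hi, add_comm]
  rw [← key Finset.univ]
  exact (EquivK0.mk_sub_of_eq_top (hstab _)
    (eq_top_iff.2 fun m _ => hN.2 fun i hi => (hi (Finset.mem_univ i)).elim)).symm

end Restrict

/-! ### Transport between fixed point subschemes -/

section Transport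

variable {G : Type u} [Group G] {A : Type u} [CommRing A] (ρ : G →* RingAut A)
  (σ τ : Subgroup G) (x : G)

/-- The map on functions that belongs to the map `y ↦ x y` from `X^σ` to `X`. -/
def conjHom : A →+* FixedRing ρ σ :=
  (Ideal.Quotient.mk (fixedIdeal ρ σ)).comp (ρ x⁻¹ : A ≃+* A).toRingHom

theorem conjHom_surjective : Function.Surjective (conjHom ρ σ x) :=
  Ideal.Quotient.mk_surjective.comp (ρ x⁻¹).surjective

/-- The push-forward of a sheaf on `X^σ` along `y ↦ x y`, restricted to `X^τ`. -/
def transport [IsNoetherianRing A]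
    (N : EquivSheaf (1 : PUnit.{u + 1} →* RingAut (FixedRing ρ σ))) :
    EquivSheaf (1 : PUnit.{u + 1} →* RingAut (FixedRing ρ τ)) :=
  (EquivSheaf.pushforward (ρA := 1) (conjHom ρ σ x)
    (RingHom.Finite.of_surjective _ (conjHom_surjective ρ σ x)) (fun _ _ => rfl) N).restrict
      (fixedIdeal ρ τ)

/-- The map `[N] ↦ [transport N]`. -/
def transportK0 [IsSemisimpleRing A] : OrdK0 (FixedRing ρ σ) →+ OrdK0 (FixedRing ρ τ) :=
  (EquivK0.map _ (EquivSheaf.isExactOn_restrict (fixedIdeal ρ τ))).comp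
    (EquivK0.map _ (EquivSheaf.isExactOn_pushforward (ρA := 1) (conjHom ρ σ x)
      (RingHom.Finite.of_surjective _ (conjHom_surjective ρ σ x)) (fun _ _ => rfl)))

theorem transportK0_mk [IsSemisimpleRing A]
    (N : EquivSheaf (1 : PUnit.{u + 1} →* RingAut (FixedRing ρ σ))) :
    transportK0 ρ σ τ x (EquivK0.mk N) = EquivK0.mk (transport ρ σ τ x N) := by
  rw [transportK0, AddMonoidHom.comp_apply, EquivK0.map_mk, EquivK0.map_mk]
  rfl

section

variable {ρ σ τ x} [IsNoetherianRing A]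
  {N : EquivSheaf (1 : PUnit.{u + 1} →* RingAut (FixedRing ρ σ))}

/-- The section of `N` given by a section of its transport. -/
def transportVal (n : (transport ρ σ τ x N).carrier) : N.carrier := n.1

theorem transportVal_injective : Function.Injective
    (transportVal : (transport ρ σ τ x N).carrier → N.carrier) := Subtype.val_injective

theorem transportVal_add (n n' : (transport ρ σ τ x N).carrier) :
    transportVal (n + n') = transportVal n + transportVal n' := rfl

theorem transportVal_zero : transportVal (0 : (transport ρ σ τ x N).carrier) = 0 := rfl

theorem transportVal_mk_smul (a : A) (n : (transport ρ σ τ x N).carrier) :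
    transportVal (Ideal.Quotient.mk (fixedIdeal ρ τ) a • n) =
      conjHom ρ σ x a • transportVal n := rfl

theorem smul_transportVal {a : A} (ha : a ∈ fixedIdeal ρ τ) (n : (transport ρ σ τ x N).carrier) :
    conjHom ρ σ x a • transportVal n = 0 := mem_torsionBySet_ideal.1 n.2 a ha

/-- The section of the transport given by a section that is killed by the ideal of `X^τ`. -/
def transportMk (n : N.carrier) (h : ∀ a ∈ fixedIdeal ρ τ, conjHom ρ σ x a • n = 0) :
    (transport ρ σ τ x N).carrier := ⟨n, mem_torsionBySet_ideal.2 h⟩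

@[simp] theorem transportVal_mk (n : N.carrier)
    (h : ∀ a ∈ fixedIdeal ρ τ, conjHom ρ σ x a • n = 0) :
    transportVal (transportMk n h) = n := rfl

end

/-- An element of the normalizer maps `X^σ` to itself, so the restriction to `X^σ` after the
push-forward discards nothing. -/
theorem transportK0_normalizer [IsSemisimpleRing A] (g : Subgroup.normalizer (σ : Set G)) :
    transportK0 ρ σ σ (g : G) = normalizerActK0 ρ σ g := by
  refine EquivK0.hom_ext fun N => ?_
  rw [transportK0_mk, normalizerActK0, EquivK0.map_mk]
  symm
  have hmem (n : N.carrier) (a : A) (ha : a ∈ fixedIdeal ρ σ) :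
      conjHom ρ σ (g : G) a • n = 0 := by
    have h0 : conjHom ρ σ (g : G) a = 0 := Ideal.Quotient.eq_zero_iff_mem.2
      (fixedIdeal_apply_mem (fun s hs => (g⁻¹.2 s).1 hs) ha)
    rw [h0, zero_smul]
  refine EquivK0.mk_congr
    { toFun := fun n => transportMk n (hmem n)
      invFun := transportVal
      map_add' := fun _ _ => rfl
      map_smul' := fun a n => ?_
      left_inv := fun _ => rfl
      right_inv := fun _ => rfl } (EquivSheaf.isEquivariant_of_subsingleton _)
  obtain ⟨a, rfl⟩ := Ideal.Quotient.mk_surjective a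
  rfl

end Transport

/-! ### Eigensheaves of induced sheaves -/

section Mackey

theorem inv_mul_inv_mul_mul_inv {B : Type*} [CommGroup B] (a b s h : B) :
    a⁻¹ * b⁻¹ * (s⁻¹ * a * (b * h⁻¹)) = s⁻¹ * h⁻¹ := by
  calc a⁻¹ * b⁻¹ * (s⁻¹ * a * (b * h⁻¹)) = a⁻¹ * a * (b⁻¹ * b) * (s⁻¹ * h⁻¹) := by ac_rfl
    _ = s⁻¹ * h⁻¹ := by rw [inv_mul_cancel, inv_mul_cancel, one_mul, one_mul]

variable {k : Type u} [Field k] {G : Type u} [Group G] {A : Type u} [CommRing A]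
  (κ : k →+* A) (ρ : G →* RingAut A) (σ : Subgroup G)

/-- The action of a scalar of `k` on sections over `X^σ`. -/
def fixedScalar : k →+* FixedRing ρ σ := (Ideal.Quotient.mk (fixedIdeal ρ σ)).comp κ

/-- The group `σ` acts trivially on `X^σ`, so `y ↦ x y` on `X^σ` depends only on the coset of `x`.
-/
theorem conjHom_mul (y : G) (h : σ) : conjHom ρ σ (y * h) = conjHom ρ σ y := by
  refine RingHom.ext fun a => ?_
  change Ideal.Quotient.mk _ (ρ (y * h)⁻¹ a) = Ideal.Quotient.mk _ (ρ y⁻¹ a)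
  rw [mul_inv_rev, ringAut_mul_apply]
  exact mk_act_eq ρ σ h⁻¹ (ρ y⁻¹ a)

theorem conjHom_mul_apply (s y : G) (a : A) :
    conjHom ρ σ (s * y) a = conjHom ρ σ y (ρ s⁻¹ a) := by
  change Ideal.Quotient.mk _ (ρ (s * y)⁻¹ a) = Ideal.Quotient.mk _ (ρ y⁻¹ (ρ s⁻¹ a))
  rw [mul_inv_rev, ringAut_mul_apply]

/-- The sheaf `N ⊗ χ` on `X`. -/
def twistedSheaf (χ : σ →* kˣ)
    (N : EquivSheaf (1 : PUnit.{u + 1} →* RingAut (FixedRing ρ σ))) :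
    EquivSheaf (ρ.comp σ.subtype) :=
  EquivSheaf.pushforward (Ideal.Quotient.mk (fixedIdeal ρ σ))
    (RingHom.Finite.of_surjective _ Ideal.Quotient.mk_surjective) (mk_act_eq ρ σ)
    (EquivSheaf.twist ((Ideal.Quotient.mk (fixedIdeal ρ σ)).comp κ) χ N)

/-- The sheaf on `X` that is induced from `N ⊗ χ`. -/
def inducedTwist [Finite G] (χ : σ →* kˣ)
    (N : EquivSheaf (1 : PUnit.{u + 1} →* RingAut (FixedRing ρ σ))) : EquivSheaf ρ :=
  EquivSheaf.ind ρ σ (twistedSheaf κ ρ σ χ N)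

section Sections

variable [Finite G] {κ ρ σ} {χ : σ →* kˣ}
  {N : EquivSheaf (1 : PUnit.{u + 1} →* RingAut (FixedRing ρ σ))}

/-- The value at `y` of a section of the induced sheaf. -/
def indVal (f : (inducedTwist κ ρ σ χ N).carrier) (y : G) : N.carrier :=
  (f : induced ρ σ _).1 y

theorem indVal_ext {f f' : (inducedTwist κ ρ σ χ N).carrier}
    (h : ∀ y, indVal f y = indVal f' y) : f = f' := Subtype.ext (funext h)

theorem indVal_zero (y : G) : indVal (0 : (inducedTwist κ ρ σ χ N).carrier) y = 0 := rfl

theorem indVal_smul (a : A) (f : (inducedTwist κ ρ σ χ N).carrier) (y : G) :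
    indVal (a • f) y = conjHom ρ σ y a • indVal f y := rfl

theorem indVal_act (g : G) (f : (inducedTwist κ ρ σ χ N).carrier) (y : G) :
    indVal ((inducedTwist κ ρ σ χ N).act g f) y = indVal f (g⁻¹ * y) := rfl

theorem indVal_mul (f : (inducedTwist κ ρ σ χ N).carrier) (y : G) (h : σ) :
    indVal f (y * h) = fixedScalar κ ρ σ ((χ h⁻¹ : kˣ) : k) • indVal f y :=
  (f : induced ρ σ _).2 y h

/-- The section of the induced sheaf with given values. -/
def indMk (v : G → N.carrier)
    (hv : ∀ y (h : σ), v (y * h) = fixedScalar κ ρ σ ((χ h⁻¹ : kˣ) : k) • v y) :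
    (inducedTwist κ ρ σ χ N).carrier :=
  (⟨v, hv⟩ : induced ρ σ (twistedSheaf κ ρ σ χ N))

theorem indVal_mk (v : G → N.carrier)
    (hv : ∀ y (h : σ), v (y * h) = fixedScalar κ ρ σ ((χ h⁻¹ : kˣ) : k) • v y) (y : G) :
    indVal (indMk v hv) y = v y := rfl

variable {τ : Subgroup G} {ψ : τ →* kˣ} (hκ : ∀ g c, ρ g (κ c) = κ c)

include hκ in
theorem mem_eigen_inducedTwist_iff {f : (inducedTwist κ ρ σ χ N).carrier} :
    f ∈ eigen κ τ ψ (inducedTwist κ ρ σ χ N) ↔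
      (∀ y, ∀ a ∈ fixedIdeal ρ τ, conjHom ρ σ y a • indVal f y = 0) ∧
      ∀ y (s : τ), indVal f (s * y) = fixedScalar κ ρ σ ((ψ s⁻¹ : kˣ) : k) • indVal f y := by
  have hsc (y : G) (c : k) : conjHom ρ σ y (κ c) = fixedScalar κ ρ σ c :=
    congrArg (Ideal.Quotient.mk (fixedIdeal ρ σ)) (hκ _ _)
  constructor
  · intro hf
    refine ⟨fun y a ha => ?_, fun y s => ?_⟩
    · rw [← indVal_smul, hf.1 a ha, indVal_zero]
    · have h := congrArg (fun f => indVal f y) (hf.2 s⁻¹)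
      rw [indVal_act, indVal_smul, hsc] at h
      rw [← h]
      simp
  · rintro ⟨h1, h2⟩
    refine ⟨fun a ha => indVal_ext fun y => h1 y a ha, fun s => indVal_ext fun y => ?_⟩
    rw [indVal_act, indVal_smul, hsc]
    have h := h2 y s⁻¹
    rw [inv_inv] at h
    exact h

end Sections

variable {ρ σ} (τ : Subgroup G) (ψ : τ →* kˣ) (χ : σ →* kˣ) (x : G)
  (N : EquivSheaf (1 : PUnit.{u + 1} →* RingAut (FixedRing ρ σ)))

/-- The characters `ψ` and `χ` agree on `τ ∩ x σ x⁻¹`. -/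
def AgreeAt {τ σ : Subgroup G} (ψ : τ →* kˣ) (χ : σ →* kˣ) (x : G) : Prop :=
  ∀ (s : τ) (h : σ), (s : G) * x * h = x → ψ s * χ h = 1

variable [IsSemisimpleRing A]

/-- The sections of the transport of `N` that can be values at `x` of an eigensection of the
induced sheaf. -/
def agreePart : Submodule (FixedRing ρ τ) (transport ρ σ τ x N).carrier where
  carrier := {n | ∀ (s : τ) (h : σ), (s : G) * x * h = x →
    fixedScalar κ ρ σ ((ψ s * χ h : kˣ) : k) • transportVal n = transportVal n}
  add_mem' hn hn' s h hx := by
    rw [transportVal_add, smul_add, hn s h hx, hn' s h hx]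
  zero_mem' s h _ := by rw [transportVal_zero, smul_zero]
  smul_mem' a n hn s h hx := by
    obtain ⟨a, rfl⟩ := Ideal.Quotient.mk_surjective a
    rw [transportVal_mk_smul, smul_comm, hn s h hx]

/-- The subsheaf given by `agreePart`. -/
def agreeSheaf : EquivSheaf (1 : PUnit.{u + 1} →* RingAut (FixedRing ρ τ)) :=
  (transport ρ σ τ x N).sub (agreePart κ τ ψ χ x N) fun _ _ hn => hn

open scoped Classical in
-- If the characters disagree, some `ψ s * χ t - 1` is a nonzero scalar of `k` and kills all the
-- sections, which are therefore zero.
theorem mk_agreeSheaf : EquivK0.mk (agreeSheaf κ τ ψ χ x N) =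
    if AgreeAt ψ χ x then EquivK0.mk (transport ρ σ τ x N) else 0 := by
  split_ifs with h
  · refine EquivK0.mk_sub_of_eq_top _ (eq_top_iff.2 fun n _ s t hst => ?_)
    rw [h s t hst, Units.val_one, map_one, one_smul]
  · have : Subsingleton (agreeSheaf κ τ ψ χ x N).carrier := by
      simp only [AgreeAt, not_forall] at h
      obtain ⟨s, t, hst, hne⟩ := h
      have hzero (n : agreePart κ τ ψ χ x N) : n = 0 := by
        refine Subtype.ext (transportVal_injective ?_)
        have hn := n.2 s t hst
        rw [← sub_eq_zero, ← one_smul (FixedRing ρ σ) (transportVal n.1), smul_smul, mul_one,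
          ← sub_smul, ← map_one (fixedScalar κ ρ σ), ← map_sub] at hn
        have hc : ((ψ s * χ t : kˣ) : k) - 1 ≠ 0 := fun h0 =>
          hne (Units.ext (sub_eq_zero.1 h0))
        have hu : IsUnit (fixedScalar κ ρ σ (((ψ s * χ t : kˣ) : k) - 1)) :=
          (IsUnit.mk0 _ hc).map _
        exact hu.smul_eq_zero.1 hn
      exact ⟨fun n n' => (hzero n).trans (hzero n').symm⟩
    exact EquivK0.mk_eq_zero _

variable [Finite G] (hκ : ∀ g c, ρ g (κ c) = κ c)

omit [IsSemisimpleRing A] in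
include hκ in
theorem indVal_mul_mul {f : (inducedTwist κ ρ σ χ N).carrier}
    (hf : f ∈ eigen κ τ ψ (inducedTwist κ ρ σ χ N)) (s : τ) (h : σ) :
    indVal f (s * x * h) =
      fixedScalar κ ρ σ (((ψ s)⁻¹ * (χ h)⁻¹ : kˣ) : k) • indVal f x := by
  rw [indVal_mul, ((mem_eigen_inducedTwist_iff hκ).1 hf).2, smul_smul, ← map_mul,
    ← Units.val_mul, map_inv, map_inv, mul_comm]

omit [IsSemisimpleRing A] [Finite G] in
theorem fixedScalar_inv_smul (c : kˣ) (n : N.carrier) :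
    fixedScalar κ ρ σ (c : k) • fixedScalar κ ρ σ ((c⁻¹ : kˣ) : k) • n = n := by
  rw [smul_smul, ← map_mul, ← Units.val_mul, mul_inv_cancel, Units.val_one, map_one, one_smul]

/-- The value at `x` of an eigensection of the induced sheaf. -/
def evalAt : (eigenSheaf κ τ ψ (inducedTwist κ ρ σ χ N)).carrier →ₗ[FixedRing ρ τ]
    (agreeSheaf κ τ ψ χ x N).carrier where
  toFun f := ⟨transportMk (indVal (Subtype.val f) x) fun a ha =>
      ((mem_eigen_inducedTwist_iff hκ).1 (Subtype.property f)).1 x a ha, fun s h hx => by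
    have hf := indVal_mul_mul κ τ ψ χ x N hκ (Subtype.property f) s h
    rw [hx, ← mul_inv] at hf
    rw [transportVal_mk]
    conv_lhs => rw [hf]
    exact fixedScalar_inv_smul κ N _ _⟩
  map_add' _ _ := rfl
  map_smul' a f := by
    obtain ⟨a, rfl⟩ := Ideal.Quotient.mk_surjective a
    rfl

/-- Mackey's argument. An eigensection is determined along `τ x σ` by its value at `x`. Conversely a
value at `x` extends if it is compatible with all pairs `(s, h)` with `s x h = x`, which is the
condition of `agreePart`. -/
theorem evalAt_bijective : Function.Bijective (LinearMap.pi
    fun ω : DoubleCoset.Quotient (τ : Set G) (σ : Set G) => evalAt κ τ ψ χ ω.out N hκ) := by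
  constructor
  · intro f f' hff
    refine Subtype.ext (indVal_ext fun y => ?_)
    obtain ⟨s, h, hs, hh, hy⟩ := DoubleCoset.mk_out_eq_mul τ σ y
    set ω := DoubleCoset.mk τ σ y
    have e : y = ((⟨s, hs⟩⁻¹ : τ) : G) * ω.out * ((⟨h, hh⟩⁻¹ : σ) : G) := by
      change y = s⁻¹ * ω.out * h⁻¹
      rw [hy]
      group
    have hω : indVal (Subtype.val f) ω.out = indVal (Subtype.val f') ω.out :=
      congrArg (fun n => transportVal (Subtype.val n)) (congrFun hff ω)
    rw [e, indVal_mul_mul κ τ ψ χ _ N hκ (Subtype.property f),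
      indVal_mul_mul κ τ ψ χ _ N hκ (Subtype.property f'), hω]
  · intro n
    let val (ω : DoubleCoset.Quotient (τ : Set G) (σ : Set G)) : N.carrier :=
      transportVal (Subtype.val (n ω))
    have hval (ω : DoubleCoset.Quotient (τ : Set G) (σ : Set G)) (s : τ) (h : σ)
        (hx : (s : G) * ω.out * h = ω.out) :
        fixedScalar κ ρ σ ((ψ s * χ h : kˣ) : k) • val ω = val ω :=
      Subtype.property (n ω) s h hx
    have hrep (y : G) : ∃ (s : τ) (h : σ),
        y = s * (DoubleCoset.mk τ σ y).out * h := by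
      obtain ⟨s, h, hs, hh, hy⟩ := DoubleCoset.mk_out_eq_mul τ σ y
      refine ⟨⟨s, hs⟩⁻¹, ⟨h, hh⟩⁻¹, ?_⟩
      change y = s⁻¹ * _ * h⁻¹
      rw [hy]
      group
    choose a b hab using hrep
    let v (y : G) : N.carrier := fixedScalar κ ρ σ (((ψ (a y))⁻¹ * (χ (b y))⁻¹ : kˣ) : k) •
      val (DoubleCoset.mk τ σ y)
    have hv (ω : DoubleCoset.Quotient (τ : Set G) (σ : Set G)) (s : τ) (h : σ) :
        v (s * ω.out * h) = fixedScalar κ ρ σ (((ψ s)⁻¹ * (χ h)⁻¹ : kˣ) : k) • val ω := by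
      have hmk : DoubleCoset.mk τ σ (s * ω.out * h) = ω := by
        conv_rhs => rw [← DoubleCoset.out_eq' τ σ ω]
        rw [DoubleCoset.eq]
        exact ⟨(s : G)⁻¹, inv_mem s.2, (h : G)⁻¹, inv_mem h.2, by group⟩
      set y := (s : G) * ω.out * h with hy
      have h1 := hab y
      rw [hmk] at h1
      -- Two presentations of `y` in the double coset differ by a pair that fixes the
      -- representative, so compatibility makes `v` independent of the chosen presentation.
      have h2 := hval ω (s⁻¹ * a y) (b y * h⁻¹) <| calc
        (s : G)⁻¹ * a y * ω.out * (b y * (h : G)⁻¹)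
            = (s : G)⁻¹ * (a y * ω.out * b y) * (h : G)⁻¹ := by group
        _ = (s : G)⁻¹ * y * (h : G)⁻¹ := by rw [← h1]
        _ = ω.out := by rw [hy]; group
      simp only [v]
      rw [hmk]
      conv_lhs => rw [← h2]
      rw [smul_smul, ← map_mul, ← Units.val_mul, map_mul, map_mul, map_inv, map_inv,
        inv_mul_inv_mul_mul_inv]
    have hv1 (ω : DoubleCoset.Quotient (τ : Set G) (σ : Set G)) : v ω.out = val ω := by
      have := hv ω 1 1
      simpa using this
    have hrep' (y : G) : ∃ (ω : DoubleCoset.Quotient (τ : Set G) (σ : Set G)) (s : τ) (h : σ),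
        y = s * ω.out * h := ⟨_, a y, b y, hab y⟩
    let f : (inducedTwist κ ρ σ χ N).carrier := indMk v fun y t => by
      obtain ⟨ω, s, h, rfl⟩ := hrep' y
      have := hv ω s (h * t)
      rw [Subgroup.coe_mul, ← mul_assoc] at this
      rw [this, hv, smul_smul, ← map_mul, ← Units.val_mul, map_mul, map_inv, mul_inv_rev,
        mul_left_comm]
    have hf : f ∈ eigen κ τ ψ (inducedTwist κ ρ σ χ N) := by
      refine (mem_eigen_inducedTwist_iff hκ).2 ⟨fun y c hc => ?_, fun y t => ?_⟩
      · rw [indVal_mk]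
        obtain ⟨ω, s, h, rfl⟩ := hrep' y
        rw [hv, smul_comm, conjHom_mul, conjHom_mul_apply, smul_transportVal, smul_zero]
        exact fixedIdeal_apply_mem (fun u hu => by
          have := mul_mem (mul_mem (inv_mem s.2) hu) s.2
          simpa using this) hc
      · rw [indVal_mk, indVal_mk]
        obtain ⟨ω, s, h, rfl⟩ := hrep' y
        have := hv ω (t * s) h
        rw [Subgroup.coe_mul, mul_assoc (t : G), mul_assoc (t : G)] at this
        rw [this, hv, smul_smul, ← map_mul, ← Units.val_mul, map_mul, map_inv, mul_inv,
          mul_assoc]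
    refine ⟨⟨f, hf⟩, funext fun ω => Subtype.ext (transportVal_injective ?_)⟩
    exact hv1 ω

open scoped Classical in
include hκ in
theorem mk_eigenSheaf_inducedTwist [Fintype (DoubleCoset.Quotient (τ : Set G) (σ : Set G))] :
    EquivK0.mk (eigenSheaf κ τ ψ (inducedTwist κ ρ σ χ N)) =
      ∑ ω : DoubleCoset.Quotient (τ : Set G) (σ : Set G),
        if AgreeAt ψ χ ω.out then EquivK0.mk (transport ρ σ τ ω.out N) else 0 := by
  rw [EquivK0.mk_eq_sum_of_bijective _ _ (fun _ => EquivSheaf.isEquivariant_of_subsingleton _)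
    (evalAt_bijective κ τ ψ χ N hκ)]
  exact Finset.sum_congr rfl fun ω _ => mk_agreeSheaf κ τ ψ χ ω.out N

end Mackey

/-! ### Restriction of characters to the intersection with a conjugate -/

section CharacterMackey

variable {k : Type u} [Field k] {G : Type u} [Group G] (σ τ : Subgroup G) (x : G)

/-- The homomorphism `d ↦ x⁻¹ d x` from `τ ∩ x σ x⁻¹` to `σ`. -/
def conjBack : (τ ⊓ σ.map (MulAut.conj x).toMonoidHom : Subgroup G) →* σ where
  toFun d := ⟨x⁻¹ * d * x, by
    obtain ⟨h, hh, hd⟩ := d.2.2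
    rw [← hd]
    simpa [mul_assoc] using hh⟩
  map_one' := Subtype.ext (by simp)
  map_mul' d d' := Subtype.ext (by
    change x⁻¹ * (d * d') * x = x⁻¹ * d * x * (x⁻¹ * d' * x)
    group)

theorem conjBack_coe (d : (τ ⊓ σ.map (MulAut.conj x).toMonoidHom : Subgroup G)) :
    (conjBack σ τ x d : G) = x⁻¹ * d * x := rfl

variable {σ τ x}

theorem agreeAt_iff {ψ : τ →* kˣ} {χ : σ →* kˣ} : AgreeAt ψ χ x ↔
    ψ.comp (Subgroup.inclusion inf_le_left) = χ.comp (conjBack σ τ x) := by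
  constructor
  · intro h
    refine MonoidHom.ext fun d => ?_
    have := h (Subgroup.inclusion inf_le_left d) (conjBack σ τ x d)⁻¹ (by
      rw [Subgroup.coe_inv, conjBack_coe, Subgroup.coe_inclusion]
      group)
    rwa [map_inv, mul_inv_eq_one] at this
  · intro h s t hst
    have ht : (t : G) = x⁻¹ * (s : G)⁻¹ * x := by
      calc (t : G) = (s * x : G)⁻¹ * (s * x * t) := by group
        _ = (s * x : G)⁻¹ * x := by rw [hst]
        _ = x⁻¹ * (s : G)⁻¹ * x := by group
    have hs : (s : G) ∈ σ.map (MulAut.conj x).toMonoidHom :=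
      ⟨(t : G)⁻¹, inv_mem t.2, by simp [ht, mul_assoc]⟩
    have h1 : ψ s = χ (conjBack σ τ x ⟨s, s.2, hs⟩) :=
      DFunLike.congr_fun h ⟨(s : G), s.2, hs⟩
    have h2 : conjBack σ τ x ⟨s, s.2, hs⟩ = t⁻¹ := Subtype.ext (by
      rw [conjBack_coe, Subgroup.coe_inv, ht]
      group)
    rw [h1, h2, map_inv, inv_mul_cancel]

theorem charRes_comp {σ D E : Subgroup G} (i : D →* σ) (j : E →* D) (r : RepRing k σ) :
    charRes (i.comp j) r = charRes j (charRes i r) := by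
  have : charRes (k := k) (i.comp j) = charRes j ∘ₗ charRes i :=
    MonoidAlgebra.lhom_ext' fun χ => LinearMap.ext fun c => by simp [MonoidHom.comp_assoc]
  rw [this, LinearMap.comp_apply]

variable [Finite G] [HasEnoughRootsOfUnity k (Nat.card G)]

variable (σ τ x) in
/-- The map `Rσ → Rτ` given by restriction to `τ ∩ x σ x⁻¹`, followed by induction. -/
def conjTransfer : RepRing k σ →ₗ[Coeff G] RepRing k τ :=
  charInd (Subgroup.inclusion inf_le_left) ∘ₗ charRes (conjBack σ τ x)

open scoped Classical in
-- The same condition `AgreeAt` governs the eigensheaves of an induced sheaf; this matches Mackey's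
-- formula for sheaves with that for characters.
theorem conjTransfer_single (χ : σ →* kˣ) (c : Coeff G) :
    conjTransfer σ τ x (MonoidAlgebra.single χ c : RepRing k σ) =
      c • ∑ ψ : τ →* kˣ,
        if AgreeAt ψ χ x then (MonoidAlgebra.single ψ 1 : RepRing k τ) else 0 := by
  rw [conjTransfer, LinearMap.comp_apply, charRes_single, charInd_single]
  simp only [agreeAt_iff]

/-- If the intersection is proper in `τ`, the projection kills what is induced from it. Otherwise
`τ` is properly contained in the conjugate of `σ`, and primitive elements of `Rσ` already restrict
to zero. -/
theorem primitiveProj_conjTransfer_eq_zero [IsCyclic σ] [IsCyclic τ]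
    (h : τ ≠ σ.map (MulAut.conj x).toMonoidHom) {r : RepRing k σ} (hr : r ∈ PrimitivePart k σ) :
    primitiveProj k τ (conjTransfer σ τ x r) = 0 := by
  by_cases hD : τ ⊓ σ.map (MulAut.conj x).toMonoidHom < τ
  · exact primitiveProj_charInd hD _
  · have hle : τ ≤ σ.map (MulAut.conj x).toMonoidHom :=
      inf_eq_left.1 ((le_iff_eq_or_lt.1 inf_le_left).resolve_right hD)
    -- The subgroup `x⁻¹ τ x` of `σ`, through which `conjBack` factors.
    let E : Subgroup G := (conjBack σ τ x).range.map σ.subtype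
    have hEσ : E ≤ σ := Subgroup.map_subtype_le _
    have hE : E < σ := by
      refine lt_of_le_of_ne hEσ fun he => h (le_antisymm hle ?_)
      rintro _ ⟨s, hs, rfl⟩
      rw [← he] at hs
      obtain ⟨_, ⟨d, rfl⟩, hd⟩ := hs
      rw [← hd]
      change x * (x⁻¹ * d * x) * x⁻¹ ∈ τ
      simpa [mul_assoc] using d.2.1
    let j : (τ ⊓ σ.map (MulAut.conj x).toMonoidHom : Subgroup G) →* E :=
      (σ.subtype.comp (conjBack σ τ x)).codRestrict E fun d => ⟨_, ⟨d, rfl⟩, rfl⟩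
    have hj : conjBack σ τ x = (Subgroup.inclusion hEσ).comp j := rfl
    rw [conjTransfer, LinearMap.comp_apply, hj, charRes_comp, mem_primitivePart_iff.1 hr E hE,
      map_zero, map_zero, map_zero]

theorem conjTransfer_normalizer (g : Subgroup.normalizer (σ : Set G)) (r : RepRing k σ) :
    conjTransfer σ σ (g : G) r = normalizerActRep k σ g r := by
  classical
  suffices conjTransfer (k := k) σ σ (g : G) = (normalizerActRep k σ g).toLinearMap from
    LinearMap.congr_fun this r
  refine MonoidAlgebra.lhom_ext' fun χ => LinearMap.ext fun c => ?_
  have hiff (ψ : σ →* kˣ) : AgreeAt ψ χ (g : G) ↔ ψ = normalizerActChar k σ g χ := by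
    have hconj := isConjugateBy_normalizerActChar (k := k) σ g χ
    constructor
    · intro h
      refine MonoidHom.ext fun s => ?_
      have hs := (hconj.symm.mem_iff s).1 s.2
      have h1 := h s (⟨_, hs⟩ : σ)⁻¹ (by simp [mul_assoc])
      rw [map_inv, mul_inv_eq_one] at h1
      rw [h1]
      exact hconj.symm.apply_eq s s.2 hs
    · rintro rfl s t hst
      have ht : (t : G) = (g : G)⁻¹ * ((s⁻¹ : σ) : G) * (g : G)⁻¹⁻¹ := by
        calc (t : G) = (s * g : G)⁻¹ * (s * g * t) := by group
          _ = (s * g : G)⁻¹ * g := by rw [hst]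
          _ = (g : G)⁻¹ * (s : G)⁻¹ * (g : G)⁻¹⁻¹ := by group
      have hs := (hconj.symm.mem_iff _).1 (s⁻¹).2
      have h1 := hconj.symm.apply_eq _ (s⁻¹).2 hs
      have h2 : t = ⟨_, hs⟩ := Subtype.ext ht
      rw [h2, h1, map_inv, mul_inv_cancel]
  change conjTransfer σ σ (g : G) (MonoidAlgebra.single χ c) =
    normalizerActRep k σ g (MonoidAlgebra.single χ c)
  rw [conjTransfer_single]
  simp only [hiff, Finset.sum_ite_eq', Finset.mem_univ, if_true]
  rw [normalizerActRep, MonoidAlgebra.domCongr_single, MonoidAlgebra.smul_single, smul_eq_mul,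
    mul_one]

theorem primitiveProj_conjTransfer_normalizer [IsCyclic σ] (g : Subgroup.normalizer (σ : Set G))
    (r : PrimitivePart k σ) :
    primitiveProj k σ (conjTransfer σ σ (g : G) r) = normalizerActPrimitive k σ g r := by
  rw [conjTransfer_normalizer, primitiveProj_normalizerActRep, primitiveProj_apply_coe]

end CharacterMackey

theorem mem_normalizer_of_eq_map {G : Type*} [Group G] {σ : Subgroup G} {x : G}
    (h : σ = σ.map (MulAut.conj x).toMonoidHom) : x ∈ Subgroup.normalizer (σ : Set G) := fun s => by
  constructor
  · exact fun hs => h.ge ⟨s, hs, rfl⟩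
  · intro hs
    obtain ⟨t, ht, hts⟩ := h.le hs
    rwa [← (MulAut.conj x).injective hts]

/-- As `σ` is normal in its normalizer, the double cosets there are ordinary cosets, so their number
is the index of `σ` and divides `|G|`. -/
theorem card_doubleCoset_normalizer {G : Type*} [Group G] (σ : Subgroup G) :
    Nat.card {ω : DoubleCoset.Quotient (σ : Set G) (σ : Set G) //
      ω.out ∈ Subgroup.normalizer (σ : Set G)} * Nat.card σ =
        Nat.card (Subgroup.normalizer (σ : Set G)) := by
  have hle : σ ≤ Subgroup.normalizer (σ : Set G) := Subgroup.le_normalizer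
  rw [← Nat.card_prod]
  refine Nat.card_congr (Equiv.ofBijective (fun p => ⟨p.1.1.out * p.2, mul_mem p.1.2 (hle p.2.2)⟩)
    ⟨?_, ?_⟩)
  · rintro ⟨⟨ω, hω⟩, s⟩ ⟨⟨ω', hω'⟩, s'⟩ h
    have h1 : ω.out * (s : G) = ω'.out * s' := congrArg Subtype.val h
    have h2 : ω = ω' := by
      rw [← DoubleCoset.out_eq' σ σ ω, ← DoubleCoset.out_eq' σ σ ω', DoubleCoset.eq]
      refine ⟨1, one_mem _, s * (s' : G)⁻¹, mul_mem s.2 (inv_mem s'.2), ?_⟩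
      rw [one_mul, ← mul_assoc, h1, mul_inv_cancel_right]
    subst h2
    rw [Subtype.ext (mul_left_cancel h1)]
  · rintro ⟨x, hx⟩
    obtain ⟨s, t, hs, ht, h⟩ := DoubleCoset.mk_out_eq_mul σ σ x
    have hout : (DoubleCoset.mk σ σ x).out ∈ Subgroup.normalizer (σ : Set G) := by
      rw [h]
      exact mul_mem (mul_mem (hle hs) hx) (hle ht)
    refine ⟨⟨⟨DoubleCoset.mk σ σ x, hout⟩, ⟨t⁻¹ * (x⁻¹ * s⁻¹ * x⁻¹⁻¹), mul_mem (inv_mem ht)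
      ((inv_mem hx s⁻¹).1 (inv_mem hs))⟩⟩, Subtype.ext ?_⟩
    change (DoubleCoset.mk σ σ x).out * (t⁻¹ * (x⁻¹ * s⁻¹ * x⁻¹⁻¹)) = x
    rw [h]
    group

/-! ### The composition of Vistoli's map with the equivariant pieces -/

section Composition

variable {k : Type u} [Field k] {G : Type u} [Group G] [Finite G] {A : Type u} [CommRing A]
  (κ : k →+* A) {ρ : G →* RingAut A}

/-- The map `Rσ ⊗ K₀(X^σ) → Λ ⊗ K₀(G, X)` that carries `χ ⊗ [N]` to the class of the sheaf that is
induced from `N ⊗ χ`. -/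
def inductionMap (ρ : G →* RingAut A) (σ : Subgroup G) :
    RepRing k σ ⊗[ℤ] OrdK0 (FixedRing ρ σ) →ₗ[Coeff G] Coeff G ⊗[ℤ] EquivK0 ρ :=
  (inductionK0 ρ σ).toIntLinearMap.baseChange (Coeff G) ∘ₗ
    (closedPushforward ρ σ).toIntLinearMap.baseChange (Coeff G) ∘ₗ trivialActionMap κ ρ σ

theorem inductionMap_single_tmul (σ : Subgroup G) (χ : σ →* kˣ) (c : Coeff G)
    (N : EquivSheaf (1 : PUnit.{u + 1} →* RingAut (FixedRing ρ σ))) :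
    inductionMap κ ρ σ ((MonoidAlgebra.single χ c : RepRing k σ) ⊗ₜ EquivK0.mk N) =
      c ⊗ₜ EquivK0.mk (inducedTwist κ ρ σ χ N) := by
  have h : trivialActionMap κ ρ σ ((MonoidAlgebra.single χ c : RepRing k σ) ⊗ₜ EquivK0.mk N) =
      c ⊗ₜ EquivK0.mk (EquivSheaf.twist ((Ideal.Quotient.mk (fixedIdeal ρ σ)).comp κ) χ N) := by
    simp [trivialActionMap, EquivK0.map_mk, TensorProduct.smul_tmul']
  rw [inductionMap, LinearMap.comp_apply, LinearMap.comp_apply, h, LinearMap.baseChange_tmul,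
    LinearMap.baseChange_tmul]
  change c ⊗ₜ inductionK0 ρ σ (closedPushforward ρ σ (EquivK0.mk _)) = _
  rw [closedPushforward, EquivK0.map_mk, inductionK0, EquivK0.map_mk]
  rfl

theorem vistoliComponent_apply (σ : Subgroup G) (t : invariants k ρ σ) :
    vistoliComponent κ ρ σ t = inductionMap κ ρ σ
      (TensorProduct.AlgebraTensorModule.map (PrimitivePart k σ).subtype LinearMap.id t.1) := rfl

instance finite_doubleCoset (σ τ : Subgroup G) :
    Finite (DoubleCoset.Quotient (τ : Set G) (σ : Set G)) := Quotient.finite _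

theorem tensorMap_zero_left {R B C D E : Type*} [CommRing R] [AddCommGroup B] [Module R B]
    [AddCommGroup C] [Module R C] [AddCommGroup D] [AddCommGroup E] (f : D →ₗ[ℤ] E) :
    TensorProduct.AlgebraTensorModule.map (0 : B →ₗ[R] C) f = 0 :=
  TensorProduct.AlgebraTensorModule.ext fun b d => by simp

variable [HasEnoughRootsOfUnity k (Nat.card G)] [IsSemisimpleRing A]
  (hκ : ∀ g c, ρ g (κ c) = κ c)

/-- By linearity it suffices to treat `χ ⊗ [N]`; there it is Mackey's formula for eigensheaves with
the sums over `ψ` and over double cosets exchanged. -/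
theorem primitiveComponent_inductionMap (σ τ : Subgroup G) [IsCyclic τ]
    [Fintype (DoubleCoset.Quotient (τ : Set G) (σ : Set G))]
    (z : RepRing k σ ⊗[ℤ] OrdK0 (FixedRing ρ σ)) :
    primitiveComponent κ hκ τ (inductionMap κ ρ σ z) =
      ∑ ω : DoubleCoset.Quotient (τ : Set G) (σ : Set G),
        TensorProduct.AlgebraTensorModule.map (primitiveProj k τ ∘ₗ conjTransfer σ τ ω.out)
          (transportK0 ρ σ τ ω.out).toIntLinearMap z := by
  classical
  induction z with
  | zero => simp
  | add z w hz hw => simp only [map_add, hz, hw, Finset.sum_add_distrib]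
  | tmul r y =>
    obtain ⟨N, N', rfl⟩ := EquivK0.exists_eq_sub y
    suffices h : ∀ N, primitiveComponent κ hκ τ (inductionMap κ ρ σ (r ⊗ₜ EquivK0.mk N)) =
        ∑ ω : DoubleCoset.Quotient (τ : Set G) (σ : Set G),
          TensorProduct.AlgebraTensorModule.map (primitiveProj k τ ∘ₗ conjTransfer σ τ ω.out)
            (transportK0 ρ σ τ ω.out).toIntLinearMap (r ⊗ₜ EquivK0.mk N) by
      simp only [TensorProduct.tmul_sub, map_sub, h, Finset.sum_sub_distrib]
    intro N
    induction r using MonoidAlgebra.induction_linear with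
    | zero => simp
    | add r s hr hs => simp only [TensorProduct.add_tmul, map_add, hr, hs, Finset.sum_add_distrib]
    | single χ c =>
      rw [inductionMap_single_tmul, primitiveComponent_tmul]
      simp only [eigenK0_mk, mk_eigenSheaf_inducedTwist κ τ _ χ N hκ, TensorProduct.tmul_sum]
      rw [Finset.sum_comm]
      refine Finset.sum_congr rfl fun ω _ => ?_
      rw [TensorProduct.AlgebraTensorModule.map_tmul]
      change _ = primitiveProj k τ (conjTransfer σ τ ω.out (MonoidAlgebra.single χ c)) ⊗ₜ
        transportK0 ρ σ τ ω.out (EquivK0.mk N)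
      rw [conjTransfer_single, transportK0_mk, map_smul, map_sum, Finset.smul_sum,
        TensorProduct.sum_tmul]
      refine Finset.sum_congr rfl fun ψ _ => ?_
      split_ifs
      · rfl
      · rw [TensorProduct.tmul_zero, map_zero, smul_zero, TensorProduct.zero_tmul]

theorem primitiveComponent_vistoliComponent (σ τ : Subgroup G) [IsCyclic τ]
    [Fintype (DoubleCoset.Quotient (τ : Set G) (σ : Set G))] (t : invariants k ρ σ) :
    primitiveComponent κ hκ τ (vistoliComponent κ ρ σ t) =
      ∑ ω : DoubleCoset.Quotient (τ : Set G) (σ : Set G),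
        TensorProduct.AlgebraTensorModule.map
          (primitiveProj k τ ∘ₗ conjTransfer σ τ ω.out ∘ₗ (PrimitivePart k σ).subtype)
          (transportK0 ρ σ τ ω.out).toIntLinearMap t.1 := by
  rw [vistoliComponent_apply, primitiveComponent_inductionMap]
  refine Finset.sum_congr rfl fun ω _ => ?_
  rw [← LinearMap.comp_apply, ← TensorProduct.AlgebraTensorModule.map_comp]
  rfl

theorem primitiveComponent_vistoliComponent_eq_zero {σ τ : Subgroup G} [IsCyclic σ] [IsCyclic τ]
    (h : ∀ x : G, τ ≠ σ.map (MulAut.conj x).toMonoidHom) (t : invariants k ρ σ) :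
    primitiveComponent κ hκ τ (vistoliComponent κ ρ σ t) = 0 := by
  let := Fintype.ofFinite (DoubleCoset.Quotient (τ : Set G) (σ : Set G))
  rw [primitiveComponent_vistoliComponent]
  refine Finset.sum_eq_zero fun ω _ => ?_
  have : primitiveProj k τ ∘ₗ conjTransfer σ τ ω.out ∘ₗ (PrimitivePart k σ).subtype = 0 :=
    LinearMap.ext fun r => primitiveProj_conjTransfer_eq_zero (h ω.out) r.2
  rw [this, tensorMap_zero_left, LinearMap.zero_apply]

/-- A double coset outside the normalizer contributes zero, and one inside acts through its
representative, which fixes the invariant element `t`. -/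
theorem primitiveComponent_vistoliComponent_self {σ : Subgroup G} [IsCyclic σ]
    (t : invariants k ρ σ) :
    primitiveComponent κ hκ σ (vistoliComponent κ ρ σ t) =
      Nat.card {ω : DoubleCoset.Quotient (σ : Set G) (σ : Set G) //
        ω.out ∈ Subgroup.normalizer (σ : Set G)} • t.1 := by
  classical
  let := Fintype.ofFinite (DoubleCoset.Quotient (σ : Set G) (σ : Set G))
  rw [primitiveComponent_vistoliComponent, Nat.card_eq_fintype_card, Fintype.card_subtype,
    ← Finset.sum_const, Finset.sum_filter]
  refine Finset.sum_congr rfl fun ω _ => ?_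
  split_ifs with hω
  · refine Eq.trans ?_ (t.2 ⟨ω.out, hω⟩)
    have h1 : primitiveProj k σ ∘ₗ conjTransfer σ σ ω.out ∘ₗ (PrimitivePart k σ).subtype =
        normalizerActPrimitive k σ ⟨ω.out, hω⟩ :=
      LinearMap.ext fun r => primitiveProj_conjTransfer_normalizer ⟨ω.out, hω⟩ r
    rw [h1, ← transportK0_normalizer]
  · have hne : σ ≠ σ.map (MulAut.conj ω.out).toMonoidHom := fun h => hω (mem_normalizer_of_eq_map h)
    have : primitiveProj k σ ∘ₗ conjTransfer σ σ ω.out ∘ₗ (PrimitivePart k σ).subtype = 0 :=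
      LinearMap.ext fun r => primitiveProj_conjTransfer_eq_zero hne r.2
    rw [this, tensorMap_zero_left, LinearMap.zero_apply]

end Composition

/-! ### Bijectivity over a semisimple ring -/

section Bijective

variable {k : Type u} [Field k] {G : Type u} [Group G] [Finite G]
  [HasEnoughRootsOfUnity k (Nat.card G)] {A : Type u} [CommRing A] [IsSemisimpleRing A]
  (κ : k →+* A) {ρ : G →* RingAut A} (hκ : ∀ g c, ρ g (κ c) = κ c)

theorem primitiveComponent_vistoliMap {S : Finset (Subgroup G)} (hS : IsCyclicRepresentatives S)
    (t : ∀ σ : S, invariants k ρ (σ : Subgroup G)) (σ : S) [IsCyclic (σ : Subgroup G)] :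
    primitiveComponent κ hκ (σ : Subgroup G) (vistoliMap κ ρ S t) =
      Nat.card {ω : DoubleCoset.Quotient ((σ : Subgroup G) : Set G) ((σ : Subgroup G) : Set G) //
        ω.out ∈ Subgroup.normalizer ((σ : Subgroup G) : Set G)} • (t σ).1 := by
  classical
  rw [vistoliMap, LinearMap.sum_apply, map_sum, Finset.sum_eq_single σ]
  · exact primitiveComponent_vistoliComponent_self κ hκ (t σ)
  · intro σ' _ hne
    have := hS.1 σ' σ'.2
    refine primitiveComponent_vistoliComponent_eq_zero κ hκ (fun x hx => hne (Subtype.ext ?_)) _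
    exact (hS.2 (σ : Subgroup G) inferInstance).unique ⟨σ'.2, x, hx⟩
      ⟨σ.2, 1, by
        ext s
        simp⟩
  · simp

include hκ in
/-- Vistoli's map is bijective for a semisimple ring `A`, that is for a `0`-dimensional reduced
scheme. -/
theorem vistoliMap_bijective {S : Finset (Subgroup G)} (hS : IsCyclicRepresentatives S) :
    Function.Bijective (vistoliMap κ ρ S) := by
  have hcyc (σ : S) : IsCyclic (σ : Subgroup G) := hS.1 σ σ.2
  let c (σ : S) : ℕ :=
    Nat.card {ω : DoubleCoset.Quotient ((σ : Subgroup G) : Set G) ((σ : Subgroup G) : Set G) //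
      ω.out ∈ Subgroup.normalizer ((σ : Subgroup G) : Set G)}
  have hc (σ : S) : IsUnit (c σ : Coeff G) := isUnit_natCast_coeff
    ((Dvd.intro _ (card_doubleCoset_normalizer (σ : Subgroup G))).trans
      (Subgroup.card_subgroup_dvd_card _))
  have hmap (t : ∀ σ : S, invariants k ρ (σ : Subgroup G)) (σ : S) :
      primitiveComponent κ hκ (σ : Subgroup G) (vistoliMap κ ρ S t) = (c σ : Coeff G) • (t σ).1 :=
    (primitiveComponent_vistoliMap κ hκ hS t σ).trans (Nat.cast_smul_eq_nsmul _ _ _).symm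
  refine ⟨fun t t' h => funext fun σ => Subtype.ext ((hc σ).smul_left_cancel.1 ?_), fun x => ?_⟩
  · rw [← hmap t σ, h, hmap t' σ]
  -- The preimage is formed from the components of `x` divided by the indices `c σ`; its image and
  -- `x` have the same components.
  · let t (σ : S) : invariants k ρ (σ : Subgroup G) :=
      ((hc σ).unit⁻¹ : (Coeff G)ˣ).1 • ⟨primitiveComponent κ hκ (σ : Subgroup G) x,
        primitiveComponent_mem_invariants κ hκ _ x⟩
    refine ⟨t, sub_eq_zero.1 (eq_zero_of_primitiveComponent κ hκ hS fun σ hσ _ => ?_)⟩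
    have h : (c ⟨σ, hσ⟩ : Coeff G) • (t ⟨σ, hσ⟩).1 = primitiveComponent κ hκ σ x := by
      change (c ⟨σ, hσ⟩ : Coeff G) • ((hc ⟨σ, hσ⟩).unit⁻¹ : (Coeff G)ˣ).1 •
        primitiveComponent κ hκ σ x = _
      rw [smul_smul, IsUnit.mul_val_inv, one_smul]
    rw [map_sub, sub_eq_zero]
    exact (hmap t ⟨σ, hσ⟩).trans h

end Bijective

/-! ### From the scheme to its ring of functions -/

theorem natCast_ne_zero_of_coprime_ringExpChar {k : Type*} [Field k] {n : ℕ} (hn : n ≠ 0)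
    (h : n.Coprime (ringExpChar k)) : (n : k) ≠ 0 := by
  obtain ⟨p, hp⟩ := ExpChar.exists k
  rw [ringExpChar.eq k p] at h
  cases hp with
  | zero => exact Nat.cast_ne_zero.2 hn
  | prime hp =>
    rw [Ne, CharP.cast_eq_zero_iff k p]
    exact fun hd => hp.one_lt.ne' (Nat.Coprime.eq_one_of_dvd h.symm hd)

/-- The polynomial `Φ_n` divides `X ^ n - 1` and so has a root in `k`, which is a primitive `n`-th
root of unity because `n ≠ 0` in `k`. -/
theorem hasEnoughRootsOfUnity_of_splits {k : Type*} [Field k] {n : ℕ} (hn : (n : k) ≠ 0)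
    (hk : (Polynomial.X ^ n - 1 : Polynomial k).Splits) : HasEnoughRootsOfUnity k n := by
  have : NeZero (n : k) := ⟨hn⟩
  have : NeZero n := NeZero.of_neZero_natCast k
  have hsep := Polynomial.X_pow_sub_one_separable_iff.2 hn
  have hs := hk.of_dvd hsep.ne_zero (Polynomial.cyclotomic.dvd_X_pow_sub_one n k)
  obtain ⟨ζ, hζ⟩ := hs.exists_eval_eq_zero (Polynomial.degree_cyclotomic_pos n k (NeZero.pos n)).ne'
  exact ⟨⟨ζ, Polynomial.isRoot_cyclotomic_iff.1 hζ⟩, rootsOfUnity.isCyclic k n⟩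

theorem functionAct_constants {k : Type u} [Field k] {G : Type u} [Group G]
    {X : Over (Spec (.of k))} (ρ : G →* Aut X) (g : G) (c : k) :
    functionAct ρ g (constants X c) = constants X c := by
  change (X.hom.appTop ≫ (ρ g⁻¹).hom.left.appTop) ((Scheme.ΓSpecIso (.of k)).inv c) =
    X.hom.appTop ((Scheme.ΓSpecIso (.of k)).inv c)
  rw [← Scheme.Hom.comp_appTop, Over.w]

/-- A disjoint union of nonempty schemes with finitely many points has finitely many components. -/
theorem finite_of_iso_sigma {Z : Scheme.{u}} [Finite Z] {Y : Type u} (W : Y → Scheme.{u})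
    [∀ y, Nonempty (W y)] (e : Z ≅ ∐ W) : Finite Y := by
  refine Finite.of_injective
    (fun y => e.inv (Limits.Sigma.ι W y (Classical.arbitrary (W y)))) fun y y' h => ?_
  have h' := e.inv.homeomorph.injective h
  exact congrArg Sigma.fst ((sigmaι_eq_iff W y y' _ _).1 h')

theorem isSemisimpleRing_of_iso_sigma {Z : Scheme.{u}} {Y : Type u} [Finite Y] (F : Y → Type u)
    [∀ y, Field (F y)] (e : Z ≅ ∐ fun y => Spec (.of (F y))) : IsSemisimpleRing Γ(Z, ⊤) := by
  let i : Z ≅ Spec (.of (∀ y, F y)) := e ≪≫ asIso (sigmaSpec fun y => .of (F y))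
  let j : CommRingCat.of (∀ y, F y) ≅ Γ(Z, ⊤) :=
    (Scheme.ΓSpecIso _).symm ≪≫ (Scheme.Γ.mapIso i.op)
  exact j.commRingCatIsoToRingEquiv.isSemisimpleRing

end VistoliK

theorem proposition3p1 {k : Type u} [Field k] {G : Type u} [Group G] [Finite G]
    (hG : (Nat.card G).Coprime (ringExpChar k))
    (hk : (Polynomial.X ^ Nat.card G - 1 : Polynomial k).Splits)
    (S : Finset (Subgroup G)) (hS : VistoliK.IsCyclicRepresentatives S)
    (X : Over (Spec (.of k))) (ρ : G →* Aut X)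
    {Y : Type u} (F : Y → Type u) [∀ y, Field (F y)]
    (hX : Nonempty (X.left ≅ ∐ fun y => Spec (.of (F y))))
    (hρ : ∀ x y : X.left, ∃ g : G, (ρ g).hom.left x = y) :
    Function.Bijective
      (VistoliK.vistoliMap (VistoliK.constants X) (VistoliK.functionAct ρ) S) := by
  obtain ⟨e⟩ := hX
  have : HasEnoughRootsOfUnity k (Nat.card G) := VistoliK.hasEnoughRootsOfUnity_of_splits
    (VistoliK.natCast_ne_zero_of_coprime_ringExpChar Nat.card_pos.ne' hG) hk
  -- Transitivity enters here: the points form one orbit of a finite group, unless `X` is empty.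
  -- Hence `Y` is finite and the ring of functions is a finite product of fields.
  have : Finite X.left := by
    cases isEmpty_or_nonempty X.left with
    | inl _ => infer_instance
    | inr h => exact Finite.of_surjective (fun g => (ρ g).hom.left h.some) (hρ h.some)
  have : Finite Y := VistoliK.finite_of_iso_sigma (fun y => Spec (.of (F y))) e
  have : IsSemisimpleRing Γ(X.left, ⊤) := VistoliK.isSemisimpleRing_of_iso_sigma F e
  exact VistoliK.vistoliMap_bijective _ (VistoliK.functionAct_constants ρ) hS
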